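/- A timed pushdown automaton (TPDA) is a tuple $\mathcal P=\langle\Sigma,\Gamma,L,X,Z,\Delta\rangle$ consisting of finite sets $\Sigma$ (input alphabet), $\Gamma$ (stack alphabet), $L$ (control locations), $X$ (global clocks) and $Z$ (stack clocks, disjoint from $X$), and a finite set $\Delta$ of transition rules $\ell\xrightarrow{op} r$ with $\ell,r\in L$, where $op$ is one of: $\mathsf{elapse}$; an input $a\in\Sigma\cup\{\varepsilon\}$; a test of a clock constraint $\varphi$ over $X$; a reset of a set $Y\subseteq X$ of clocks; $\mathsf{push}(\gamma:\psi)$ or $\mathsf{pop}(\gamma:\psi)$ with $\gamma\in\Gamma$ and $\psi$ a clock constraint over $X\cup Z$. A clock constraint is a boolean combination of atomic constraints $\lfloor x\rfloor\le k$, $\lfloor x\rfloor\equiv k \pmod m$, $\{x\}=0$, $\lfloor x\rfloor-\lfloor y\rfloor\le k$, $\lfloor x\rfloor-\lfloor y\rfloor\equiv k\pmod m$, $\{x\}\le\{y\}$, where $x,y$ are clocks, $k\in\mathbb Z$, $m\ge 1$ is an integer, and $\lfloor\cdot\rfloor$, $\{\cdot\}$ denote integer and fractional part. A configuration is a triple $\langle\ell,\mu,u\rangle$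 with $\ell\in L$, $\mu\in\mathbb Q_{\ge0}^X$, and $u\in(\Gamma\times\mathbb Q_{\ge0}^Z)^*$ a timed stack. For a rule $\ell\xrightarrow{op}r$ of $\Delta$ there is a transition from $\langle\ell,\mu,u\rangle$ to $\langle r,\nu,v\rangle$ as follows. If $op=\mathsf{elapse}$: with label $\delta\in\mathbb Q_{\ge0}$, where all global clocks and all clocks in the stack increase by $\delta$. If $op=a\in\Sigma\cup\{\varepsilon\}$: with label $a$, where $\nu=\mu$, $v=u$. In the remaining cases the label is $\varepsilon$: for a test $\varphi$, $\mu\models\varphi$, $\nu=\mu$, $v=u$; for a reset of $Y$, $v=u$ and $\nu$ is $\mu$ with the clocks of $Y$ set to $0$; for $\mathsf{push}(\gamma:\psi)$, $\nu=\mu$ and $v=u\cdot\langle\gamma,\zeta\rangle$ for some $\zeta\in\mathbb Q_{\ge0}^Z$ with $(\mu,\zeta)\models\psi$; for $\mathsf{pop}(\gamma:\psi)$, $\nu=\mu$ and $u=v\cdot\langle\gamma,\zeta\rangle$ for some $\zeta\in\mathbb Q_{\ge0}^Z$ with $(\mu,\zeta)\models\psi$. For $\ell,r\in L$, the timed language $L(\ell,r)$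 is the set of the timed words $\delta_1a_1\cdots\delta_na_n\in(\mathbb Q_{\ge0}\Sigma)^*$ read along the finite runs from $\langle\ell,\mathbf 0,\varepsilon\rangle$ to $\langle r,\mathbf 0,\varepsilon\rangle$ (all global clocks $0$ and empty stack at both ends), where $\varepsilon$'s are removed, $\delta_i$ is the total time elapsed between the letters $a_{i-1}$ and $a_i$ (from the start of the run if $i=1$), and time elapsing after the last letter is not recorded. The untimed language $L^{\mathrm{un}}(\ell,r)\subseteq\Sigma^*$ consists of the words $a_1\cdots a_n$ for $\delta_1a_1\cdots\delta_na_n\in L(\ell,r)$. **Theorem.** Untimed TPDA languages are effectively context-free: for every TPDA $\mathcal P$ and all control locations $\ell,r$, the language $L^{\mathrm{un}}(\ell,r)$ is context-free, and there is one algorithm (a total computable function) that, given (a finite description of) $\mathcal P$, $\ell$ and $r$, outputs a context-free grammar that generates $L^{\mathrm{un}}(\ell,r)$. -/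

import Mathlib

namespace TimedPushdown

/-- Atomic clock constraints over a set `V` of clocks. -/
inductive Atom (V : Type*) where
  /-- `⌊x⌋ ≤ k` -/
  | floorLe (x : V) (k : ℤ)
  /-- `⌊x⌋ ≡ k (mod m)` -/
  | floorMod (x : V) (m : ℕ+) (k : ℤ)
  /-- `{x} = 0` -/
  | fracZero (x : V)
  /-- `⌊x⌋ - ⌊y⌋ ≤ k` -/
  | diffLe (x y : V) (k : ℤ)
  /-- `⌊x⌋ - ⌊y⌋ ≡ k (mod m)` -/
  | diffMod (x y : V) (m : ℕ+) (k : ℤ)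
  /-- `{x} ≤ {y}` -/
  | fracLe (x y : V)

/-- Clock constraints: boolean combinations of atomic clock constraints. -/
inductive Constraint (V : Type*) where
  | tru
  | atom (a : Atom V)
  | neg (φ : Constraint V)
  | conj (φ ψ : Constraint V)
  | disj (φ ψ : Constraint V)

/-- Clock valuations: maps from clocks to the non-negative rationals. -/
abbrev Valuation (V : Type*) := V → NNRat

section Constraints

variable {V W : Type*}

/-- `a.Holds μ` : the valuation `μ` satisfies the atomic constraint `a`. -/
def Atom.Holds (μ : Valuation V) : Atom V → Prop
  | .floorLe x k => ⌊(μ x : ℚ)⌋ ≤ k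
  | .floorMod x m k => ⌊(μ x : ℚ)⌋ ≡ k [ZMOD (m : ℤ)]
  | .fracZero x => Int.fract (μ x : ℚ) = 0
  | .diffLe x y k => ⌊(μ x : ℚ)⌋ - ⌊(μ y : ℚ)⌋ ≤ k
  | .diffMod x y m k => ⌊(μ x : ℚ)⌋ - ⌊(μ y : ℚ)⌋ ≡ k [ZMOD (m : ℤ)]
  | .fracLe x y => Int.fract (μ x : ℚ) ≤ Int.fract (μ y : ℚ)

/-- `φ.Holds μ` : the valuation `μ` satisfies the clock constraint `φ`. -/
def Constraint.Holds (μ : Valuation V) : Constraint V → Prop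
  | .tru => True
  | .atom a => a.Holds μ
  | .neg φ => ¬ φ.Holds μ
  | .conj φ ψ => φ.Holds μ ∧ ψ.Holds μ
  | .disj φ ψ => φ.Holds μ ∨ ψ.Holds μ

/-- Renaming of clocks. -/
def Atom.map (f : V → W) : Atom V → Atom W
  | .floorLe x k => .floorLe (f x) k
  | .floorMod x m k => .floorMod (f x) m k
  | .fracZero x => .fracZero (f x)
  | .diffLe x y k => .diffLe (f x) (f y) k
  | .diffMod x y m k => .diffMod (f x) (f y) m k
  | .fracLe x y => .fracLe (f x) (f y)

/-- Renaming of clocks. -/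
def Constraint.map (f : V → W) : Constraint V → Constraint W
  | .tru => .tru
  | .atom a => .atom (a.map f)
  | .neg φ => .neg (φ.map f)
  | .conj φ ψ => .conj (φ.map f) (ψ.map f)
  | .disj φ ψ => .disj (φ.map f) (ψ.map f)

end Constraints

/-- Operations of a timed pushdown automaton with input alphabet `S`, stack alphabet `G`,
global clocks `X` and stack clocks `Z`. -/
inductive Op (S G X Z : Type*) where
  /-- let time elapse -/
  | elapse
  /-- read an input letter, or nothing (`none` stands for `ε`) -/
  | input (a : Option S)
  /-- test a constraint on the global clocks -/
  | test (φ : Constraint X)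
  /-- reset the set of the listed global clocks -/
  | reset (Y : List X)
  /-- push a stack symbol, under a constraint on global and stack clocks -/
  | push (g : G) (ψ : Constraint (X ⊕ Z))
  /-- pop a stack symbol, under a constraint on global and stack clocks -/
  | pop (g : G) (ψ : Constraint (X ⊕ Z))

/-- A timed pushdown automaton with input alphabet `S`, stack alphabet `G`, control locations `L`,
global clocks `X` and stack clocks `Z`, given by the list of its (finitely many) transition rules
`(ℓ, op, r)`. Only membership in the list matters. -/
structure TPDA (S G L X Z : Type*) where
  rules : List (L × Op S G X Z × L)

/-- Transition labels: time increments, and input letters or `ε` (which is `none`). -/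
inductive Label (S : Type*) where
  | delay (δ : NNRat)
  | letter (a : Option S)

/-- Configurations. The top of the stack is the head of the list. -/
structure Config (G L X Z : Type*) where
  loc : L
  val : Valuation X
  stack : List (G × Valuation Z)

section Semantics

variable {S G L X Z : Type*}

/-- All clocks advance by `δ`. -/
def Valuation.elapse {V : Type*} (μ : Valuation V) (δ : NNRat) : Valuation V := fun x => μ x + δ

open Classical in
/-- The clocks in `Y` are set to `0`. -/
noncomputable def Valuation.reset {V : Type*} (μ : Valuation V) (Y : List V) : Valuation V :=
  fun x => if x ∈ Y then 0 else μ x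

/-- All clocks in the stack advance by `δ`. -/
def stackElapse (u : List (G × Valuation Z)) (δ : NNRat) : List (G × Valuation Z) :=
  u.map fun p => (p.1, Valuation.elapse p.2 δ)

/-- The one-step transition relation. -/
inductive TPDA.Step (P : TPDA S G L X Z) : Config G L X Z → Label S → Config G L X Z → Prop
  | elapse {ℓ r : L} (μ : Valuation X) (u : List (G × Valuation Z)) (δ : NNRat)
      (h : (ℓ, Op.elapse, r) ∈ P.rules) :
      P.Step ⟨ℓ, μ, u⟩ (.delay δ) ⟨r, Valuation.elapse μ δ, stackElapse u δ⟩
  | input {ℓ r : L} (μ : Valuation X) (u : List (G × Valuation Z)) (a : Option S)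
      (h : (ℓ, Op.input a, r) ∈ P.rules) :
      P.Step ⟨ℓ, μ, u⟩ (.letter a) ⟨r, μ, u⟩
  | test {ℓ r : L} (μ : Valuation X) (u : List (G × Valuation Z)) (φ : Constraint X)
      (h : (ℓ, Op.test φ, r) ∈ P.rules) (hφ : φ.Holds μ) :
      P.Step ⟨ℓ, μ, u⟩ (.letter none) ⟨r, μ, u⟩
  | reset {ℓ r : L} (μ : Valuation X) (u : List (G × Valuation Z)) (Y : List X)
      (h : (ℓ, Op.reset Y, r) ∈ P.rules) :
      P.Step ⟨ℓ, μ, u⟩ (.letter none) ⟨r, Valuation.reset μ Y, u⟩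
  | push {ℓ r : L} (μ : Valuation X) (u : List (G × Valuation Z)) (g : G)
      (ψ : Constraint (X ⊕ Z)) (ζ : Valuation Z)
      (h : (ℓ, Op.push g ψ, r) ∈ P.rules) (hψ : ψ.Holds (Sum.elim μ ζ)) :
      P.Step ⟨ℓ, μ, u⟩ (.letter none) ⟨r, μ, (g, ζ) :: u⟩
  | pop {ℓ r : L} (μ : Valuation X) (u : List (G × Valuation Z)) (g : G)
      (ψ : Constraint (X ⊕ Z)) (ζ : Valuation Z)
      (h : (ℓ, Op.pop g ψ, r) ∈ P.rules) (hψ : ψ.Holds (Sum.elim μ ζ)) :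
      P.Step ⟨ℓ, μ, (g, ζ) :: u⟩ (.letter none) ⟨r, μ, u⟩

/-- Finite runs, with the sequence of their labels. -/
inductive TPDA.Run (P : TPDA S G L X Z) : Config G L X Z → List (Label S) → Config G L X Z → Prop
  | nil (c : Config G L X Z) : P.Run c [] c
  | cons {c d e : Config G L X Z} {a : Label S} {w : List (Label S)}
      (h : P.Step c a d) (h' : P.Run d w e) : P.Run c (a :: w) e

/-- The timed word `δ₁ a₁ ⋯ δₙ aₙ` over `S` read off a sequence of labels, if time `δ` has elapsed
beforehand: `ε`s are removed, consecutive time elapses are added up, and time that elapses after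
the last letter is not recorded. -/
def timedWordFrom (δ : NNRat) : List (Label S) → List (NNRat × S)
  | [] => []
  | .delay δ' :: w => timedWordFrom (δ + δ') w
  | .letter none :: w => timedWordFrom δ w
  | .letter (some a) :: w => (δ, a) :: timedWordFrom 0 w

/-- The timed language from location `ℓ` to location `r`: timed words of the runs that begin and
end with all global clocks equal to `0` and with the empty stack. -/
def TPDA.timedLanguage (P : TPDA S G L X Z) (ℓ r : L) : Set (List (NNRat × S)) :=
  {v | ∃ w : List (Label S),
    P.Run ⟨ℓ, fun _ => 0, []⟩ w ⟨r, fun _ => 0, []⟩ ∧ timedWordFrom 0 w = v}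

/-- The untimed language: time elapses are removed from the words of the timed language. -/
def TPDA.untimedLanguage (P : TPDA S G L X Z) (ℓ r : L) : Language S :=
  {v | ∃ t ∈ P.timedLanguage ℓ r, t.map Prod.snd = v}

end Semantics

section Codes

/-- Atoms as a sum of products. -/
def Atom.equivSum (V : Type*) :
    Atom V ≃ (V × ℤ) ⊕ (V × ℕ+ × ℤ) ⊕ V ⊕ (V × V × ℤ) ⊕ (V × V × ℕ+ × ℤ) ⊕ (V × V) where
  toFun
    | .floorLe x k => .inl (x, k)
    | .floorMod x m k => .inr (.inl (x, m, k))
    | .fracZero x => .inr (.inr (.inl x))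
    | .diffLe x y k => .inr (.inr (.inr (.inl (x, y, k))))
    | .diffMod x y m k => .inr (.inr (.inr (.inr (.inl (x, y, m, k)))))
    | .fracLe x y => .inr (.inr (.inr (.inr (.inr (x, y)))))
  invFun
    | .inl (x, k) => .floorLe x k
    | .inr (.inl (x, m, k)) => .floorMod x m k
    | .inr (.inr (.inl x)) => .fracZero x
    | .inr (.inr (.inr (.inl (x, y, k)))) => .diffLe x y k
    | .inr (.inr (.inr (.inr (.inl (x, y, m, k))))) => .diffMod x y m k
    | .inr (.inr (.inr (.inr (.inr (x, y))))) => .fracLe x y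
  left_inv a := by cases a <;> rfl
  right_inv a := by rcases a with a | a | a | a | a | a <;> rfl

instance Atom.instDenumerable {V : Type*} [Denumerable V] : Denumerable (Atom V) :=
  Denumerable.ofEquiv _ (Atom.equivSum V)

/-- Gödel numbers of clock constraints. -/
def Constraint.toNat {V : Type*} [Denumerable V] : Constraint V → ℕ
  | .tru => 0
  | .atom a => 4 * Encodable.encode a + 1
  | .neg φ => 4 * φ.toNat + 2
  | .conj φ ψ => 4 * Nat.pair φ.toNat ψ.toNat + 3
  | .disj φ ψ => 4 * Nat.pair φ.toNat ψ.toNat + 4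

/-- The clock constraint with a given Gödel number. -/
def Constraint.ofNat (V : Type*) [Denumerable V] : ℕ → Constraint V
  | 0 => .tru
  | n + 1 =>
    have h : n / 4 < n + 1 := by omega
    have h₁ : (n / 4).unpair.1 < n + 1 := lt_of_le_of_lt (Nat.unpair_left_le _) h
    have h₂ : (n / 4).unpair.2 < n + 1 := lt_of_le_of_lt (Nat.unpair_right_le _) h
    match n % 4 with
    | 0 => .atom (Denumerable.ofNat (Atom V) (n / 4))
    | 1 => .neg (Constraint.ofNat V (n / 4))
    | 2 => .conj (Constraint.ofNat V (n / 4).unpair.1) (Constraint.ofNat V (n / 4).unpair.2)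
    | _ => .disj (Constraint.ofNat V (n / 4).unpair.1) (Constraint.ofNat V (n / 4).unpair.2)

theorem Constraint.ofNat_toNat {V : Type*} [Denumerable V] (φ : Constraint V) :
    Constraint.ofNat V φ.toNat = φ := by
  induction φ with
  | tru => simp [Constraint.toNat, Constraint.ofNat]
  | atom a =>
    rw [Constraint.toNat, Constraint.ofNat, Nat.mul_mod_right]
    have h₂ : 4 * Encodable.encode a / 4 = Encodable.encode a := by omega
    simp only [h₂, Denumerable.ofNat_encode]
  | neg φ ih =>
    rw [Constraint.toNat, Constraint.ofNat]
    have h₁ : (4 * φ.toNat + 1) % 4 = 1 := by omega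
    have h₂ : (4 * φ.toNat + 1) / 4 = φ.toNat := by omega
    rw [h₁, h₂]
    simp only [ih]
  | conj φ ψ ih ih' =>
    rw [Constraint.toNat, Constraint.ofNat]
    have h₁ : (4 * Nat.pair φ.toNat ψ.toNat + 2) % 4 = 2 := by omega
    have h₂ : (4 * Nat.pair φ.toNat ψ.toNat + 2) / 4 = Nat.pair φ.toNat ψ.toNat := by omega
    rw [h₁, h₂, Nat.unpair_pair]
    simp only [ih, ih']
  | disj φ ψ ih ih' =>
    rw [Constraint.toNat, Constraint.ofNat]
    have h₁ : (4 * Nat.pair φ.toNat ψ.toNat + 3) % 4 = 3 := by omega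
    have h₂ : (4 * Nat.pair φ.toNat ψ.toNat + 3) / 4 = Nat.pair φ.toNat ψ.toNat := by omega
    rw [h₁, h₂, Nat.unpair_pair]
    simp only [ih, ih']

theorem Constraint.toNat_ofNat {V : Type*} [Denumerable V] (n : ℕ) :
    (Constraint.ofNat V n).toNat = n := by
  induction n using Nat.strong_induction_on with
  | _ n ih =>
    cases n with
    | zero => simp [Constraint.toNat, Constraint.ofNat]
    | succ n =>
      have h : n / 4 < n + 1 := by omega
      have e := ih _ h
      have e₁ := ih _ (lt_of_le_of_lt (Nat.unpair_left_le _) h)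
      have e₂ := ih _ (lt_of_le_of_lt (Nat.unpair_right_le _) h)
      rw [Constraint.ofNat]
      have hm : n % 4 = 0 ∨ n % 4 = 1 ∨ n % 4 = 2 ∨ n % 4 = 3 := by omega
      rcases hm with hm | hm | hm | hm
      · simp only [hm, Constraint.toNat, Denumerable.encode_ofNat]; omega
      · simp only [hm, Constraint.toNat, e]; omega
      · simp only [hm, Constraint.toNat, e₁, e₂, Nat.pair_unpair]; omega
      · simp only [hm, Constraint.toNat, e₁, e₂, Nat.pair_unpair]; omega

instance Constraint.instDenumerable {V : Type*} [Denumerable V] : Denumerable (Constraint V) :=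
  Denumerable.mk' ⟨Constraint.toNat, Constraint.ofNat V, Constraint.ofNat_toNat,
    Constraint.toNat_ofNat⟩

/-- Operations as a sum of products. -/
def Op.equivSum (S G X Z : Type*) :
    Op S G X Z ≃ Unit ⊕ Option S ⊕ Constraint X ⊕ List X ⊕
      (G × Constraint (X ⊕ Z)) ⊕ (G × Constraint (X ⊕ Z)) where
  toFun
    | .elapse => .inl ()
    | .input a => .inr (.inl a)
    | .test φ => .inr (.inr (.inl φ))
    | .reset Y => .inr (.inr (.inr (.inl Y)))
    | .push g ψ => .inr (.inr (.inr (.inr (.inl (g, ψ)))))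
    | .pop g ψ => .inr (.inr (.inr (.inr (.inr (g, ψ)))))
  invFun
    | .inl _ => .elapse
    | .inr (.inl a) => .input a
    | .inr (.inr (.inl φ)) => .test φ
    | .inr (.inr (.inr (.inl Y))) => .reset Y
    | .inr (.inr (.inr (.inr (.inl (g, ψ))))) => .push g ψ
    | .inr (.inr (.inr (.inr (.inr (g, ψ))))) => .pop g ψ
  left_inv a := by cases a <;> rfl
  right_inv a := by rcases a with a | a | a | a | a | a <;> rfl

/-- Operations with letters, stack symbols and clocks named by natural numbers. -/
abbrev OpCode := Op ℕ ℕ ℕ ℕ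

instance OpCode.instPrimcodable : Primcodable OpCode :=
  Primcodable.ofEquiv _ (Op.equivSum ℕ ℕ ℕ ℕ)

/-- Renaming of letters, stack symbols and clocks. -/
def Op.map {S S' G G' X X' Z Z' : Type*} (s : S → S') (g : G → G') (x : X → X') (z : Z → Z') :
    Op S G X Z → Op S' G' X' Z'
  | .elapse => .elapse
  | .input a => .input (a.map s)
  | .test φ => .test (φ.map x)
  | .reset Y => .reset (Y.map x)
  | .push γ ψ => .push (g γ) (ψ.map (Sum.map x z))
  | .pop γ ψ => .pop (g γ) (ψ.map (Sum.map x z))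

/-- Finite descriptions of timed pushdown automata: the numbers of input letters, stack symbols,
control locations, global clocks and stack clocks, and the list of the transition rules. -/
abbrev TPDACode := (ℕ × ℕ × ℕ × ℕ × ℕ) × List (ℕ × OpCode × ℕ)

/-- The finite description of a timed pushdown automaton whose finite sets are `{0, …, n - 1}`. -/
def TPDA.code {s g l x z : ℕ} (P : TPDA (Fin s) (Fin g) (Fin l) (Fin x) (Fin z)) : TPDACode :=
  ((s, g, l, x, z),
    P.rules.map fun ρ => (ρ.1.val, ρ.2.1.map Fin.val Fin.val Fin.val Fin.val, ρ.2.2.val))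

/-- Finite descriptions of context-free grammars: the initial nonterminal and the list of the
rules; `Sum.inl a` is the terminal `a`, and `Sum.inr A` is the nonterminal `A`. -/
abbrev GrammarCode := ℕ × List (ℕ × List (ℕ ⊕ ℕ))

/-- The context-free grammar with a given finite description. -/
def GrammarCode.grammar (c : GrammarCode) : ContextFreeGrammar ℕ where
  NT := ℕ
  initial := c.1
  rules := (c.2.map fun ρ =>
    (⟨ρ.1, ρ.2.map (Sum.elim Symbol.terminal Symbol.nonterminal)⟩ : ContextFreeRule ℕ ℕ)).toFinset

end Codes

end TimedPushdown

namespace TimedPushdown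

open Encodable

/-! The value of a clock is the present time minus the time at which it was last zero. Described by
such rational time stamps, a configuration changes little: elapsing time moves only the present
time, and a stack frame keeps its stamps from push to pop. Hence balanced runs are captured by the
inductive relation `TPDA.Summary`, which is closed under composition and under wrapping in a push
and a matching pop. The frame enters only as an existentially quantified tuple that fits the push
constraint at the initial stamps and the pop constraint at the final ones. By
`TPDA.mem_untimedLanguage_iff` this relation determines the untimed language. It is a context-free
grammar in all but one respect: the tuples of stamps make infinitely many nonterminals.

Finiteness comes from the equivalence `Equi`: differences of floors agree modulo `M` and up to a
threshold `K`, and fractional parts have the same order and the same zeros. Constraints with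
constants at most `C` and moduli dividing `M` do not separate tuples that are equivalent for `K = C
+ 2` (`Equi.holds_iff`), and every tuple is equivalent to a bounded one with a fixed denominator
(`exists_equi_scale`). The derivations `TPDA.Gen` mirror summaries on bounded tuples, with a rule
for passing to an equivalent pair.

The crux is `TPDA.Gen.sound`: abstract derivations must be realised by actual stamps, at any depth
of nesting, without a gradual loss of precision. Composition costs nothing. Stamps that change are
set at or after the start of the run, so the gaps in a composition are sums of nonnegative gaps, and
agreement up to `K` passes to such sums (`IntEq.add`); for fractional parts, one order embedding of
`ℚ` serves for the middle and for the end (`Valid.exists_lift`). Only the choice of a stack frame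
costs precision, a factor of three for each stack clock (`IntCompat.exists_extend`,
`Equi.exists_frame`). The frame is forgotten after the pop, so starting from `K = 3 ^ |Z| * (C + 2 +
M)` these losses do not accumulate. Conversely, `TPDA.Summary.gen` replaces the stamps involved in
each rule by a bounded representative.

For effectiveness, tuples become digit expansions and nonterminals become numbers; the rules are
filtered from a finite range of candidates by the primitive recursive predicate `TPDACode.RuleOk`.
Its main ingredient is the evaluation of constraints in `primrecPred_holds`. Arbitrary finite
alphabets and clock sets reduce to `Fin n` by renaming, followed by an inverse image under an
injective map of letters (`isContextFree_preimage`). -/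

/-- Agreement of two integers modulo `M` and up to the threshold `K`. -/
def IntEq (K M : ℕ) (a b : ℤ) : Prop :=
  a ≡ b [ZMOD (M : ℤ)] ∧ (a = b ∨ ((K : ℤ) < a ∧ (K : ℤ) < b) ∨ (a < -(K : ℤ) ∧ b < -(K : ℤ)))

/-! ### Integers up to a threshold and a modulus. -/

namespace IntEq

variable {K K' M : ℕ} {a b c d : ℤ}

theorem refl (a : ℤ) : IntEq K M a a := ⟨Int.ModEq.refl _, .inl rfl⟩

theorem symm (h : IntEq K M a b) : IntEq K M b a := ⟨h.1.symm, by have := h.2; omega⟩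

theorem trans (h : IntEq K M a b) (h' : IntEq K M b c) : IntEq K M a c :=
  ⟨h.1.trans h'.1, by have := h.2; have := h'.2; omega⟩

theorem mono (hK : K ≤ K') (h : IntEq K' M a b) : IntEq K M a b :=
  ⟨h.1, by have := h.2; omega⟩

theorem neg (h : IntEq K M a b) : IntEq K M (-a) (-b) := ⟨h.1.neg, by have := h.2; omega⟩

theorem sub_comm (h : IntEq K M (a - b) (c - d)) : IntEq K M (b - a) (d - c) := by
  simpa using h.neg

/-- Nonnegative summands cannot cancel: if one of them exceeds the threshold, so does the sum. This
is what makes the composition of runs free of loss. -/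
theorem add (h : IntEq K M a b) (h' : IntEq K M c d) (ha : 0 ≤ a) (hc : 0 ≤ c) :
    IntEq K M (a + c) (b + d) :=
  ⟨h.1.add h'.1, by have := h.2; have := h'.2; omega⟩

/-- A bounded error costs as much of the threshold. -/
theorem add_const (h : IntEq K' M a b) (e : ℤ) (he : K + |e| ≤ K') : IntEq K M (a + e) (b + e) :=
  ⟨h.1.add_right e, by have := h.2; have := neg_abs_le e; have := le_abs_self e; omega⟩

theorem le_iff (h : IntEq K M a b) {k : ℤ} (hk : |k| ≤ K) : a ≤ k ↔ b ≤ k := by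
  have := h.2; have := neg_abs_le k; have := le_abs_self k; omega

theorem modEq_iff (h : IntEq K M a b) {m : ℕ} (hm : m ∣ M) {k : ℤ} :
    a ≡ k [ZMOD (m : ℤ)] ↔ b ≡ k [ZMOD (m : ℤ)] := by
  have h' : a ≡ b [ZMOD (m : ℤ)] := h.1.of_dvd (by exact_mod_cast hm)
  exact ⟨h'.symm.trans, h'.trans⟩

/-- Above the threshold only the residue matters, and the numbers from `K + 1` to `K + M` represent
every residue modulo `M`. -/
theorem exists_small (hM : 0 < M) (ha : 0 ≤ a) : ∃ h : ℕ, h ≤ K + M ∧ IntEq K M a h := by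
  by_cases hK : a ≤ K
  · exact ⟨a.toNat, by omega, by rw [Int.toNat_of_nonneg ha]; exact refl a⟩
  · have h1 := Int.emod_nonneg (a - K - 1) (b := (M : ℤ)) (by omega)
    have h2 := Int.emod_lt_of_pos (a - K - 1) (b := (M : ℤ)) (by omega)
    refine ⟨(K + 1 + (a - K - 1) % M).toNat, by omega, ?_⟩
    rw [Int.toNat_of_nonneg (by omega)]
    refine ⟨?_, by omega⟩
    have : (a - K - 1) % M ≡ a - K - 1 [ZMOD (M : ℤ)] := Int.mod_modEq _ _
    have h3 := (this.symm.add_left ((K : ℤ) + 1))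
    have h4 : (K : ℤ) + 1 + (a - K - 1) = a := by ring
    rwa [h4] at h3

end IntEq

/-- A finite set of integers embeds in an initial segment of the naturals, with agreement of the
differences up to a threshold and a modulus. -/
theorem exists_int_compress {K M : ℕ} (hM : 0 < M) (A : Finset ℤ) :
    ∃ c : ℤ → ℕ, (∀ a ∈ A, c a < A.card * (K + M + 1)) ∧
      ∀ a ∈ A, ∀ b ∈ A, IntEq K M (a - b) ((c a : ℤ) - c b) := by
  classical
  induction A using Finset.induction_on_max with
  | empty => exact ⟨fun _ => 0, by simp, by simp⟩
  | insert a A hlt ih =>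
    obtain ⟨c, hc, hA⟩ := ih
    have haA : a ∉ A := fun h => lt_irrefl _ (hlt a h)
    rw [Finset.card_insert_of_notMem haA]
    rcases A.eq_empty_or_nonempty with rfl | hne
    · refine ⟨fun _ => 0, by simp, ?_⟩
      simpa using IntEq.refl 0
    · have hm := A.max'_mem hne
      set m := A.max' hne
      -- The new maximum is placed a reduced gap `g` above the image of the old one. Its differences
      -- to the other elements are then sums of two nonnegative gaps.
      obtain ⟨g, hg, hg'⟩ := IntEq.exists_small (K := K) (M := M) hM (a := a - m)
        (by have := hlt m hm; omega)
      have key : ∀ b ∈ A, IntEq K M (a - b) (((c m + g : ℕ) : ℤ) - c b) := by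
        intro b hb
        have h1 := hg'.add (hA m hm b hb) (by have := hlt m hm; omega)
          (by have := A.le_max' b hb; omega)
        have e1 : a - m + (m - b) = a - b := by ring
        have e2 : (g : ℤ) + (c m - c b) = ((c m + g : ℕ) : ℤ) - c b := by push_cast; ring
        rwa [e1, e2] at h1
      have hu : ∀ b ∈ A, Function.update c a (c m + g) b = c b := fun b hb =>
        Function.update_of_ne (by rintro rfl; exact haA hb) _ _
      refine ⟨Function.update c a (c m + g), ?_, ?_⟩
      · intro b hb
        rcases Finset.mem_insert.1 hb with rfl | hb
        · rw [Function.update_self]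
          have := hc m hm
          rw [Nat.add_mul]; omega
        · rw [hu b hb]
          have := hc b hb
          rw [Nat.add_mul]; omega
      · intro b hb b' hb'
        rcases Finset.mem_insert.1 hb with rfl | h1 <;>
          rcases Finset.mem_insert.1 hb' with rfl | h2
        · simpa using IntEq.refl 0
        · rw [hu b' h2, Function.update_self]; exact key _ h2
        · rw [hu b h1, Function.update_self]; exact (key _ h1).sub_comm
        · rw [hu b h1, hu b' h2]; exact hA b h1 b' h2

/-- Pairs of integers with differences that agree. -/
def IntCompat (K M : ℕ) (R : Finset (ℤ × ℤ)) : Prop :=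
  ∀ p ∈ R, ∀ q ∈ R, IntEq K M (p.1 - q.1) (p.2 - q.2)

/-- If `c` is within `K + M` of a known point, its offset from that point is copied, at the price of
that much threshold. Otherwise `c` is far from all points, and its partner goes at a distance
between `K + 1` and `K + M` above the partner of the nearest point below, or below the partner of
the least point if none lies below. In the first of these cases the points above `c` remain far:
they are more than `2 * K + M` from the nearest point below, on both sides. -/
theorem IntCompat.exists_point {K K' M : ℕ} (hK : 2 * K + M ≤ K') (hM : 0 < M)
    {R : Finset (ℤ × ℤ)} (hR : IntCompat K' M R) (c : ℤ) :
    ∃ d : ℤ, ∀ p ∈ R, IntEq K M (p.1 - c) (p.2 - d) := by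
  classical
  by_cases hnear : ∃ p ∈ R, |c - p.1| ≤ K + M
  · obtain ⟨p, hp, hpc⟩ := hnear
    refine ⟨p.2 + (c - p.1), fun q hq => ?_⟩
    have := (hR q hq p hp).add_const (K := K) (p.1 - c) (by
      rw [abs_sub_comm] at hpc; omega)
    convert this using 1 <;> ring
  · push Not at hnear
    by_cases hbelow : ∃ p ∈ R, p.1 ≤ c
    · obtain ⟨p, hp, hmax⟩ := (R.filter fun p => p.1 ≤ c).exists_max_image Prod.fst
        (by obtain ⟨p, hp⟩ := hbelow; exact ⟨p, by simpa using hp⟩)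
      simp only [Finset.mem_filter] at hp hmax
      obtain ⟨h, hle, hh⟩ := IntEq.exists_small (K := K) (M := M) hM (a := c - p.1) (by omega)
      refine ⟨p.2 + h, fun q hq => ?_⟩
      have h1 := hR q hq p hp.1
      have hn := hnear q hq
      have hnp := hnear p hp.1
      refine ⟨?_, ?_⟩
      · have := h1.1.sub hh.1
        convert this using 1 <;> ring
      · have h2 := h1.2
        have h3 := hh.2
        rw [abs_of_nonneg (by omega)] at hnp
        by_cases hqc : q.1 ≤ c
        · have := hmax q ⟨hq, hqc⟩
          omega
        · rw [abs_of_neg (by omega)] at hn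
          omega
    · push Not at hbelow
      rcases R.eq_empty_or_nonempty with rfl | hne
      · exact ⟨0, by simp⟩
      · obtain ⟨p, hp, hmin⟩ := R.exists_min_image Prod.fst hne
        have := hbelow p hp
        obtain ⟨h, hle, hh⟩ := IntEq.exists_small (K := K) (M := M) hM (a := p.1 - c) (by omega)
        refine ⟨p.2 - h, fun q hq => ?_⟩
        have h1 := (hR q hq p hp).mono (show K ≤ K' by omega)
        have := h1.add hh (by have := hmin q hq; omega) (by omega)
        convert this using 1 <;> ring

/-- Points are added one by one; since `2 * K + M ≤ 3 * K`, each divides the threshold by three. -/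
theorem IntCompat.exists_extend {K M : ℕ} (hKM : M ≤ K) (hM : 0 < M) (l : List ℤ)
    {R : Finset (ℤ × ℤ)} (hR : IntCompat (3 ^ l.length * K) M R) :
    ∃ R', R ⊆ R' ∧ IntCompat K M R' ∧ ∀ c ∈ l, ∃ d, (c, d) ∈ R' := by
  classical
  induction l generalizing R with
  | nil => exact ⟨R, subset_rfl, by simpa using hR, by simp⟩
  | cons c l ih =>
    have h3 : 1 ≤ 3 ^ l.length := Nat.one_le_pow _ _ (by norm_num)
    have hle : K ≤ 3 ^ l.length * K := Nat.le_mul_of_pos_left _ h3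
    have hle' : 3 ^ l.length * K ≤ 3 ^ (c :: l).length * K := by
      rw [List.length_cons, pow_succ]; nlinarith
    obtain ⟨d, hd⟩ := hR.exists_point (K := 3 ^ l.length * K) (by
      rw [List.length_cons, pow_succ]; nlinarith) hM c
    have hR1 : IntCompat (3 ^ l.length * K) M (insert (c, d) R) := by
      intro p hp q hq
      rcases Finset.mem_insert.1 hp with rfl | hp <;> rcases Finset.mem_insert.1 hq with rfl | hq
      · simpa using IntEq.refl 0
      · exact (hd q hq).sub_comm
      · exact hd p hp
      · exact (hR p hp q hq).mono hle'
    obtain ⟨R', h1, h2, h4⟩ := ih hR1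
    refine ⟨R', fun x hx => h1 (Finset.mem_insert_of_mem hx), h2, fun c' hc' => ?_⟩
    rcases List.mem_cons.1 hc' with rfl | hc'
    · exact ⟨d, h1 (Finset.mem_insert_self _ _)⟩
    · exact h4 c' hc'

/-! ### Order embeddings of the rationals and the equivalence of tuples. -/

/-- A finite partial isomorphism of the order of the rationals extends to a self-embedding. -/
theorem exists_strictMono_extend (f : Order.PartialIso ℚ ℚ) :
    ∃ φ : ℚ → ℚ, StrictMono φ ∧ ∀ p ∈ f.val, φ p.1 = p.2 := by
  classical
  -- Half of Cantor's back-and-forth suffices: a total function is wanted, not a surjective one.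
  let I : Order.Ideal (Order.PartialIso ℚ ℚ) :=
    Order.idealOfCofinals f (Order.PartialIso.definedAtLeft ℚ)
  let F : ∀ a, { b // ∃ g ∈ I, (a, b) ∈ Subtype.val g } := fun a =>
    Order.PartialIso.funOfIdeal a I (Order.cofinal_meets_idealOfCofinals f _ a)
  have key : ∀ a b a' b', (∃ g ∈ I, (a, b) ∈ Subtype.val g) →
      (∃ g ∈ I, (a', b') ∈ Subtype.val g) → cmp a a' = cmp b b' := by
    rintro a b a' b' ⟨g, hg, hab⟩ ⟨g', hg', hab'⟩
    obtain ⟨m, -, hm, hm'⟩ := I.directed _ hg _ hg'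
    exact m.prop (a, b) (hm hab) (a', b') (hm' hab')
  refine ⟨fun a => (F a).1, ?_, ?_⟩
  · intro a b hab
    exact (lt_iff_lt_of_cmp_eq_cmp (key _ _ _ _ (F a).2 (F b).2)).1 hab
  · rintro ⟨a, b⟩ hp
    have := key a (F a).1 a b (F a).2
      ⟨f, Order.mem_idealOfCofinals f _, hp⟩
    rw [cmp_self_eq_eq] at this
    exact cmp_eq_eq_iff _ _ |>.1 this.symm

/-- Tuples of rationals that no clock constraint with threshold `K` and modulus `M` separates. -/
structure Equi {ι : Type*} (K M : ℕ) (u v : ι → ℚ) : Prop where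
  int : ∀ i j, IntEq K M (⌊u i⌋ - ⌊u j⌋) (⌊v i⌋ - ⌊v j⌋)
  frac : ∀ i j, Int.fract (u i) ≤ Int.fract (u j) ↔ Int.fract (v i) ≤ Int.fract (v j)
  -- Matching zeros guarantee that there is room below the least fractional part on one side exactly
  -- if there is on the other.
  zero : ∀ i, Int.fract (u i) = 0 ↔ Int.fract (v i) = 0

/-! ### Floors and fractional parts of differences. -/

theorem rat_le_iff (a b : ℚ) : a ≤ b ↔ ⌊a⌋ < ⌊b⌋ ∨ ⌊a⌋ = ⌊b⌋ ∧ Int.fract a ≤ Int.fract b := by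
  constructor
  · intro h
    rcases (Int.floor_mono h).lt_or_eq with h' | h'
    · exact .inl h'
    · refine .inr ⟨h', ?_⟩
      rw [Int.fract, Int.fract, h']
      linarith
  · rintro (h | ⟨h, h'⟩)
    · have : a < b := Int.floor_lt.1 h |>.trans_le (Int.floor_le b) |> fun h => h
      exact this.le
    · rw [← Int.floor_add_fract a, ← Int.floor_add_fract b, h]
      linarith

theorem floor_sub_eq (a b : ℚ) :
    ⌊a - b⌋ = ⌊a⌋ - ⌊b⌋ + if Int.fract b ≤ Int.fract a then 0 else -1 := by
  have := Int.fract_nonneg a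
  have := Int.fract_lt_one a
  have := Int.fract_nonneg b
  have := Int.fract_lt_one b
  have := Int.floor_add_fract a
  have := Int.floor_add_fract b
  rw [Int.floor_eq_iff]
  split_ifs <;> push_cast <;> constructor <;> linarith

theorem fract_sub_eq (a b : ℚ) :
    Int.fract (a - b) =
      Int.fract a - Int.fract b + if Int.fract b ≤ Int.fract a then 0 else 1 := by
  rw [Int.fract, floor_sub_eq]
  have := Int.floor_add_fract a
  have := Int.floor_add_fract b
  split_ifs <;> push_cast <;> linarith

theorem fract_sub_eq_zero_iff (a b : ℚ) :
    Int.fract (a - b) = 0 ↔ Int.fract a ≤ Int.fract b ∧ Int.fract b ≤ Int.fract a := by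
  have := Int.fract_nonneg a
  have := Int.fract_lt_one b
  rw [fract_sub_eq]
  split_ifs with h
  · constructor
    · intro h'; exact ⟨by linarith, h⟩
    · rintro ⟨h1, h2⟩; linarith
  · constructor
    · intro h'; linarith
    · rintro ⟨h1, h2⟩; exact absurd h2 h

/-- As a function of the fractional part of `b`, that of `a - b` is decreasing up to the fractional
part of `a`, and decreasing again beyond it, with all values of the second range above those of the
first. -/
theorem fract_sub_le_iff (a b c : ℚ) :
    Int.fract (a - b) ≤ Int.fract (a - c) ↔
      (Int.fract b ≤ Int.fract a ∧ ¬ Int.fract c ≤ Int.fract a) ∨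
      ((Int.fract b ≤ Int.fract a ↔ Int.fract c ≤ Int.fract a) ∧ Int.fract c ≤ Int.fract b) := by
  have := Int.fract_nonneg a
  have := Int.fract_lt_one a
  have := Int.fract_nonneg b
  have := Int.fract_lt_one b
  have := Int.fract_nonneg c
  have := Int.fract_lt_one c
  rw [fract_sub_eq, fract_sub_eq]
  by_cases h1 : Int.fract b ≤ Int.fract a <;> by_cases h2 : Int.fract c ≤ Int.fract a <;>
    simp only [h1, h2, if_true, if_false, not_true, not_false_eq_true, and_true, and_false,
      true_and, false_and, false_or, true_or, iff_true] <;>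
    (try constructor) <;> (try intro) <;> first | contradiction | linarith

namespace Equi

variable {ι κ : Type*} {K K' M : ℕ} {u v w : ι → ℚ}

theorem refl (u : ι → ℚ) : Equi K M u u :=
  ⟨fun _ _ => IntEq.refl _, fun _ _ => Iff.rfl, fun _ => Iff.rfl⟩

theorem symm (h : Equi K M u v) : Equi K M v u :=
  ⟨fun i j => (h.int i j).symm, fun i j => (h.frac i j).symm, fun i => (h.zero i).symm⟩

theorem trans (h : Equi K M u v) (h' : Equi K M v w) : Equi K M u w :=
  ⟨fun i j => (h.int i j).trans (h'.int i j), fun i j => (h.frac i j).trans (h'.frac i j),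
    fun i => (h.zero i).trans (h'.zero i)⟩

theorem mono (hK : K ≤ K') (h : Equi K' M u v) : Equi K M u v :=
  ⟨fun i j => (h.int i j).mono hK, h.frac, h.zero⟩

theorem comp (h : Equi K M u v) (f : κ → ι) : Equi K M (fun i => u (f i)) (fun i => v (f i)) :=
  ⟨fun i j => h.int (f i) (f j), fun i j => h.frac (f i) (f j), fun i => h.zero (f i)⟩

theorem le_iff (h : Equi K M u v) (i j : ι) : u i ≤ u j ↔ v i ≤ v j := by
  rw [rat_le_iff (u i), rat_le_iff (v i), h.frac i j]
  have := (h.int i j).2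
  constructor <;> (rintro (h1 | ⟨h1, h2⟩)) <;> first | (left; omega) | (right; exact ⟨by omega, h2⟩)

theorem eq_iff (h : Equi K M u v) (i j : ι) : u i = u j ↔ v i = v j := by
  rw [le_antisymm_iff, le_antisymm_iff, h.le_iff, h.le_iff]

/-- The correspondence of fractional parts of a finite tuple extends to all rationals. -/
theorem exists_strictMono [Finite ι] (h : Equi K M u v) :
    ∃ φ : ℚ → ℚ, StrictMono φ ∧ φ 0 = 0 ∧ φ 1 = 1 ∧
      ∀ i, φ (Int.fract (u i)) = Int.fract (v i) := by
  classical
  have := Fintype.ofFinite ι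
  have hcmp : ∀ {a b c d : ℚ}, (a ≤ b ↔ c ≤ d) → (b ≤ a ↔ d ≤ c) → cmp a b = cmp c d := by
    intro a b c d h1 h2
    rcases lt_trichotomy a b with hab | hab | hab
    · rw [cmp_eq_lt_iff _ _ |>.2 hab, eq_comm, cmp_eq_lt_iff, ← not_le, ← h2]; exact not_le.2 hab
    · rw [cmp_eq_eq_iff _ _ |>.2 hab, eq_comm, cmp_eq_eq_iff]
      exact le_antisymm (h1.1 hab.le) (h2.1 hab.ge)
    · rw [cmp_eq_gt_iff _ _ |>.2 hab, eq_comm, cmp_eq_gt_iff, ← not_le, ← h1]; exact not_le.2 hab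
  -- The pairs `(0, 0)` and `(1, 1)` are adjoined so that `φ` maps the interval `[0, 1)` into
  -- itself.
  let e : Option (Option ι) → ℚ × ℚ
    | none => (0, 0)
    | some none => (1, 1)
    | some (some i) => (Int.fract (u i), Int.fract (v i))
  have he : ∀ i j, (e i).1 ≤ (e j).1 ↔ (e i).2 ≤ (e j).2 := by
    rintro (_ | _ | i) (_ | _ | j)
    all_goals simp only [e, le_refl, zero_le_one, Int.fract_nonneg]
    · simp only [not_le.2 (Int.fract_lt_one (u j)), not_le.2 (Int.fract_lt_one (v j))]
    · have := h.zero i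
      constructor
      · intro h1; exact (this.1 (le_antisymm h1 (Int.fract_nonneg _))).le
      · intro h1; exact (this.2 (le_antisymm h1 (Int.fract_nonneg _))).le
    · simp only [(Int.fract_lt_one (u i)).le, (Int.fract_lt_one (v i)).le]
    · exact h.frac i j
  obtain ⟨φ, hφ, hp⟩ := exists_strictMono_extend ⟨Finset.univ.image e, by
    intro p hp q hq
    obtain ⟨i, -, rfl⟩ := Finset.mem_image.1 hp
    obtain ⟨j, -, rfl⟩ := Finset.mem_image.1 hq
    exact hcmp (he i j) (he j i)⟩
  have hp' : ∀ i, φ (e i).1 = (e i).2 := fun i =>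
    hp (e i) (Finset.mem_image_of_mem _ (Finset.mem_univ i))
  exact ⟨φ, hφ, hp' none, hp' (some none), fun i => hp' (some (some i))⟩

end Equi

/-- `φ` acts on fractional parts. -/
theorem floor_add_of_strictMono {φ : ℚ → ℚ} (hφ : StrictMono φ) (h0 : φ 0 = 0) (h1 : φ 1 = 1)
    (n : ℤ) (a : ℚ) :
    ⌊n + φ (Int.fract a)⌋ = n ∧ Int.fract (n + φ (Int.fract a)) = φ (Int.fract a) := by
  have h2 : 0 ≤ φ (Int.fract a) := by rw [← h0]; exact hφ.monotone (Int.fract_nonneg a)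
  have h3 : φ (Int.fract a) < 1 := by rw [← h1]; exact hφ (Int.fract_lt_one a)
  constructor
  · rw [Int.floor_intCast_add, Int.floor_eq_zero_iff.2 ⟨h2, h3⟩, add_zero]
  · rw [Int.fract_intCast_add, Int.fract_eq_self.2 ⟨h2, h3⟩]

theorem strictMono_eq_zero_iff {φ : ℚ → ℚ} (hφ : StrictMono φ) (h0 : φ 0 = 0) (a : ℚ) :
    φ a = 0 ↔ a = 0 := by
  rw [← h0, hφ.injective.eq_iff, h0]

/-! ### Bounded representatives. -/

/-- A tuple of natural numbers, in units of `1 / N`. -/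
def scale {ι : Type*} (N : ℕ) (p : ι → ℕ) : ι → ℚ := fun i => (p i : ℚ) / N

theorem floor_natCast_div (a N : ℕ) : ⌊(a : ℚ) / N⌋ = ((a / N : ℕ) : ℤ) := by
  rw [← Nat.floor_div_eq_div (K := ℚ) a N, Int.natCast_floor_eq_floor (by positivity)]

theorem fract_natCast_div {N : ℕ} (hN : 0 < N) (a : ℕ) :
    Int.fract ((a : ℚ) / N) = ((a % N : ℕ) : ℚ) / N := by
  have h : (0 : ℚ) < N := by exact_mod_cast hN
  rw [Int.fract, floor_natCast_div, eq_div_iff h.ne', sub_mul, div_mul_cancel₀ _ h.ne']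
  have : (a : ℚ) = ((N * (a / N) + a % N : ℕ) : ℚ) := by rw [Nat.div_add_mod]
  rw [this, Int.cast_natCast, Nat.cast_add, Nat.cast_mul]
  ring

/-- Every finite tuple is equivalent to a bounded tuple with a fixed denominator. -/
theorem exists_equi_scale {ι : Type*} [Fintype ι] {K M N B : ℕ} (hM : 0 < M)
    (hN : Fintype.card ι < N) (hB : Fintype.card ι * (K + M + 1) ≤ B) (u : ι → ℚ) :
    ∃ p : ι → ℕ, (∀ i, p i < B * N) ∧ Equi K M (scale N p) u := by
  classical
  obtain ⟨c, hc, hc'⟩ := exists_int_compress (K := K) hM (Finset.univ.image fun i => ⌊u i⌋)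
  have hcard : (Finset.univ.image fun i => ⌊u i⌋).card ≤ Fintype.card ι := Finset.card_image_le
  have hmem : ∀ i, ⌊u i⌋ ∈ Finset.univ.image fun i => ⌊u i⌋ := fun i =>
    Finset.mem_image_of_mem _ (Finset.mem_univ i)
  -- A fractional part is replaced by its rank in `F`, divided by `N`. With `0` in `F`, rank zero
  -- marks exactly the fractional part zero, and ranks are at most `Fintype.card ι`, which is less
  -- than `N`.
  set F : Finset ℚ := insert 0 (Finset.univ.image fun i => Int.fract (u i)) with hF
  have hFc : F.card ≤ Fintype.card ι + 1 :=
    (Finset.card_insert_le _ _).trans (Nat.add_le_add_right Finset.card_image_le 1)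
  have hF0 : (0 : ℚ) ∈ F := Finset.mem_insert_self _ _
  have hFi : ∀ i, Int.fract (u i) ∈ F := fun i =>
    Finset.mem_insert_of_mem (Finset.mem_image_of_mem _ (Finset.mem_univ i))
  have hFnn : ∀ a ∈ F, 0 ≤ a := by
    intro a ha
    rcases Finset.mem_insert.1 ha with rfl | ha
    · exact le_rfl
    · obtain ⟨i, -, rfl⟩ := Finset.mem_image.1 ha
      exact Int.fract_nonneg _
  let rank : ℚ → ℕ := fun a => (F.filter (· < a)).card
  have hrank0 : rank 0 = 0 := by
    rw [Finset.card_eq_zero, Finset.filter_eq_empty_iff]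
    exact fun a ha => not_lt.2 (hFnn a ha)
  have hmono : Monotone rank := fun a b hab =>
    Finset.card_le_card (fun x hx => by
      rw [Finset.mem_filter] at hx ⊢; exact ⟨hx.1, hx.2.trans_le hab⟩)
  have hlt : ∀ a ∈ F, ∀ b, a < b → rank a < rank b := by
    intro a ha b hab
    refine Finset.card_lt_card ⟨fun x hx => ?_, fun h => ?_⟩
    · rw [Finset.mem_filter] at hx ⊢; exact ⟨hx.1, hx.2.trans hab⟩
    · have := h (Finset.mem_filter.2 ⟨ha, hab⟩)
      exact lt_irrefl _ (Finset.mem_filter.1 this).2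
  have hle : ∀ a, ∀ b ∈ F, (rank a ≤ rank b ↔ a ≤ b) := fun a b hb =>
    ⟨fun h => not_lt.1 fun hba => not_lt.2 h (hlt b hb a hba), fun h => hmono h⟩
  have hrN : ∀ i, rank (Int.fract (u i)) < N := by
    intro i
    have : rank (Int.fract (u i)) < F.card :=
      Finset.card_lt_card (Finset.filter_ssubset.2 ⟨_, hFi i, lt_irrefl _⟩)
    omega
  have hN0 : 0 < N := by omega
  have hNQ : (0 : ℚ) < N := by exact_mod_cast hN0
  have hdiv : ∀ i, (c ⌊u i⌋ * N + rank (Int.fract (u i))) / N = c ⌊u i⌋ := fun i => by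
    rw [Nat.mul_comm, Nat.mul_add_div hN0, Nat.div_eq_of_lt (hrN i), add_zero]
  have hmod : ∀ i, (c ⌊u i⌋ * N + rank (Int.fract (u i))) % N = rank (Int.fract (u i)) :=
    fun i => by rw [Nat.mul_comm, Nat.mul_add_mod, Nat.mod_eq_of_lt (hrN i)]
  refine ⟨fun i => c ⌊u i⌋ * N + rank (Int.fract (u i)), fun i => ?_, ?_, ?_, ?_⟩
  · have h1 : c ⌊u i⌋ + 1 ≤ B :=
      (hc _ (hmem i)).trans_le ((Nat.mul_le_mul_right _ hcard).trans hB)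
    calc _ < c ⌊u i⌋ * N + N := Nat.add_lt_add_left (hrN i) _
      _ = (c ⌊u i⌋ + 1) * N := by ring
      _ ≤ B * N := Nat.mul_le_mul_right _ h1
  · intro i j
    rw [scale, scale, floor_natCast_div, floor_natCast_div, hdiv, hdiv]
    exact (hc' _ (hmem i) _ (hmem j)).symm
  · intro i j
    rw [scale, scale, fract_natCast_div hN0, fract_natCast_div hN0, hmod, hmod,
      div_le_div_iff_of_pos_right hNQ, Nat.cast_le, hle _ _ (hFi j)]
  · intro i
    rw [scale, fract_natCast_div hN0, hmod, div_eq_zero_iff, or_iff_left hNQ.ne', Nat.cast_eq_zero,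
      ← Nat.le_zero, ← hrank0, hle _ _ hF0]
    exact ⟨fun h => le_antisymm h (Int.fract_nonneg _), fun h => h.le⟩

/-! ### Clock constraints under the equivalence -/

section Constraints

variable {V : Type*} {K M C : ℕ}

/-- The constants of an atomic constraint are at most `C`, and its modulus divides `M`. -/
def Atom.BoundedBy (C M : ℕ) : Atom V → Prop
  | .floorLe _ k => |k| ≤ C
  | .floorMod _ m _ => (m : ℕ) ∣ M
  | .fracZero _ => True
  | .diffLe _ _ k => |k| ≤ C
  | .diffMod _ _ m _ => (m : ℕ) ∣ M
  | .fracLe _ _ => True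

/-- The constants of a constraint are at most `C`, and its moduli divide `M`. -/
def Constraint.BoundedBy (C M : ℕ) : Constraint V → Prop
  | .tru => True
  | .atom a => a.BoundedBy C M
  | .neg φ => φ.BoundedBy C M
  | .conj φ ψ => φ.BoundedBy C M ∧ ψ.BoundedBy C M
  | .disj φ ψ => φ.BoundedBy C M ∧ ψ.BoundedBy C M

/-- The values of clocks at time `u none`, clock `x` having been zero at time `u (some x)`. -/
def clockVal (u : Option V → ℚ) : Valuation V := fun x => (u none - u (some x)).toNNRat

theorem coe_clockVal {u : Option V → ℚ} {x : V} (h : u (some x) ≤ u none) :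
    (clockVal u x : ℚ) = u none - u (some x) :=
  Rat.coe_toNNRat _ (sub_nonneg.2 h)

/-- The floor of a difference is the difference of the floors up to a borrow, which the order of the
fractional parts decides. The two borrows coincide, so they shift both sides alike. -/
theorem Equi.floor_sub {u v : Option V → ℚ} (h : Equi (K + 2) M u v) (x : V) :
    IntEq (K + 1) M ⌊u none - u (some x)⌋ ⌊v none - v (some x)⌋ := by
  rw [floor_sub_eq, floor_sub_eq, if_congr (h.frac (some x) none) rfl rfl]
  refine (h.int none (some x)).add_const _ ?_
  split_ifs <;> simp

theorem Equi.atom_holds_iff {u v : Option V → ℚ} (h : Equi (C + 2) M u v)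
    -- Without this order the subtraction in `clockVal` would be truncated at zero.
    (hu : ∀ x, u (some x) ≤ u none) (a : Atom V) (ha : a.BoundedBy C M) :
    a.Holds (clockVal u) ↔ a.Holds (clockVal v) := by
  have hv : ∀ x, v (some x) ≤ v none := fun x => (h.le_iff _ _).1 (hu x)
  -- In a difference of two clocks the present time cancels; what remains is a difference of floors
  -- of stamps and two borrows, covered by the slack of two in the threshold.
  have hdiff : ∀ x y, IntEq C M (⌊u none - u (some x)⌋ - ⌊u none - u (some y)⌋)
      (⌊v none - v (some x)⌋ - ⌊v none - v (some y)⌋) := by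
    intro x y
    rw [floor_sub_eq, floor_sub_eq, floor_sub_eq, floor_sub_eq,
      if_congr (h.frac (some x) none) rfl rfl, if_congr (h.frac (some y) none) rfl rfl]
    have := (h.int (some y) (some x)).add_const (K := C)
      ((if Int.fract (v (some x)) ≤ Int.fract (v none) then 0 else -1) -
        (if Int.fract (v (some y)) ≤ Int.fract (v none) then 0 else -1))
      (by split_ifs <;> simp)
    convert this using 1 <;> ring
  cases a with
  | floorLe x k =>
    simp only [Atom.Holds, coe_clockVal (hu x), coe_clockVal (hv x)]
    exact (h.floor_sub x).le_iff (ha.trans (by push_cast; omega))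
  | floorMod x m k =>
    simp only [Atom.Holds, coe_clockVal (hu x), coe_clockVal (hv x)]
    exact (h.floor_sub x).modEq_iff ha
  | fracZero x =>
    simp only [Atom.Holds, coe_clockVal (hu x), coe_clockVal (hv x)]
    rw [fract_sub_eq_zero_iff, fract_sub_eq_zero_iff, h.frac, h.frac]
  | diffLe x y k =>
    simp only [Atom.Holds, coe_clockVal (hu x), coe_clockVal (hv x), coe_clockVal (hu y),
      coe_clockVal (hv y)]
    exact (hdiff x y).le_iff ha
  | diffMod x y m k =>
    simp only [Atom.Holds, coe_clockVal (hu x), coe_clockVal (hv x), coe_clockVal (hu y),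
      coe_clockVal (hv y)]
    exact (hdiff x y).modEq_iff ha
  | fracLe x y =>
    simp only [Atom.Holds, coe_clockVal (hu x), coe_clockVal (hv x), coe_clockVal (hu y),
      coe_clockVal (hv y)]
    rw [fract_sub_le_iff, fract_sub_le_iff, h.frac, h.frac, h.frac]

theorem Equi.holds_iff {u v : Option V → ℚ} (h : Equi (C + 2) M u v)
    (hu : ∀ x, u (some x) ≤ u none) (φ : Constraint V) (hφ : φ.BoundedBy C M) :
    φ.Holds (clockVal u) ↔ φ.Holds (clockVal v) := by
  induction φ with
  | tru => exact Iff.rfl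
  | atom a => exact h.atom_holds_iff hu a hφ
  | neg φ ih => exact not_congr (ih hφ)
  | conj φ ψ ih ih' => exact and_congr (ih hφ.1) (ih' hφ.2)
  | disj φ ψ ih ih' => exact or_congr (ih hφ.1) (ih' hφ.2)

end Constraints

/-! ### Summaries of balanced runs, in terms of time stamps -/

/-- `u` and `v` give the present time and the times of the last resets, at the beginning and
at the end of a run. -/
structure Valid {X : Type*} (u v : Option X → ℚ) : Prop where
  left : ∀ i, u i ≤ u none
  right : ∀ i, v i ≤ v none
  -- A stamp that changes is set to some moment of the run, hence not before the start.
  stay : ∀ i, v i = u i ∨ u none ≤ v i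

namespace Valid

variable {X : Type*} {u v w : Option X → ℚ}

theorem now_le (h : Valid u v) : u none ≤ v none := by
  rcases h.stay none with h | h
  · exact h.ge
  · exact h

theorem trans (h : Valid u v) (h' : Valid v w) : Valid u w := by
  refine ⟨h.left, h'.right, fun i => ?_⟩
  rcases h'.stay i with h1 | h1
  · rw [h1]; exact h.stay i
  · exact .inr (h.now_le.trans h1)

theorem of_le (h : ∀ i, u i ≤ u none) : Valid u u := ⟨h, h, fun _ => .inl rfl⟩

end Valid

section Summary

variable {S G L X Z : Type*}

/-- Time stamps of the global clocks together with those of a stack frame. -/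
def withFrame (u : Option X → ℚ) (ζ : Z → ℚ) : Option (X ⊕ Z) → ℚ
  | none => u none
  | some (.inl x) => u (some x)
  | some (.inr z) => ζ z

/-- The values at time `T` of stack clocks with given time stamps. -/
def frameVal (T : ℚ) (ζ : Z → ℚ) : Valuation Z := fun z => (T - ζ z).toNNRat

theorem clockVal_withFrame (u : Option X → ℚ) (ζ : Z → ℚ) :
    clockVal (withFrame u ζ) = Sum.elim (clockVal u) (frameVal (u none) ζ) := by
  funext i
  rcases i with x | z <;> rfl

/-- The effect on time stamps, and the word read, of an operation other than push and pop. -/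
def Op.Basic (op : Op S G X Z) (w : List S) (u v : Option X → ℚ) : Prop :=
  match op with
  | .elapse => w = [] ∧ ∀ x, v (some x) = u (some x)
  | .input a => w = a.toList ∧ ∀ i, v i = u i
  | .test φ => w = [] ∧ (∀ i, v i = u i) ∧ φ.Holds (clockVal u)
  | .reset Y => w = [] ∧ v none = u none ∧
      ∀ x, (x ∈ Y → v (some x) = u none) ∧ (x ∉ Y → v (some x) = u (some x))
  | .push _ _ => False
  | .pop _ _ => False

/-- `P.Summary ℓ u w r v` : some run from `ℓ` to `r` that ends at the stack height where it begins,
and does not go below, reads `w` and changes the time stamps from `u` to `v`. -/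
inductive TPDA.Summary (P : TPDA S G L X Z) :
    L → (Option X → ℚ) → List S → L → (Option X → ℚ) → Prop
  | nil {ℓ : L} {u : Option X → ℚ} (hv : Valid u u) : P.Summary ℓ u [] ℓ u
  | step {ℓ r : L} {op : Op S G X Z} {w : List S} {u v : Option X → ℚ}
      (h : (ℓ, op, r) ∈ P.rules) (hv : Valid u v) (hb : op.Basic w u v) : P.Summary ℓ u w r v
  -- The same stamps `ζ` serve at push and at pop. They are only required not to exceed the time of
  -- the push, because stack clocks start with arbitrary nonnegative values.
  | pushPop {ℓ ℓ' r' r : L} {g : G} {ψ ψ' : Constraint (X ⊕ Z)} {w : List S}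
      {u v : Option X → ℚ} (h : (ℓ, Op.push g ψ, ℓ') ∈ P.rules)
      (h' : (r', Op.pop g ψ', r) ∈ P.rules) (ζ : Z → ℚ) (hζ : ∀ z, ζ z ≤ u none)
      (hψ : ψ.Holds (clockVal (withFrame u ζ))) (hψ' : ψ'.Holds (clockVal (withFrame v ζ)))
      (hs : P.Summary ℓ' u w r' v) : P.Summary ℓ u w r v
  | trans {ℓ k r : L} {w w' : List S} {u s v : Option X → ℚ}
      (h : P.Summary ℓ u w k s) (h' : P.Summary k s w' r v) : P.Summary ℓ u (w ++ w') r v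

theorem TPDA.Summary.valid {P : TPDA S G L X Z} {ℓ r : L} {w : List S} {u v : Option X → ℚ}
    (h : P.Summary ℓ u w r v) : Valid u v := by
  induction h with
  | nil hv => exact hv
  | step _ hv _ => exact hv
  | pushPop _ _ _ _ _ _ _ ih => exact ih
  | trans _ _ ih ih' => exact ih.trans ih'

/-- The input letters in a sequence of labels. -/
def letters (l : List (Label S)) : List S :=
  l.filterMap fun
    | .delay _ => none
    | .letter a => a

theorem letters_append (l l' : List (Label S)) : letters (l ++ l') = letters l ++ letters l' :=
  List.filterMap_append

theorem letters_delay (δ : NNRat) (l : List (Label S)) : letters (.delay δ :: l) = letters l := rfl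

theorem letters_none (l : List (Label S)) : letters (.letter none :: l) = letters l := rfl

theorem letters_letter (a : Option S) (l : List (Label S)) :
    letters (.letter a :: l) = a.toList ++ letters l := by
  cases a <;> rfl

theorem map_snd_timedWordFrom (δ : NNRat) (l : List (Label S)) :
    (timedWordFrom δ l).map Prod.snd = letters l := by
  induction l generalizing δ with
  | nil => rfl
  | cons a l ih =>
    rcases a with δ' | _ | a
    · rw [timedWordFrom, ih, letters_delay]
    · rw [timedWordFrom, ih, letters_none]
    · rw [timedWordFrom, List.map_cons, ih, letters_letter]; rfl

/-- The stack at time `T`, from its time stamps. -/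
def stackAt (T : ℚ) (fs : List (G × (Z → ℚ))) : List (G × Valuation Z) :=
  fs.map fun f => (f.1, frameVal T f.2)

theorem toNNRat_sub_add {T t : ℚ} (h : t ≤ T) (δ : NNRat) :
    (T + δ - t).toNNRat = (T - t).toNNRat + δ := by
  apply NNRat.coe_injective
  rw [NNRat.coe_add, Rat.coe_toNNRat _ (sub_nonneg.2 h), Rat.coe_toNNRat]
  · ring
  · have := δ.coe_nonneg
    linarith

theorem stackAt_add {T : ℚ} {fs : List (G × (Z → ℚ))} (h : ∀ f ∈ fs, ∀ z, f.2 z ≤ T)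
    (δ : NNRat) : stackAt (T + δ) fs = stackElapse (stackAt T fs) δ := by
  rw [stackAt, stackElapse, stackAt, List.map_map]
  refine List.map_congr_left fun f hf => ?_
  refine Prod.ext rfl (funext fun z => ?_)
  exact toNNRat_sub_add (h f hf z) δ

theorem TPDA.Run.append {P : TPDA S G L X Z} {c d e : Config G L X Z} {w w' : List (Label S)}
    (h : P.Run c w d) (h' : P.Run d w' e) : P.Run c (w ++ w') e := by
  induction h with
  | nil c => exact h'
  | cons hs _ ih => exact .cons hs (ih h')

theorem TPDA.Run.single {P : TPDA S G L X Z} {c d : Config G L X Z} {a : Label S}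
    (h : P.Step c a d) : P.Run c [a] d := .cons h (.nil d)

theorem Op.Basic.exists_step {P : TPDA S G L X Z} {ℓ r : L} {op : Op S G X Z} {w : List S}
    {u v : Option X → ℚ} (hb : op.Basic w u v) (h : (ℓ, op, r) ∈ P.rules) (hv : Valid u v)
    {fs : List (G × (Z → ℚ))} (hfs : ∀ f ∈ fs, ∀ z, f.2 z ≤ u none) :
    ∃ a, P.Step ⟨ℓ, clockVal u, stackAt (u none) fs⟩ a ⟨r, clockVal v, stackAt (v none) fs⟩ ∧
      letters [a] = w := by
  cases op with
  | elapse =>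
    obtain ⟨rfl, hb⟩ := hb
    obtain ⟨δ, hδ⟩ : ∃ δ : NNRat, v none = u none + δ := by
      refine ⟨(v none - u none).toNNRat, ?_⟩
      rw [Rat.coe_toNNRat _ (sub_nonneg.2 hv.now_le)]; ring
    refine ⟨.delay δ, ?_, rfl⟩
    have := TPDA.Step.elapse (P := P) (clockVal u) (stackAt (u none) fs) δ h
    rw [← stackAt_add hfs, ← hδ] at this
    convert this using 2
    funext x
    rw [clockVal, hb, hδ]
    exact toNNRat_sub_add (hv.left _) _
  | input a =>
    obtain ⟨rfl, hb⟩ := hb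
    obtain rfl : v = u := funext hb
    exact ⟨_, .input _ _ a h, by rw [letters_letter]; exact List.append_nil _⟩
  | test φ =>
    obtain ⟨rfl, hb, hφ⟩ := hb
    obtain rfl : v = u := funext hb
    exact ⟨_, .test _ _ φ h hφ, rfl⟩
  | reset Y =>
    obtain ⟨rfl, hn, hb⟩ := hb
    refine ⟨.letter none, ?_, rfl⟩
    have := TPDA.Step.reset (P := P) (clockVal u) (stackAt (u none) fs) Y h
    rw [hn]
    convert this using 2
    funext x
    rw [clockVal, hn, Valuation.reset]
    split_ifs with hx
    · rw [(hb x).1 hx, sub_self]; rfl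
    · rw [(hb x).2 hx]; rfl
  | push g ψ => exact hb.elim
  | pop g ψ => exact hb.elim

/-- The untouched part `fs` of the stack is universally quantified, so that the induction can place
a pushed frame on it. -/
theorem TPDA.Summary.exists_run {P : TPDA S G L X Z} {ℓ r : L} {w : List S} {u v : Option X → ℚ}
    (h : P.Summary ℓ u w r v) {fs : List (G × (Z → ℚ))} (hfs : ∀ f ∈ fs, ∀ z, f.2 z ≤ u none) :
    ∃ l, P.Run ⟨ℓ, clockVal u, stackAt (u none) fs⟩ l ⟨r, clockVal v, stackAt (v none) fs⟩ ∧
      letters l = w := by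
  induction h generalizing fs with
  | nil hv => exact ⟨[], .nil _, rfl⟩
  | step h hv hb =>
    obtain ⟨a, ha, hw⟩ := hb.exists_step h hv hfs
    exact ⟨[a], .single ha, hw⟩
  | @pushPop ℓ ℓ' r' r g ψ ψ' w u v h h' ζ hζ hψ hψ' hs ih =>
    obtain ⟨l, hl, hw⟩ := ih (fs := (g, ζ) :: fs) (by
      intro f hf
      rcases List.mem_cons.1 hf with rfl | hf
      · exact hζ
      · exact hfs f hf)
    rw [clockVal_withFrame] at hψ hψ'
    have hpop : P.Step ⟨r', clockVal v, stackAt (v none) ((g, ζ) :: fs)⟩ (.letter none)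
        ⟨r, clockVal v, stackAt (v none) fs⟩ :=
      TPDA.Step.pop (clockVal v) (stackAt (v none) fs) g ψ' (frameVal (v none) ζ) h' hψ'
    refine ⟨.letter none :: l ++ [.letter none],
      (TPDA.Run.cons (.push _ _ g ψ _ h hψ) hl).append (.single hpop), ?_⟩
    rw [List.cons_append, letters_none, letters_append, hw]
    simp [letters]
  | trans h h' ih ih' =>
    obtain ⟨l, hl, hw⟩ := ih hfs
    obtain ⟨l', hl', hw'⟩ := ih' fun f hf z => (hfs f hf z).trans h.valid.now_le
    exact ⟨l ++ l', hl.append hl', by rw [letters_append, hw, hw']⟩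

/-- The decomposition of a run that empties the stack `fs` at the pops of its symbols. -/
def TPDA.Unwind (P : TPDA S G L X Z) (r : L) (v : Option X → ℚ) :
    List (G × (Z → ℚ)) → L → (Option X → ℚ) → List S → Prop
  | [], ℓ, u, w => P.Summary ℓ u w r v
  | (g, ζ) :: fs, ℓ, u, w => ∃ w₁ w₂ k k' s ψ, P.Summary ℓ u w₁ k s ∧
      (k, Op.pop g ψ, k') ∈ P.rules ∧ ψ.Holds (clockVal (withFrame s ζ)) ∧
      P.Unwind r v fs k' s w₂ ∧ w = w₁ ++ w₂

theorem TPDA.Unwind.prepend {P : TPDA S G L X Z} {r : L} {v : Option X → ℚ}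
    {fs : List (G × (Z → ℚ))} {ℓ k : L} {u s : Option X → ℚ} {w w' : List S}
    (h : P.Unwind r v fs k s w') (h' : P.Summary ℓ u w k s) : P.Unwind r v fs ℓ u (w ++ w') := by
  cases fs with
  | nil => exact h'.trans h
  | cons f fs =>
    obtain ⟨w₁, w₂, k', k'', s', ψ, h1, h2, h3, h4, rfl⟩ := h
    exact ⟨w ++ w₁, w₂, k', k'', s', ψ, h'.trans h1, h2, h3, h4, by rw [List.append_assoc]⟩

/-- Induction on the run, first step first, for any current stack. After a push, the unwinding of
the rest already exhibits the matching pop, and the two close up to a `pushPop`; a pop opens a new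
segment with an empty summary. All other steps are prepended to the first segment. -/
theorem TPDA.Run.exists_unwind {P : TPDA S G L X Z} {c e : Config G L X Z} {l : List (Label S)}
    (h : P.Run c l e) (he : e.stack = []) {u : Option X → ℚ} (hu : ∀ i, u i ≤ u none)
    {fs : List (G × (Z → ℚ))} (hfs : ∀ f ∈ fs, ∀ z, f.2 z ≤ u none)
    (hval : c.val = clockVal u) (hst : c.stack = stackAt (u none) fs) :
    ∃ v, e.val = clockVal v ∧ P.Unwind e.loc v fs c.loc u (letters l) := by
  induction h generalizing u fs with
  | nil c =>
    obtain rfl : fs = [] := by rw [he] at hst; exact List.map_eq_nil_iff.1 hst.symm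
    exact ⟨u, hval, .nil (.of_le hu)⟩
  | @cons c d e a l hs h ih =>
    cases hs with
    | @elapse ℓ r μ s δ hr =>
      subst hval hst
      have hδ := δ.coe_nonneg
      -- Only the present time advances.
      let u' : Option X → ℚ := fun i => i.elim (u none + δ) fun x => u (some x)
      have hu' : ∀ i, u' i ≤ u' none := by
        rintro (_ | x)
        · exact le_rfl
        · have := hu (some x)
          change u (some x) ≤ u none + δ
          linarith
      obtain ⟨v, hv, hw⟩ := ih he (u := u') hu' (fs := fs)
        (fun f hf z => by
          have := hfs f hf z
          change f.2 z ≤ u none + δ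
          linarith)
        (funext fun x => (toNNRat_sub_add (hu (some x)) δ).symm) (stackAt_add hfs δ).symm
      refine ⟨v, hv, hw.prepend (w := []) (.step hr ⟨hu, hu', ?_⟩ ⟨rfl, fun _ => rfl⟩)⟩
      rintro (_ | x)
      · right
        change u none ≤ u none + δ
        linarith
      · exact .inl rfl
    | @input ℓ r μ s a hr =>
      subst hval hst
      obtain ⟨v, hv, hw⟩ := ih he hu hfs rfl rfl
      rw [letters_letter]
      exact ⟨v, hv, hw.prepend (.step hr (.of_le hu) ⟨rfl, fun _ => rfl⟩)⟩
    | @test ℓ r μ s φ hr hφ =>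
      subst hval hst
      obtain ⟨v, hv, hw⟩ := ih he hu hfs rfl rfl
      exact ⟨v, hv, hw.prepend (w := []) (.step hr (.of_le hu) ⟨rfl, fun _ => rfl, hφ⟩)⟩
    | @reset ℓ r μ s Y hr =>
      subst hval hst
      classical
      let u' : Option X → ℚ := fun i =>
        i.elim (u none) fun x => if x ∈ Y then u none else u (some x)
      have hu' : ∀ i, u' i ≤ u' none := by
        rintro (_ | x)
        · exact le_rfl
        · change (if x ∈ Y then u none else u (some x)) ≤ u none
          split_ifs
          · exact le_rfl
          · exact hu _
      obtain ⟨v, hv, hw⟩ := ih he (u := u') hu' (fs := fs) hfs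
        (funext fun x => by
          change (if x ∈ Y then 0 else _) = (u none - if x ∈ Y then u none else u (some x)).toNNRat
          split_ifs
          · rw [sub_self]; rfl
          · rfl) rfl
      refine ⟨v, hv, hw.prepend (w := []) (.step hr ⟨hu, hu', ?_⟩
        ⟨rfl, rfl, fun x => ⟨fun hx => if_pos hx, fun hx => if_neg hx⟩⟩)⟩
      rintro (_ | x)
      · exact .inl rfl
      · by_cases hx : x ∈ Y
        · exact .inr (if_pos hx).ge
        · exact .inl (if_neg hx)
    | @push ℓ r μ s g ψ ζ hr hψ =>
      subst hval hst
      -- The stamp of a stack clock is the virtual time at which it was zero; it may be negative, so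
      -- stamps range over `ℚ`.
      have hζ : ∀ z, u none - (ζ z : ℚ) ≤ u none := fun z => by
        have := (ζ z).coe_nonneg
        linarith
      have hfr : frameVal (u none) (fun z => u none - (ζ z : ℚ)) = ζ := by
        funext z
        rw [frameVal, sub_sub_cancel]
        exact NNRat.toNNRat_coe _
      obtain ⟨v, hv, w₁, w₂, k, k', s, ψ', h1, h2, h3, h4, h5⟩ := ih he hu
        (fs := (g, fun z => u none - (ζ z : ℚ)) :: fs) (by
          intro f hf
          rcases List.mem_cons.1 hf with rfl | hf
          · exact hζ
          · exact hfs f hf) rfl (congrArg (fun ζ' => (g, ζ') :: stackAt (u none) fs) hfr.symm)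
      refine ⟨v, hv, ?_⟩
      rw [letters_none, h5]
      exact h4.prepend (.pushPop hr h2 _ hζ (by rwa [clockVal_withFrame, hfr]) h3 h1)
    | @pop ℓ r μ s g ψ ζ hr hψ =>
      subst hval
      rcases fs with _ | ⟨⟨g', ζ'⟩, fs⟩
      · exact absurd hst (List.cons_ne_nil _ _)
      · obtain ⟨h1, h2⟩ := List.cons.inj hst
        obtain ⟨rfl, rfl⟩ := Prod.mk.inj h1
        subst h2
        obtain ⟨v, hv, hw⟩ := ih he hu (fs := fs)
          (fun f hf => hfs f (List.mem_cons_of_mem _ hf)) rfl rfl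
        exact ⟨v, hv, [], letters l, ℓ, r, u, ψ, .nil (.of_le hu), hr,
          by rwa [clockVal_withFrame], hw, rfl⟩

/-- All clocks are zero exactly if all stamps coincide with the present time; the absolute time of
the start is irrelevant. -/
theorem TPDA.mem_untimedLanguage_iff {P : TPDA S G L X Z} {ℓ r : L} {w : List S} :
    w ∈ P.untimedLanguage ℓ r ↔
      ∃ u v, (∀ i, u i = u none) ∧ (∀ i, v i = v none) ∧ P.Summary ℓ u w r v := by
  have hz : ∀ u : Option X → ℚ, (∀ i, u i = u none) → clockVal u = fun _ => 0 := by
    intro u hu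
    funext x
    rw [clockVal, hu (some x), sub_self]
    rfl
  constructor
  · rintro ⟨t, ⟨l, hl, rfl⟩, rfl⟩
    rw [map_snd_timedWordFrom]
    obtain ⟨v, hv, hw⟩ := hl.exists_unwind rfl (u := fun _ => 0) (fun _ => le_rfl) (fs := [])
      (by simp) (hz _ fun _ => rfl).symm rfl
    refine ⟨fun _ => 0, v, fun _ => rfl, ?_, hw⟩
    -- A value zero only means that the stamp is not before the present time, since `clockVal`
    -- truncates; validity gives the converse inequality.
    have hwf := (TPDA.Summary.valid hw).right
    rintro (_ | x)
    · rfl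
    · have := congrFun hv x
      rw [eq_comm, clockVal, Rat.toNNRat_eq_zero] at this
      exact le_antisymm (hwf _) (by linarith)
  · rintro ⟨u, v, hu, hv, h⟩
    obtain ⟨l, hl, hw⟩ := h.exists_run (fs := []) (by simp)
    rw [hz u hu, hz v hv] at hl
    exact ⟨timedWordFrom 0 l, ⟨l, hl, rfl⟩, by rw [map_snd_timedWordFrom, hw]⟩

end Summary

/-! ### Extending an equivalence by further time stamps. -/

section Extension

variable {X Z : Type*} {K M : ℕ}

theorem Equi.fract_mono {ι : Type*} {u v : ι → ℚ} {φ : ℚ → ℚ} (hφ : StrictMono φ) (h0 : φ 0 = 0)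
    (hint : ∀ i j, IntEq K M (⌊u i⌋ - ⌊u j⌋) (⌊v i⌋ - ⌊v j⌋))
    (h : ∀ i, Int.fract (v i) = φ (Int.fract (u i))) : Equi K M u v :=
  ⟨hint, fun i j => by rw [h, h, hφ.le_iff_le], fun i => by
    rw [h, strictMono_eq_zero_iff hφ h0]⟩

/-- A move of time stamps can be repeated from equivalent time stamps, with any fractional parts
that are ordered in the right way. -/
theorem Valid.exists_lift {p s σ : Option X → ℚ} (hv : Valid p s) (h : Equi K M p σ)
    {φ : ℚ → ℚ} (hφ : StrictMono φ) (h0 : φ 0 = 0) (h1 : φ 1 = 1)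
    (hp : ∀ i, φ (Int.fract (p i)) = Int.fract (σ i)) :
    ∃ ρ : Option X → ℚ, (∀ i, Int.fract (ρ i) = φ (Int.fract (s i))) ∧
      Equi K M (Sum.elim p s) (Sum.elim σ ρ) := by
  classical
  -- An unchanged stamp is copied from `σ`; a changed one keeps its integral distance from the
  -- initial present time.
  let m : Option X → ℤ := fun i =>
    if s i = p i then ⌊σ i⌋ else ⌊σ none⌋ + (⌊s i⌋ - ⌊p none⌋)
  let ρ : Option X → ℚ := fun i => m i + φ (Int.fract (s i))
  have hfl : ∀ i, ⌊ρ i⌋ = m i := fun i => (floor_add_of_strictMono hφ h0 h1 (m i) (s i)).1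
  have hfr : ∀ i, Int.fract (ρ i) = φ (Int.fract (s i)) := fun i =>
    (floor_add_of_strictMono hφ h0 h1 (m i) (s i)).2
  -- Each floor is that of an initial stamp plus an offset, nonzero only over the latest stamp. So,
  -- up to sign, every difference is given, identical on both sides, or a sum of nonnegative gaps,
  -- and the threshold `K` survives intact.
  have key : ∀ a : Option X ⊕ Option X, ∃ (k : Option X) (c : ℤ), 0 ≤ c ∧ (k = none ∨ c = 0) ∧
      ⌊Sum.elim p s a⌋ = ⌊p k⌋ + c ∧ ⌊Sum.elim σ ρ a⌋ = ⌊σ k⌋ + c := by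
    rintro (i | i)
    · exact ⟨i, 0, le_rfl, .inr rfl, by simp, by simp⟩
    · simp only [Sum.elim_inr, hfl, m]
      by_cases hi : s i = p i
      · exact ⟨i, 0, le_rfl, .inr rfl, by simp [hi], by simp [hi]⟩
      · have := Int.floor_mono ((hv.stay i).resolve_left hi)
        exact ⟨none, ⌊s i⌋ - ⌊p none⌋, by omega, .inl rfl, by ring, by simp [hi]⟩
  have hnn : ∀ k, 0 ≤ ⌊p none⌋ - ⌊p k⌋ := fun k => by
    have := Int.floor_mono (hv.left k)
    omega
  refine ⟨ρ, hfr, Equi.fract_mono hφ h0 (fun a b => ?_) ?_⟩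
  · obtain ⟨k, c, hc, hk, e1, e2⟩ := key a
    obtain ⟨k', c', hc', hk', e3, e4⟩ := key b
    rw [e1, e2, e3, e4]
    rcases hk with rfl | rfl
    · rcases hk' with rfl | rfl
      · have e5 : ⌊p none⌋ + c - (⌊p none⌋ + c') = c - c' := by ring
        have e6 : ⌊σ none⌋ + c - (⌊σ none⌋ + c') = c - c' := by ring
        rw [e5, e6]
        exact .refl _
      · have := (h.int none k').add (.refl c) (hnn k') hc
        convert this using 1 <;> ring
    · rcases hk' with rfl | rfl
      · have := ((h.int none k).add (.refl c') (hnn k) hc').neg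
        convert this using 1 <;> ring
      · simpa using h.int k k'
  · rintro (i | i)
    · exact (hp i).symm
    · exact hfr i

/-- A stack frame can be repeated over equivalent time stamps. -/
theorem Equi.exists_frame {ι : Type*} [Finite ι] [Fintype Z] (hM : 0 < M) (hK : M ≤ K)
    {u v : ι → ℚ} (h : Equi (3 ^ Fintype.card Z * K) M u v) (ζ : Z → ℚ) :
    ∃ ξ : Z → ℚ, Equi K M (Sum.elim u ζ) (Sum.elim v ξ) := by
  classical
  have := Fintype.ofFinite ι
  obtain ⟨φ, hφ, h0, h1, hp⟩ := h.exists_strictMono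
  let l : List ℤ := (Finset.univ : Finset Z).toList.map fun z => ⌊ζ z⌋
  have hl : l.length = Fintype.card Z := by simp [l]
  -- Integral parts may lie on either side of the known ones, so they are found by successive
  -- extension at a loss of threshold; fractional parts simply follow `φ`.
  obtain ⟨R, hR, hRc, hRl⟩ := IntCompat.exists_extend hK hM l
    (R := Finset.univ.image fun i => (⌊u i⌋, ⌊v i⌋)) (by
      rw [hl]
      intro p hp q hq
      obtain ⟨i, -, rfl⟩ := Finset.mem_image.1 hp
      obtain ⟨j, -, rfl⟩ := Finset.mem_image.1 hq
      exact h.int i j)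
  have hd : ∀ z, ∃ d, (⌊ζ z⌋, d) ∈ R := fun z => hRl _ (by simp [l])
  choose d hd using hd
  let ξ : Z → ℚ := fun z => d z + φ (Int.fract (ζ z))
  have hmem : ∀ a, (⌊Sum.elim u ζ a⌋, ⌊Sum.elim v ξ a⌋) ∈ R := by
    rintro (i | z)
    · exact hR (Finset.mem_image_of_mem _ (Finset.mem_univ i))
    · have := hd z
      rw [← (floor_add_of_strictMono hφ h0 h1 (d z) (ζ z)).1] at this
      exact this
  refine ⟨ξ, Equi.fract_mono hφ h0 (fun a b => hRc _ (hmem a) _ (hmem b)) ?_⟩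
  rintro (i | z)
  · exact (hp i).symm
  · exact (floor_add_of_strictMono hφ h0 h1 (d z) (ζ z)).2

end Extension

/-! ### Transfer of moves between equivalent tuples. -/

section Transfer

variable {S G L X Z : Type*} {C K M : ℕ}

/-- The constants of the constraints of an operation are at most `C`, the moduli divide `M`. -/
def Op.BoundedBy (C M : ℕ) : Op S G X Z → Prop
  | .test φ => φ.BoundedBy C M
  | .push _ ψ => ψ.BoundedBy C M
  | .pop _ ψ => ψ.BoundedBy C M
  | _ => True

theorem Valid.congr {u v u' v' : Option X → ℚ} (h : Equi K M (Sum.elim u v) (Sum.elim u' v'))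
    (hv : Valid u v) : Valid u' v' :=
  ⟨fun i => (h.le_iff (.inl i) (.inl none)).1 (hv.left i),
    fun i => (h.le_iff (.inr i) (.inr none)).1 (hv.right i),
    fun i => (hv.stay i).imp (h.eq_iff (.inr i) (.inl i)).1 (h.le_iff (.inl none) (.inr i)).1⟩

theorem Op.Basic.congr {op : Op S G X Z} {w : List S} {u v u' v' : Option X → ℚ}
    (hC : op.BoundedBy C M) (h : Equi (C + 2) M (Sum.elim u v) (Sum.elim u' v'))
    (hv : Valid u v) (hb : op.Basic w u v) : op.Basic w u' v' := by
  have heq : ∀ i, v i = u i → v' i = u' i := fun i => (h.eq_iff (.inr i) (.inl i)).1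
  cases op with
  | elapse => exact ⟨hb.1, fun x => heq _ (hb.2 x)⟩
  | input a => exact ⟨hb.1, fun i => heq _ (hb.2 i)⟩
  | test φ =>
    exact ⟨hb.1, fun i => heq _ (hb.2.1 i),
      ((h.comp Sum.inl).holds_iff (fun x => hv.left _) φ hC).1 hb.2.2⟩
  | reset Y =>
    exact ⟨hb.1, heq _ hb.2.1, fun x => ⟨fun hx =>
      (h.eq_iff (.inr (some x)) (.inl none)).1 ((hb.2.2 x).1 hx), fun hx =>
      heq _ ((hb.2.2 x).2 hx)⟩⟩
  | push g ψ => exact hb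
  | pop g ψ => exact hb

/-- The positions of the time stamps of clocks and of a frame in a joint tuple. -/
def frameIndex (f : Option X → (Option X ⊕ Option X)) : Option (X ⊕ Z) → (Option X ⊕ Option X) ⊕ Z
  | none => .inl (f none)
  | some (.inl x) => .inl (f (some x))
  | some (.inr z) => .inr z

theorem Equi.frame_left {u v u' v' : Option X → ℚ} {ζ ξ : Z → ℚ}
    (h : Equi K M (Sum.elim (Sum.elim u v) ζ) (Sum.elim (Sum.elim u' v') ξ)) :
    Equi K M (withFrame u ζ) (withFrame u' ξ) := by
  convert h.comp (frameIndex Sum.inl) using 1 <;>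
    (funext i; rcases i with _ | x | z <;> rfl)

theorem Equi.frame_right {u v u' v' : Option X → ℚ} {ζ ξ : Z → ℚ}
    (h : Equi K M (Sum.elim (Sum.elim u v) ζ) (Sum.elim (Sum.elim u' v') ξ)) :
    Equi K M (withFrame v ζ) (withFrame v' ξ) := by
  convert h.comp (frameIndex Sum.inr) using 1 <;>
    (funext i; rcases i with _ | x | z <;> rfl)

theorem withFrame_le {u : Option X → ℚ} (hu : ∀ i, u i ≤ u none) {ζ : Z → ℚ} {T : ℚ}
    (hζ : ∀ z, ζ z ≤ T) (hT : T ≤ u none) (i : X ⊕ Z) :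
    withFrame u ζ (some i) ≤ withFrame u ζ none := by
  rcases i with x | z
  · exact hu _
  · exact (hζ z).trans hT

end Transfer

/-! ### Derivations on bounded tuples. -/

section Gen

variable {S G L X Z : Type*}

/-- Derivations that mirror `TPDA.Summary`, on tuples of natural numbers below `D` in units of
`1 / N`, up to equivalence of tuples. -/
inductive TPDA.Gen (P : TPDA S G L X Z) (N K M D : ℕ) :
    L → (Option X → ℕ) → List S → L → (Option X → ℕ) → Prop
  | nil {ℓ : L} {p q : Option X → ℕ} (hv : Valid (scale N p) (scale N q)) (h : ∀ i, q i = p i) :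
      P.Gen N K M D ℓ p [] ℓ q
  | step {ℓ r : L} {op : Op S G X Z} {w : List S} {p q : Option X → ℕ}
      (h : (ℓ, op, r) ∈ P.rules) (hv : Valid (scale N p) (scale N q))
      (hb : op.Basic w (scale N p) (scale N q)) : P.Gen N K M D ℓ p w r q
  | pushPop {ℓ ℓ' r' r : L} {g : G} {ψ ψ' : Constraint (X ⊕ Z)} {w : List S}
      {p q : Option X → ℕ} (h : (ℓ, Op.push g ψ, ℓ') ∈ P.rules)
      (h' : (r', Op.pop g ψ', r) ∈ P.rules) (ζ : Z → ℕ) (hD : ∀ z, ζ z < D)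
      (hζ : ∀ z, scale N ζ z ≤ scale N p none)
      (hψ : ψ.Holds (clockVal (withFrame (scale N p) (scale N ζ))))
      (hψ' : ψ'.Holds (clockVal (withFrame (scale N q) (scale N ζ))))
      (hs : P.Gen N K M D ℓ' p w r' q) : P.Gen N K M D ℓ p w r q
  -- Here, as for `ζ` above and for `p'`, `q'` below, bounds concern exactly the tuples that the
  -- conclusion does not show, since these are what a grammar rule has to guess.
  | trans {ℓ k r : L} {w w' : List S} {p s q : Option X → ℕ} (hD : ∀ i, s i < D)
      (h : P.Gen N K M D ℓ p w k s) (h' : P.Gen N K M D k s w' r q) :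
      P.Gen N K M D ℓ p (w ++ w') r q
  | equi {ℓ r : L} {w : List S} {p q p' q' : Option X → ℕ} (hp : ∀ i, p' i < D)
      (hq : ∀ i, q' i < D)
      (he : Equi K M (Sum.elim (scale N p) (scale N q)) (Sum.elim (scale N p') (scale N q')))
      (h : P.Gen N K M D ℓ p' w r q') : P.Gen N K M D ℓ p w r q

variable {P : TPDA S G L X Z} {N K M D C : ℕ}

theorem TPDA.Gen.valid {ℓ r : L} {w : List S} {p q : Option X → ℕ} (h : P.Gen N K M D ℓ p w r q) :
    Valid (scale N p) (scale N q) := by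
  induction h with
  | nil hv _ => exact hv
  | step _ hv _ => exact hv
  | pushPop _ _ _ _ _ _ _ _ ih => exact ih
  | trans _ _ _ ih ih' => exact ih.trans ih'
  | equi _ _ he _ ih => exact ih.congr he.symm

/-- The final stamps cannot be prescribed: a long gap realised in two stages has the right length
only up to `IntEq`. Their fractional parts can be prescribed, and the induction needs this, because
in a composition the order of the final fractional parts relative to the initial ones must come out
right. -/
theorem TPDA.Gen.sound [Finite X] [Fintype Z] (hM : 0 < M)
    (hP : ∀ ρ ∈ P.rules, ρ.2.1.BoundedBy C M)
    (hK : K = 3 ^ Fintype.card Z * (C + 2 + M)) {ℓ r : L} {w : List S} {p q : Option X → ℕ}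
    (h : P.Gen N K M D ℓ p w r q) {σ τ₀ : Option X → ℚ}
    (he : Equi K M (Sum.elim (scale N p) (scale N q)) (Sum.elim σ τ₀)) :
    ∃ τ : Option X → ℚ, (∀ i, Int.fract (τ i) = Int.fract (τ₀ i)) ∧
      Equi K M (Sum.elim (scale N p) (scale N q)) (Sum.elim σ τ) ∧ P.Summary ℓ σ w r τ := by
  have hCK : C + 2 + M ≤ K := hK ▸ Nat.le_mul_of_pos_left _ (by positivity)
  induction h generalizing σ τ₀ with
  | nil hv h =>
    have hσ : τ₀ = σ := funext fun i =>
      (he.eq_iff (.inr i) (.inl i)).1 (by simp [scale, h])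
    subst hσ
    exact ⟨τ₀, fun _ => rfl, he, .nil (hv.congr he)⟩
  | step h hv hb =>
    exact ⟨τ₀, fun _ => rfl, he, .step h (hv.congr he)
      (hb.congr (hP _ h) (he.mono (by omega)) hv)⟩
  | @pushPop ℓ ℓ' r' r g ψ ψ' w p q h h' ζ hD hζ hψ hψ' hs ih =>
    obtain ⟨τ, h1, h2, h3⟩ := ih he
    -- The threshold drops only for the joint tuple with the frame; the conclusion `h2` retains `K`.
    obtain ⟨ξ, hξ⟩ := Equi.exists_frame (K := C + 2 + M) hM (by omega) (hK ▸ h2) (scale N ζ)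
    have hv := hs.valid
    refine ⟨τ, h1, h2, .pushPop h h' ξ (fun z => ?_) ?_ ?_ h3⟩
    · exact (hξ.le_iff (.inr z) (.inl (.inl none))).1 (hζ z)
    · exact ((hξ.frame_left.mono (by omega)).holds_iff (withFrame_le hv.left hζ le_rfl) ψ
        (hP _ h)).1 hψ
    · exact ((hξ.frame_right.mono (by omega)).holds_iff (withFrame_le hv.right hζ hv.now_le) ψ'
        (hP _ h')).1 hψ'
  | @trans ℓ k r w w' p s q hD h h' ih ih' =>
    -- One embedding, determined by the outer tuples, fixes the fractional parts of the middle and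
    -- of the end. This makes them comparable with those of `σ`.
    obtain ⟨φ, hφ, h0, h1, hp⟩ := he.exists_strictMono
    obtain ⟨ρ₀, hρ₀, hE₀⟩ := h.valid.exists_lift (he.comp Sum.inl) hφ h0 h1 (fun i => hp (.inl i))
    obtain ⟨ρ, hρ, hE, hS⟩ := ih hE₀
    obtain ⟨τ₁, hτ₁, hE₁⟩ := h'.valid.exists_lift (hE.comp Sum.inr) hφ h0 h1
      (fun i => ((hρ i).trans (hρ₀ i)).symm)
    obtain ⟨τ, hτ, hE', hS'⟩ := ih' hE₁
    have hfr : ∀ i, Int.fract (τ i) = Int.fract (τ₀ i) := fun i =>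
      ((hτ i).trans (hτ₁ i)).trans (hp (.inr i))
    -- A final stamp either equals its middle stamp or is at least the middle time, which in turn is
    -- at least every initial stamp: the gap is then a sum of two nonnegative ones.
    have hcross : ∀ i j, IntEq K M (⌊scale N q j⌋ - ⌊scale N p i⌋) (⌊τ j⌋ - ⌊σ i⌋) := by
      intro i j
      rcases h'.valid.stay j with hj | hj
      · have hj' : τ j = ρ j := (hE'.eq_iff (.inr j) (.inl j)).1 hj
        rw [hj, hj']
        exact hE.int (.inr j) (.inl i)
      · have e1 := Int.floor_mono hj
        have e2 := Int.floor_mono ((h.valid.left i).trans h.valid.now_le)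
        have := (hE'.int (.inr j) (.inl none)).add (hE.int (.inr none) (.inl i))
          (by simpa using e1) (by simpa using e2)
        simpa using this
    refine ⟨τ, hfr, ?_, hS.trans hS'⟩
    refine Equi.fract_mono hφ h0 ?_ ?_
    · rintro (i | i) (j | j)
      · exact he.int (.inl i) (.inl j)
      · exact (hcross i j).sub_comm
      · exact hcross j i
      · exact hE'.int (.inr i) (.inr j)
    · rintro (i | i)
      · exact (hp (.inl i)).symm
      · exact (hfr i).trans (hp (.inr i)).symm
  | equi hp hq he' h ih =>
    obtain ⟨τ, h1, h2, h3⟩ := ih (he'.symm.trans he)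
    exact ⟨τ, h1, he'.trans h2, h3⟩

theorem scale_injective {ι : Type*} (hN : 0 < N) {p : ι → ℕ} {i j : ι} :
    scale N p i = scale N p j ↔ p i = p j := by
  have : (N : ℚ) ≠ 0 := by exact_mod_cast hN.ne'
  rw [scale, scale, div_left_inj' this, Nat.cast_inj]

/-- All stamps that a rule involves are replaced jointly by a bounded representative, reached
through `equi`. A composition involves `3 * (|X| + 1)` stamps, a frame `2 * (|X| + 1) + |Z|`; `N`
and `D` are large enough for both. -/
theorem TPDA.Summary.gen [Fintype X] [Fintype Z] (hM : 0 < M)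
    (hP : ∀ ρ ∈ P.rules, ρ.2.1.BoundedBy C M) (hK : C + 2 ≤ K)
    (hN : 3 * (Fintype.card X + 1) + Fintype.card Z < N)
    (hD : (3 * (Fintype.card X + 1) + Fintype.card Z) * (K + M + 1) * N ≤ D)
    {ℓ r : L} {w : List S} {u v : Option X → ℚ} (h : P.Summary ℓ u w r v) {p q : Option X → ℕ}
    (he : Equi K M (Sum.elim (scale N p) (scale N q)) (Sum.elim u v)) :
    P.Gen N K M D ℓ p w r q := by
  induction h generalizing p q with
  | nil hv =>
    refine .nil (hv.congr he.symm) fun i => ?_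
    have h1 := (he.eq_iff (.inr i) (.inl i)).2 rfl
    have : (N : ℚ) ≠ 0 := by exact_mod_cast (by omega : N ≠ 0)
    simpa [scale, div_left_inj' this] using h1
  | step h hv hb =>
    exact .step h (hv.congr he.symm) (hb.congr (hP _ h) (he.symm.mono hK) hv)
  | @pushPop ℓ ℓ' r' r g ψ ψ' w u v h h' ζ hζ hψ hψ' hs ih =>
    obtain ⟨c, hc, hE⟩ := exists_equi_scale (K := K) (M := M) (N := N) hM
      (by simp only [Fintype.card_sum, Fintype.card_option]; omega) (le_refl _)
      (Sum.elim (Sum.elim u v) ζ)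
    have hc' : ∀ a, c a < D := fun a => (hc a).trans_le (le_trans (by
      simp only [Fintype.card_sum, Fintype.card_option]
      exact Nat.mul_le_mul_right _ (Nat.mul_le_mul_right _ (by omega))) hD)
    have hE' : Equi K M (Sum.elim (Sum.elim (scale N fun i => c (.inl (.inl i)))
        (scale N fun i => c (.inl (.inr i)))) (scale N fun z => c (.inr z)))
        (Sum.elim (Sum.elim u v) ζ) := by
      convert hE using 1
      funext a
      rcases a with (a | a) | a <;> rfl
    have hE₁ := hE'.comp Sum.inl
    have hv := hs.valid
    refine .equi (fun i => hc' (.inl (.inl i))) (fun i => hc' (.inl (.inr i)))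
      (he.trans hE₁.symm) (.pushPop h h' (fun z => c (.inr z)) (fun z => hc' _) (fun z => ?_) ?_ ?_
        (ih hE₁))
    · exact (hE'.le_iff (.inr z) (.inl (.inl none))).2 (hζ z)
    · exact ((hE'.frame_left.symm.mono hK).holds_iff (withFrame_le hv.left hζ le_rfl) ψ
        (hP _ h)).1 hψ
    · exact ((hE'.frame_right.symm.mono hK).holds_iff (withFrame_le hv.right hζ hv.now_le) ψ'
        (hP _ h')).1 hψ'
  | @trans ℓ k r w w' u s v h h' ih ih' =>
    obtain ⟨c, hc, hE⟩ := exists_equi_scale (K := K) (M := M) (N := N) hM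
      (by simp only [Fintype.card_sum, Fintype.card_option]; omega) (le_refl _)
      (Sum.elim (Sum.elim u s) v)
    have hc' : ∀ a, c a < D := fun a => (hc a).trans_le (le_trans (by
      simp only [Fintype.card_sum, Fintype.card_option]
      exact Nat.mul_le_mul_right _ (Nat.mul_le_mul_right _ (by omega))) hD)
    have hE' : Equi K M (Sum.elim (Sum.elim (scale N fun i => c (.inl (.inl i)))
        (scale N fun i => c (.inl (.inr i)))) (scale N fun z => c (.inr z)))
        (Sum.elim (Sum.elim u s) v) := by
      convert hE using 1
      funext a
      rcases a with (a | a) | a <;> rfl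
    have hE₁₃ : Equi K M (Sum.elim (scale N fun i => c (.inl (.inl i)))
        (scale N fun z => c (.inr z))) (Sum.elim u v) := by
      convert hE'.comp (Sum.map Sum.inl id) using 1 <;> (funext a; rcases a with a | a <;> rfl)
    have hE₂₃ : Equi K M (Sum.elim (scale N fun i => c (.inl (.inr i)))
        (scale N fun z => c (.inr z))) (Sum.elim s v) := by
      convert hE'.comp (Sum.map Sum.inr id) using 1 <;> (funext a; rcases a with a | a <;> rfl)
    exact .equi (fun i => hc' (.inl (.inl i))) (fun i => hc' (.inr i))
      (he.trans hE₁₃.symm)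
      (.trans (fun i => hc' (.inl (.inr i))) (ih (hE'.comp Sum.inl)) (ih' hE₂₃))

theorem TPDA.mem_untimedLanguage_iff_gen [Fintype X] [Fintype Z] (hM : 0 < M)
    (hP : ∀ ρ ∈ P.rules, ρ.2.1.BoundedBy C M) (hK : K = 3 ^ Fintype.card Z * (C + 2 + M))
    (hN : 3 * (Fintype.card X + 1) + Fintype.card Z < N)
    (hD : (3 * (Fintype.card X + 1) + Fintype.card Z) * (K + M + 1) * N ≤ D)
    {ℓ r : L} {w : List S} :
    w ∈ P.untimedLanguage ℓ r ↔ ∃ p q : Option X → ℕ, (∀ i, p i < D) ∧ (∀ i, q i < D) ∧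
      (∀ i, p i = p none) ∧ (∀ i, q i = q none) ∧ P.Gen N K M D ℓ p w r q := by
  rw [TPDA.mem_untimedLanguage_iff]
  have hCK : C + 2 + M ≤ K := hK ▸ Nat.le_mul_of_pos_left _ (by positivity)
  constructor
  · rintro ⟨u, v, hu, hv, h⟩
    obtain ⟨c, hc, hE⟩ := exists_equi_scale (K := K) (M := M) (N := N) hM
      (by simp only [Fintype.card_sum, Fintype.card_option]; omega) (le_refl _)
      (Sum.elim u v)
    have hc' : ∀ a, c a < D := fun a => (hc a).trans_le (le_trans (by
      simp only [Fintype.card_sum, Fintype.card_option]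
      exact Nat.mul_le_mul_right _ (Nat.mul_le_mul_right _ (by omega))) hD)
    have hE' : Equi K M (Sum.elim (scale N fun i => c (.inl i)) (scale N fun i => c (.inr i)))
        (Sum.elim u v) := by
      convert hE using 1
      funext a
      rcases a with a | a <;> rfl
    refine ⟨_, _, fun i => hc' (.inl i), fun i => hc' (.inr i), fun i => ?_, fun i => ?_,
      h.gen hM hP (by omega) hN hD hE'⟩
    · exact (scale_injective (by omega)).1 ((hE.eq_iff (.inl i) (.inl none)).2 (hu i))
    · exact (scale_injective (by omega)).1 ((hE.eq_iff (.inr i) (.inr none)).2 (hv i))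
  · rintro ⟨p, q, -, -, hp, hq, h⟩
    -- The end `τ` may differ from `scale N q`, but equivalence preserves that all its stamps are
    -- equal.
    obtain ⟨τ, -, he, hS⟩ := h.sound hM hP hK (.refl _)
    refine ⟨scale N p, τ, fun i => (scale_injective (by omega)).2 (hp i), fun i => ?_, hS⟩
    exact (he.eq_iff (.inr i) (.inr none)).1 ((scale_injective (by omega)).2 (hq i))

end Gen

/-! ### Languages of coded grammars -/

section Grammar

open ContextFreeGrammar

/-- A rule of a coded grammar in the sense of `ContextFreeGrammar`. -/
def GrammarCode.toRule (ρ : ℕ × List (ℕ ⊕ ℕ)) : ContextFreeRule ℕ ℕ :=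
  ⟨ρ.1, ρ.2.map (Sum.elim Symbol.terminal Symbol.nonterminal)⟩

theorem GrammarCode.mem_rules {c : GrammarCode} {ρ : ContextFreeRule ℕ ℕ} :
    ρ ∈ c.grammar.rules ↔ ∃ σ ∈ c.2, GrammarCode.toRule σ = ρ :=
  List.mem_toFinset.trans List.mem_map

/-- The language of a sentential form, given the languages of the nonterminals. -/
def formLanguage {T N : Type*} (sem : N → Language T) (u : List (Symbol T N)) : Language T :=
  (u.map fun
    | .terminal a => ({[a]} : Language T)
    | .nonterminal A => sem A).prod

theorem formLanguage_append {T N : Type*} (sem : N → Language T) (u v : List (Symbol T N)) :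
    formLanguage sem (u ++ v) = formLanguage sem u * formLanguage sem v := by
  rw [formLanguage, List.map_append, List.prod_append]; rfl

theorem formLanguage_terminal {T N : Type*} (sem : N → Language T) (w : List T) :
    w ∈ formLanguage sem (w.map Symbol.terminal) := by
  induction w with
  | nil => exact Language.nil_mem_one
  | cons a w ih =>
    exact Language.mem_mul.2 ⟨[a], rfl, w, ih, rfl⟩

/-- An interpretation of the nonterminals that is closed under the rules contains the language of
the grammar. -/
theorem language_le_of_rules {T : Type*} (g : ContextFreeGrammar T) (sem : g.NT → Language T)
    (h : ∀ ρ ∈ g.rules, formLanguage sem ρ.output ≤ sem ρ.input) : g.language ≤ sem g.initial := by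
  intro w hw
  have key : ∀ u v, g.Derives u v → formLanguage sem v ≤ formLanguage sem u := by
    intro u v huv
    induction huv with
    | refl => exact le_rfl
    | tail _ hs ih =>
      obtain ⟨ρ, hρ, hr⟩ := hs
      obtain ⟨p, q, rfl, rfl⟩ := hr.exists_parts
      -- A rewriting step replaces one factor of a product of languages by a smaller one.
      refine le_trans ?_ ih
      simp only [formLanguage_append]
      have : formLanguage sem ρ.output ≤ formLanguage sem [.nonterminal ρ.input] := by
        simpa [formLanguage] using h ρ hρ
      gcongr
  have := key _ _ hw (formLanguage_terminal sem w)
  simpa [formLanguage] using this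

/-- The words that a nonterminal of a coded grammar generates. -/
def GrammarCode.Yields (c : GrammarCode) (A : ℕ) (w : List ℕ) : Prop :=
  c.grammar.Derives [Symbol.nonterminal A] (w.map Symbol.terminal)

namespace GrammarCode

variable {c : GrammarCode} {A B C a : ℕ} {w w' : List ℕ}

theorem derives_of_mem {u : List (ℕ ⊕ ℕ)} (h : (A, u) ∈ c.2) :
    c.grammar.Derives [Symbol.nonterminal A]
      (u.map (Sum.elim Symbol.terminal Symbol.nonterminal)) :=
  Produces.single ⟨_, mem_rules.2 ⟨_, h, rfl⟩, ContextFreeRule.Rewrites.input_output⟩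

theorem Yields.nil (h : (A, []) ∈ c.2) : c.Yields A [] := derives_of_mem h

theorem Yields.letter (h : (A, [.inl a]) ∈ c.2) : c.Yields A [a] := derives_of_mem h

theorem Yields.unit (h : (A, [.inr B]) ∈ c.2) (hB : c.Yields B w) : c.Yields A w :=
  (derives_of_mem h).trans hB

theorem Yields.binary (h : (A, [.inr B, .inr C]) ∈ c.2) (hB : c.Yields B w)
    (hC : c.Yields C w') : c.Yields A (w ++ w') := by
  rw [Yields, List.map_append]
  exact (derives_of_mem h).trans ((Derives.append_right hB [_]).trans (Derives.append_left hC _))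

end GrammarCode

end Grammar

/-! ### Tuples as digits of numbers -/

/-- Digit `i` of `P` in base `D`. -/
def dig (D P i : ℕ) : ℕ := P / D ^ i % D

theorem dig_lt {D : ℕ} (hD : 0 < D) (P i : ℕ) : dig D P i < D := Nat.mod_lt _ hD

theorem exists_dig {D : ℕ} (n : ℕ) (f : ℕ → ℕ) (hf : ∀ i < n, f i < D) :
    ∃ P < D ^ n, ∀ i < n, dig D P i = f i := by
  induction n generalizing f with
  | zero => exact ⟨0, by simp, by simp⟩
  | succ n ih =>
    obtain ⟨P, hP, h⟩ := ih (fun i => f (i + 1)) fun i hi => hf _ (by omega)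
    have h0 := hf 0 (by omega)
    refine ⟨f 0 + D * P, ?_, ?_⟩
    · calc f 0 + D * P < D + D * P := by omega
        _ = D * (P + 1) := by ring
        _ ≤ D * D ^ n := Nat.mul_le_mul_left _ hP
        _ = D ^ (n + 1) := by ring
    · rintro (_ | i) hi
      · rw [dig, pow_zero, Nat.div_one, Nat.add_mul_mod_self_left, Nat.mod_eq_of_lt h0]
      · rw [dig, pow_succ', ← Nat.div_div_eq_div_mul, Nat.add_mul_div_left _ _ (by omega),
          Nat.div_eq_of_lt h0, zero_add]
        exact h i (by omega)

/-- The digit that holds a time stamp. -/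
def idx {x : ℕ} : Option (Fin x) → ℕ
  | none => x
  | some i => i

theorem idx_lt {x : ℕ} (i : Option (Fin x)) : idx i < x + 1 := by
  rcases i with _ | i
  · exact Nat.lt_succ_self x
  · exact i.2.trans (Nat.lt_succ_self x)

theorem exists_idx {x j : ℕ} (hj : j < x + 1) : ∃ i : Option (Fin x), idx i = j := by
  rcases Nat.lt_succ_iff_lt_or_eq.1 hj with h | rfl
  · exact ⟨some ⟨j, h⟩, rfl⟩
  · exact ⟨none, rfl⟩

/-- Positions in the concatenation of two tuples. -/
def idx₂ {x : ℕ} : Option (Fin x) ⊕ Option (Fin x) → ℕ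
  | .inl i => idx i
  | .inr i => x + 1 + idx i

theorem idx₂_lt {x : ℕ} (i : Option (Fin x) ⊕ Option (Fin x)) : idx₂ i < 2 * (x + 1) := by
  rcases i with i | i <;> simp only [idx₂] <;> have := idx_lt i <;> omega

theorem exists_idx₂ {x j : ℕ} (hj : j < 2 * (x + 1)) :
    ∃ i : Option (Fin x) ⊕ Option (Fin x), idx₂ i = j := by
  by_cases h : j < x + 1
  · obtain ⟨i, hi⟩ := exists_idx h
    exact ⟨.inl i, hi⟩
  · obtain ⟨i, hi⟩ := exists_idx (show j - (x + 1) < x + 1 by omega)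
    exact ⟨.inr i, by rw [idx₂, hi]; omega⟩

/-- The tuple of time stamps with code `P`. -/
def tup (D x P : ℕ) : Option (Fin x) → ℕ := fun i => dig D P (idx i)

/-- The stack frame with code `F`. -/
def frm (D z F : ℕ) : Fin z → ℕ := fun i => dig D F i

theorem exists_tup {D x : ℕ} (p : Option (Fin x) → ℕ) (hp : ∀ i, p i < D) :
    ∃ P < D ^ (x + 1), tup D x P = p := by
  obtain ⟨P, hP, h⟩ := exists_dig (D := D) (x + 1)
    (fun j => if hj : j < x then p (some ⟨j, hj⟩) else p none)
    (fun j _ => by split_ifs <;> exact hp _)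
  refine ⟨P, hP, funext fun i => ?_⟩
  rw [tup, h _ (idx_lt i)]
  rcases i with _ | i
  · simp [idx]
  · simp [idx]

theorem exists_frm {D z : ℕ} (p : Fin z → ℕ) (hp : ∀ i, p i < D) :
    ∃ F < D ^ z, frm D z F = p := by
  obtain ⟨F, hF, h⟩ := exists_dig (D := D) z (fun j => if hj : j < z then p ⟨j, hj⟩ else 0)
    (fun j hj => by rw [dif_pos hj]; exact hp _)
  refine ⟨F, hF, funext fun i => ?_⟩
  rw [frm, h _ i.2, dif_pos i.2]

/-- `Valid` on codes. -/
def ValidN (D x P Q : ℕ) : Prop :=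
  ∀ j < x + 1, dig D P j ≤ dig D P x ∧ dig D Q j ≤ dig D Q x ∧
    (dig D Q j = dig D P j ∨ dig D P x ≤ dig D Q j)

/-- Equality of the coded tuples. -/
def SameN (D n P Q : ℕ) : Prop := ∀ j < n, dig D Q j = dig D P j

/-- All time stamps are equal. -/
def ConstN (D x P : ℕ) : Prop := ∀ j < x + 1, dig D P j = dig D P x

/-- The digits of `P`, and then those of `Q`. -/
def jdig (D x P Q j : ℕ) : ℕ := if j < x + 1 then dig D P j else dig D Q (j - (x + 1))

/-- `Equi` on codes of pairs of tuples. -/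
def EquiN (K M N D x P Q P' Q' : ℕ) : Prop :=
  ∀ i < 2 * (x + 1), ∀ j < 2 * (x + 1),
    IntEq K M (((jdig D x P Q i / N : ℕ) : ℤ) - (jdig D x P Q j / N : ℕ))
      (((jdig D x P' Q' i / N : ℕ) : ℤ) - (jdig D x P' Q' j / N : ℕ)) ∧
    (jdig D x P Q i % N ≤ jdig D x P Q j % N ↔ jdig D x P' Q' i % N ≤ jdig D x P' Q' j % N) ∧
    (jdig D x P Q i % N = 0 ↔ jdig D x P' Q' i % N = 0)

/-- The value of clock `i` of the tuple with code `F`, at the present time of the tuple with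
code `P`, in units of `1 / N`. -/
def valN (D x P F i : ℕ) : ℕ := dig D P x - dig D F i

/-! ### Agreement of the predicates on codes with those on tuples. -/

section Codes

variable {N D x z : ℕ}

theorem scale_le_scale {ι κ : Type*} (hN : 0 < N) {p : ι → ℕ} {q : κ → ℕ} {i : ι} {j : κ} :
    scale N p i ≤ scale N q j ↔ p i ≤ q j := by
  have : (0 : ℚ) < N := by exact_mod_cast hN
  rw [scale, scale, div_le_div_iff_of_pos_right this, Nat.cast_le]

theorem scale_eq_scale {ι κ : Type*} (hN : 0 < N) {p : ι → ℕ} {q : κ → ℕ} {i : ι} {j : κ} :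
    scale N p i = scale N q j ↔ p i = q j := by
  rw [le_antisymm_iff, scale_le_scale hN, scale_le_scale hN, ← le_antisymm_iff]

theorem validN_iff (hN : 0 < N) {P Q : ℕ} :
    ValidN D x P Q ↔ Valid (scale N (tup D x P)) (scale N (tup D x Q)) := by
  constructor
  · intro h
    refine ⟨fun i => (scale_le_scale hN).2 (h _ (idx_lt i)).1,
      fun i => (scale_le_scale hN).2 (h _ (idx_lt i)).2.1, fun i => ?_⟩
    rw [scale_le_scale hN, scale_eq_scale hN]
    exact (h _ (idx_lt i)).2.2
  · intro h j hj
    obtain ⟨i, rfl⟩ := exists_idx hj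
    have h3 := h.stay i
    rw [scale_le_scale hN, scale_eq_scale hN] at h3
    exact ⟨(scale_le_scale hN).1 (h.left i), (scale_le_scale hN).1 (h.right i), h3⟩

theorem sameN_iff {P Q : ℕ} : SameN D (x + 1) P Q ↔ ∀ i, tup D x Q i = tup D x P i := by
  constructor
  · exact fun h i => h _ (idx_lt i)
  · intro h j hj
    obtain ⟨i, rfl⟩ := exists_idx hj
    exact h i

theorem constN_iff {P : ℕ} : ConstN D x P ↔ ∀ i, tup D x P i = tup D x P none := by
  constructor
  · exact fun h i => h _ (idx_lt i)
  · intro h j hj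
    obtain ⟨i, rfl⟩ := exists_idx hj
    exact h i

theorem jdig_idx₂ {P Q : ℕ} (i : Option (Fin x) ⊕ Option (Fin x)) :
    jdig D x P Q (idx₂ i) = Sum.elim (tup D x P) (tup D x Q) i := by
  rcases i with i | i
  · rw [jdig, idx₂, if_pos (idx_lt i)]; rfl
  · rw [jdig, idx₂, if_neg (by omega), Nat.add_sub_cancel_left]; rfl

/-- In units of `1 / N`, floor and fractional part are quotient and remainder. -/
theorem equiN_iff {K M : ℕ} (hN : 0 < N) {P Q P' Q' : ℕ} :
    EquiN K M N D x P Q P' Q' ↔ Equi K M (Sum.elim (scale N (tup D x P)) (scale N (tup D x Q)))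
      (Sum.elim (scale N (tup D x P')) (scale N (tup D x Q'))) := by
  have hNQ : (0 : ℚ) < N := by exact_mod_cast hN
  have hs : ∀ (P Q : ℕ) (i : Option (Fin x) ⊕ Option (Fin x)),
      Sum.elim (scale N (tup D x P)) (scale N (tup D x Q)) i =
        ((jdig D x P Q (idx₂ i) : ℕ) : ℚ) / N := by
    intro P Q i
    rw [jdig_idx₂]
    rcases i with i | i <;> rfl
  have hfl : ∀ (P Q : ℕ) (i : Option (Fin x) ⊕ Option (Fin x)),
      ⌊Sum.elim (scale N (tup D x P)) (scale N (tup D x Q)) i⌋ =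
        ((jdig D x P Q (idx₂ i) / N : ℕ) : ℤ) := by
    intro P Q i
    rw [hs, floor_natCast_div]
  have hfr : ∀ (P Q : ℕ) (i : Option (Fin x) ⊕ Option (Fin x)),
      Int.fract (Sum.elim (scale N (tup D x P)) (scale N (tup D x Q)) i) =
        ((jdig D x P Q (idx₂ i) % N : ℕ) : ℚ) / N := by
    intro P Q i
    rw [hs, fract_natCast_div hN]
  constructor
  · intro h
    refine ⟨fun i j => ?_, fun i j => ?_, fun i => ?_⟩
    · rw [hfl, hfl, hfl, hfl]
      exact (h _ (idx₂_lt i) _ (idx₂_lt j)).1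
    · rw [hfr, hfr, hfr, hfr, div_le_div_iff_of_pos_right hNQ, div_le_div_iff_of_pos_right hNQ,
        Nat.cast_le, Nat.cast_le]
      exact (h _ (idx₂_lt i) _ (idx₂_lt j)).2.1
    · rw [hfr, hfr, div_eq_zero_iff, div_eq_zero_iff, or_iff_left hNQ.ne', or_iff_left hNQ.ne',
        Nat.cast_eq_zero, Nat.cast_eq_zero]
      exact (h _ (idx₂_lt i) _ (idx₂_lt i)).2.2
  · intro h i hi j hj
    obtain ⟨i, rfl⟩ := exists_idx₂ hi
    obtain ⟨j, rfl⟩ := exists_idx₂ hj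
    have h1 := h.int i j
    have h2 := h.frac i j
    have h3 := h.zero i
    rw [hfl, hfl, hfl, hfl] at h1
    rw [hfr, hfr, hfr, hfr, div_le_div_iff_of_pos_right hNQ, div_le_div_iff_of_pos_right hNQ,
      Nat.cast_le, Nat.cast_le] at h2
    rw [hfr, hfr, div_eq_zero_iff, div_eq_zero_iff, or_iff_left hNQ.ne', or_iff_left hNQ.ne',
      Nat.cast_eq_zero, Nat.cast_eq_zero] at h3
    exact ⟨h1, h2, h3⟩

/-- Truncation in `ℕ` matches truncation by `toNNRat`, so `a` and `b` may come in any order. -/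
theorem toNNRat_sub_div (hN : 0 < N) (a b : ℕ) :
    ((a : ℚ) / N - (b : ℚ) / N).toNNRat = ((a - b : ℕ) : NNRat) / N := by
  have hNQ : (0 : ℚ) < N := by exact_mod_cast hN
  apply NNRat.coe_injective
  rw [← sub_div, NNRat.coe_div, NNRat.coe_natCast, NNRat.coe_natCast]
  rcases le_total b a with h | h
  · rw [Nat.cast_sub h, Rat.coe_toNNRat]
    have : (b : ℚ) ≤ a := by exact_mod_cast h
    exact div_nonneg (by linarith) hNQ.le
  · rw [Nat.sub_eq_zero_of_le h, Rat.toNNRat_of_nonpos]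
    · simp
    · have : (a : ℚ) ≤ b := by exact_mod_cast h
      exact div_nonpos_of_nonpos_of_nonneg (by linarith) hNQ.le

theorem Atom.holds_map {V W : Type*} (f : V → W) (a : Atom V) (μ : Valuation W) :
    (a.map f).Holds μ ↔ a.Holds fun x => μ (f x) := by
  cases a <;> rfl

theorem Constraint.holds_map {V W : Type*} (f : V → W) (φ : Constraint V) (μ : Valuation W) :
    (φ.map f).Holds μ ↔ φ.Holds fun x => μ (f x) := by
  induction φ with
  | tru => exact Iff.rfl
  | atom a => exact Atom.holds_map f a μ
  | neg φ ih => exact not_congr ih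
  | conj φ ψ ih ih' => exact and_congr ih ih'
  | disj φ ψ ih ih' => exact or_congr ih ih'

theorem holds_test_iff (hN : 0 < N) {P : ℕ} (φ : Constraint (Fin x)) :
    (φ.map Fin.val).Holds (fun i => (valN D x P P i : NNRat) / N) ↔
      φ.Holds (clockVal (scale N (tup D x P))) := by
  rw [Constraint.holds_map]
  have : clockVal (scale N (tup D x P)) = fun i => (valN D x P P i.val : NNRat) / N :=
    funext fun i => toNNRat_sub_div hN _ _
  rw [this]

theorem holds_frame_iff (hN : 0 < N) {P F : ℕ} (ψ : Constraint (Fin x ⊕ Fin z)) :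
    (ψ.map (Sum.map Fin.val Fin.val)).Holds
        (fun i => ((Sum.elim (valN D x P P) (valN D x P F) i : ℕ) : NNRat) / N) ↔
      ψ.Holds (clockVal (withFrame (scale N (tup D x P)) (scale N (frm D z F)))) := by
  rw [Constraint.holds_map]
  have : clockVal (withFrame (scale N (tup D x P)) (scale N (frm D z F))) =
      fun i => ((Sum.elim (valN D x P P) (valN D x P F) (Sum.map Fin.val Fin.val i) : ℕ) :
        NNRat) / N := by
    funext i
    rcases i with i | i
    · exact toNNRat_sub_div hN _ _
    · exact toNNRat_sub_div hN _ _
  rw [this]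

end Codes

/-! ### The grammar of a timed pushdown automaton -/

/-- The constraint of a test. -/
def Op.tests {S G X Z : Type*} : Op S G X Z → List (Constraint X)
  | .test φ => [φ]
  | _ => []

/-- The clocks of a reset. -/
def Op.resets {S G X Z : Type*} : Op S G X Z → List (List X)
  | .reset Y => [Y]
  | _ => []

/-- The symbol and the constraint of a push. -/
def Op.pushes {S G X Z : Type*} : Op S G X Z → List (G × Constraint (X ⊕ Z))
  | .push g ψ => [(g, ψ)]
  | _ => []

/-- The symbol and the constraint of a pop. -/
def Op.pops {S G X Z : Type*} : Op S G X Z → List (G × Constraint (X ⊕ Z))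
  | .pop g ψ => [(g, ψ)]
  | _ => []

/-- `Op.Basic` on codes, for operations that read no letter. -/
def EpsN (N D x : ℕ) (op : OpCode) (P Q : ℕ) : Prop :=
  (op = .elapse ∧ SameN D x P Q) ∨ (op = .input none ∧ SameN D (x + 1) P Q) ∨
  -- Quantification over a list with at most one element replaces pattern matching; bounded
  -- quantifiers preserve primitive recursiveness.
  (∃ φ ∈ op.tests, SameN D (x + 1) P Q ∧ φ.Holds fun i => (valN D x P P i : NNRat) / N) ∨
  ∃ Y ∈ op.resets, dig D Q x = dig D P x ∧
    ∀ i < x, (i ∈ Y ∧ dig D Q i = dig D P x) ∨ (i ∉ Y ∧ dig D Q i = dig D P i)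

/-- Some stack frame can be pushed at `P` under the constraint `ψ` and popped at `Q` under `ψ'`. -/
def FrameN (N D x z : ℕ) (ψ ψ' : Constraint (ℕ ⊕ ℕ)) (P Q : ℕ) : Prop :=
  ∃ F < D ^ z, (∀ i < z, dig D F i ≤ dig D P x) ∧
    (ψ.Holds fun i => ((Sum.elim (valN D x P P) (valN D x P F) i : ℕ) : NNRat) / N) ∧
    ψ'.Holds fun i => ((Sum.elim (valN D x Q Q) (valN D x Q F) i : ℕ) : NNRat) / N

/-- The nonterminal for the runs from location `ℓ` and tuple `P` to location `r` and tuple `Q`. -/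
def nt (ℓ P r Q : ℕ) : ℕ := Nat.pair (Nat.pair ℓ P) (Nat.pair r Q) + 1

/-- The first location of a nonterminal. -/
def srcLoc (A : ℕ) : ℕ := (A - 1).unpair.1.unpair.1

/-- The first tuple of a nonterminal. -/
def srcTup (A : ℕ) : ℕ := (A - 1).unpair.1.unpair.2

/-- The last location of a nonterminal. -/
def tgtLoc (A : ℕ) : ℕ := (A - 1).unpair.2.unpair.1

/-- The last tuple of a nonterminal. -/
def tgtTup (A : ℕ) : ℕ := (A - 1).unpair.2.unpair.2

section

variable (ℓ P r Q : ℕ)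

@[simp] theorem srcLoc_nt : srcLoc (nt ℓ P r Q) = ℓ := by simp [srcLoc, nt]
@[simp] theorem srcTup_nt : srcTup (nt ℓ P r Q) = P := by simp [srcTup, nt]
@[simp] theorem tgtLoc_nt : tgtLoc (nt ℓ P r Q) = r := by simp [tgtLoc, nt]
@[simp] theorem tgtTup_nt : tgtTup (nt ℓ P r Q) = Q := by simp [tgtTup, nt]
-- The number `0` is reserved for the initial nonterminal.
@[simp] theorem nt_ne_zero : nt ℓ P r Q ≠ 0 := Nat.succ_ne_zero _

end

namespace TPDACode

/-- The number of control locations. -/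
def locs (c : TPDACode) : ℕ := c.1.2.2.1

/-- The number of global clocks. -/
def clocks (c : TPDACode) : ℕ := c.1.2.2.2.1

/-- The number of stack clocks. -/
def frame (c : TPDACode) : ℕ := c.1.2.2.2.2

/-- A common multiple of the moduli. -/
def modulus (c : TPDACode) : ℕ := (encode c).factorial

/-- The threshold for differences of integral parts. -/
def thr (c : TPDACode) : ℕ := 3 ^ c.frame * (encode c + 2 + c.modulus)

/-- The denominator. -/
def den (c : TPDACode) : ℕ := 3 * (c.clocks + 1) + c.frame + 1

/-- The bound for time stamps, in units of `1 / c.den`. -/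
def base (c : TPDACode) : ℕ :=
  (3 * (c.clocks + 1) + c.frame) * (c.thr + c.modulus + 1) * c.den

/-- The conditions for the rules of the grammar. -/
def RuleOk (c : TPDACode) (ℓ r : ℕ) (k A B C : ℕ) : Prop :=
  (k = 0 ∧ A ≠ 0 ∧ ValidN c.base c.clocks (srcTup A) (tgtTup A) ∧
    -- Here the location must be checked to exist; in the other rules locations come from a
    -- transition, from a nonterminal on the right, or from `ℓ` and `r`.
    ((srcLoc A = tgtLoc A ∧ srcLoc A < c.locs ∧
        SameN c.base (c.clocks + 1) (srcTup A) (tgtTup A)) ∨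
      ∃ ρ ∈ c.2, ρ.1 = srcLoc A ∧ ρ.2.2 = tgtLoc A ∧
        EpsN c.den c.base c.clocks ρ.2.1 (srcTup A) (tgtTup A))) ∨
  (k = 1 ∧ A ≠ 0 ∧ ValidN c.base c.clocks (srcTup A) (tgtTup A) ∧
    SameN c.base (c.clocks + 1) (srcTup A) (tgtTup A) ∧
    ∃ ρ ∈ c.2, ρ = (srcLoc A, Op.input (some B), tgtLoc A)) ∨
  (k = 2 ∧ A = 0 ∧ B ≠ 0 ∧ srcLoc B = ℓ ∧ tgtLoc B = r ∧
    ConstN c.base c.clocks (srcTup B) ∧ ConstN c.base c.clocks (tgtTup B)) ∨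
  (k = 2 ∧ A ≠ 0 ∧ B ≠ 0 ∧ srcLoc B = srcLoc A ∧ tgtLoc B = tgtLoc A ∧
    EquiN c.thr c.modulus c.den c.base c.clocks (srcTup A) (tgtTup A) (srcTup B) (tgtTup B)) ∨
  (k = 2 ∧ A ≠ 0 ∧ B ≠ 0 ∧ srcTup B = srcTup A ∧ tgtTup B = tgtTup A ∧
    ∃ ρ ∈ c.2, ρ.1 = srcLoc A ∧ ρ.2.2 = srcLoc B ∧
      ∃ ρ' ∈ c.2, ρ'.1 = tgtLoc B ∧ ρ'.2.2 = tgtLoc A ∧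
        ∃ a ∈ ρ.2.1.pushes, ∃ b ∈ ρ'.2.1.pops, a.1 = b.1 ∧
          FrameN c.den c.base c.clocks c.frame a.2 b.2 (srcTup A) (tgtTup A)) ∨
  (3 ≤ k ∧ A ≠ 0 ∧ B ≠ 0 ∧ C ≠ 0 ∧ srcLoc B = srcLoc A ∧ srcTup B = srcTup A ∧
    srcLoc C = tgtLoc B ∧ srcTup C = tgtTup B ∧ tgtLoc C = tgtLoc A ∧ tgtTup C = tgtTup A)

/-- The right-hand side of a rule. -/
def rhs (k B C : ℕ) : List (ℕ ⊕ ℕ) :=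
  if k = 0 then [] else if k = 1 then [.inl B] else if k = 2 then [.inr B] else [.inr B, .inr C]

/-- A bound for the locations, tuples and letters in use. -/
def width (c : TPDACode) : ℕ := c.locs + c.base ^ (c.clocks + 1) + c.1.1

/-- A bound for the nonterminals and letters in use. -/
def bound (c : TPDACode) : ℕ := nt c.width c.width c.width c.width + 3

open Classical in
/-- The grammar for the runs from `ℓ` to `r`. -/
noncomputable def toGrammar (c : TPDACode) (ℓ r : ℕ) : GrammarCode :=
  -- By monotonicity of pairing the range contains the codes of all quadruples `(k, A, B, C)` with
  -- entries at most `bound`.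
  (0, ((List.range (Nat.pair c.bound (Nat.pair c.bound (Nat.pair c.bound c.bound)) + 1)).filter
    fun n => RuleOk c ℓ r n.unpair.1 n.unpair.2.unpair.1 n.unpair.2.unpair.2.unpair.1
      n.unpair.2.unpair.2.unpair.2).map
    fun n => (n.unpair.2.unpair.1,
      rhs n.unpair.1 n.unpair.2.unpair.2.unpair.1 n.unpair.2.unpair.2.unpair.2))

theorem mem_toGrammar {c : TPDACode} {ℓ r : ℕ} {ρ : ℕ × List (ℕ ⊕ ℕ)}
    (h : ρ ∈ (toGrammar c ℓ r).2) :
    ∃ k B C, RuleOk c ℓ r k ρ.1 B C ∧ ρ.2 = rhs k B C := by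
  simp only [toGrammar, List.mem_map, List.mem_filter, decide_eq_true_eq] at h
  obtain ⟨n, ⟨-, h⟩, rfl⟩ := h
  exact ⟨_, _, _, h, rfl⟩

theorem pair_mono {a b a' b' : ℕ} (h : a ≤ a') (h' : b ≤ b') : Nat.pair a b ≤ Nat.pair a' b' := by
  have h1 : Nat.pair a b ≤ Nat.pair a' b := by
    rcases h.lt_or_eq with h | rfl
    · exact (Nat.pair_lt_pair_left b h).le
    · exact le_rfl
  have h2 : Nat.pair a' b ≤ Nat.pair a' b' := by
    rcases h'.lt_or_eq with h | rfl
    · exact (Nat.pair_lt_pair_right a' h).le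
    · exact le_rfl
  exact h1.trans h2

theorem RuleOk.mem {c : TPDACode} {ℓ r k A B C : ℕ} (h : RuleOk c ℓ r k A B C) (hk : k ≤ 3)
    (hA : A ≤ c.bound) (hB : B ≤ c.bound) (hC : C ≤ c.bound) :
    (A, rhs k B C) ∈ (toGrammar c ℓ r).2 := by
  simp only [toGrammar, List.mem_map, List.mem_filter, decide_eq_true_eq, List.mem_range]
  refine ⟨Nat.pair k (Nat.pair A (Nat.pair B C)), ⟨Nat.lt_succ_of_le ?_, ?_⟩, ?_⟩
  -- The summand `3` in `bound` accommodates the kind `k` of the rule.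
  · exact pair_mono (hk.trans (Nat.le_add_left _ _)) (pair_mono hA (pair_mono hB hC))
  · simpa using h
  · simp

theorem nt_le_bound {c : TPDACode} {ℓ P r Q : ℕ} (hℓ : ℓ < c.locs)
    (hP : P < c.base ^ (c.clocks + 1)) (hr : r < c.locs) (hQ : Q < c.base ^ (c.clocks + 1)) :
    nt ℓ P r Q ≤ c.bound := by
  have : nt ℓ P r Q ≤ nt c.width c.width c.width c.width :=
    Nat.succ_le_succ (pair_mono (pair_mono (by unfold width; omega) (by unfold width; omega))
      (pair_mono (by unfold width; omega) (by unfold width; omega)))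
  exact this.trans (Nat.le_add_right _ _)

theorem letter_le_bound {c : TPDACode} {a : ℕ} (ha : a < c.1.1) : a ≤ c.bound := by
  have h1 : a ≤ c.width := by unfold width; omega
  have h2 : c.width ≤ Nat.pair (Nat.pair c.width c.width) (Nat.pair c.width c.width) :=
    (Nat.left_le_pair _ _).trans (Nat.left_le_pair _ _)
  unfold bound nt
  omega

theorem den_pos (c : TPDACode) : 0 < c.den := Nat.succ_pos _

theorem modulus_pos (c : TPDACode) : 0 < c.modulus := Nat.factorial_pos _

theorem base_pos (c : TPDACode) : 0 < c.base := by
  unfold base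
  have := c.den_pos
  positivity

end TPDACode

/-! ### Bounds for the constants -/

section Bounds

theorem natAbs_le_encode (k : ℤ) : |k| ≤ (encode k : ℕ) := by
  cases k with
  | ofNat n =>
    have : encode (Int.ofNat n) = 2 * n := rfl
    rw [this]
    simp only [Int.ofNat_eq_natCast, Nat.abs_cast]
    push_cast
    omega
  | negSucc n =>
    have : encode (Int.negSucc n) = 2 * n + 1 := rfl
    rw [this, Int.abs_eq_natAbs, Int.natAbs_negSucc]
    push_cast
    omega

theorem pnat_le_encode (m : ℕ+) : (m : ℕ) ≤ encode m + 1 := by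
  have : encode m = m.natPred := rfl
  rw [this, PNat.natPred_add_one]

/-- A Gödel number dominates the codes of its parts. So it bounds the constants, and its factorial
is a multiple of every modulus. -/
theorem Constraint.boundedBy_of_toNat_le {V : Type*} [Denumerable V] {φ : Constraint V} {n : ℕ}
    (h : φ.toNat ≤ n) : φ.BoundedBy n n.factorial := by
  induction φ with
  | tru => trivial
  | atom a =>
    have ha : encode a + 1 ≤ n := by rw [Constraint.toNat] at h; omega
    have he : encode a = encode (Atom.equivSum V a) := rfl
    have hk : ∀ k : ℤ, encode k ≤ n → |k| ≤ (n : ℤ) := fun k hk =>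
      (natAbs_le_encode k).trans (by exact_mod_cast hk)
    have hm : ∀ m : ℕ+, encode m + 1 ≤ n → (m : ℕ) ∣ n.factorial := fun m hm =>
      Nat.dvd_factorial m.pos ((pnat_le_encode m).trans hm)
    cases a with
    | floorLe x k =>
      have e : encode (Atom.floorLe x k) = 2 * Nat.pair (encode x) (encode k) := rfl
      have := Nat.right_le_pair (encode x) (encode k)
      exact hk k (by omega)
    | floorMod x m k =>
      have e : encode (Atom.floorMod x m k) =
        2 * (2 * Nat.pair (encode x) (Nat.pair (encode m) (encode k))) + 1 := rfl
      have h1 := Nat.right_le_pair (encode x) (Nat.pair (encode m) (encode k))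
      have h2 := Nat.left_le_pair (encode m) (encode k)
      exact hm m (by omega)
    | fracZero x => trivial
    | diffLe x y k =>
      have e : encode (Atom.diffLe x y k) = 2 * (2 * (2 * (2 *
        Nat.pair (encode x) (Nat.pair (encode y) (encode k))) + 1) + 1) + 1 := rfl
      have h1 := Nat.right_le_pair (encode x) (Nat.pair (encode y) (encode k))
      have h2 := Nat.right_le_pair (encode y) (encode k)
      exact hk k (by omega)
    | diffMod x y m k =>
      have e : encode (Atom.diffMod x y m k) = 2 * (2 * (2 * (2 * (2 *
        Nat.pair (encode x) (Nat.pair (encode y) (Nat.pair (encode m) (encode k)))) + 1) + 1)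
          + 1) + 1 := rfl
      have h1 := Nat.right_le_pair (encode x) (Nat.pair (encode y) (Nat.pair (encode m) (encode k)))
      have h2 := Nat.right_le_pair (encode y) (Nat.pair (encode m) (encode k))
      have h3 := Nat.left_le_pair (encode m) (encode k)
      exact hm m (by omega)
    | fracLe x y => trivial
  | neg φ ih => exact ih (by rw [Constraint.toNat] at h; omega)
  | conj φ ψ ih ih' =>
    have h1 := Nat.left_le_pair φ.toNat ψ.toNat
    have h2 := Nat.right_le_pair φ.toNat ψ.toNat
    rw [Constraint.toNat] at h
    exact ⟨ih (by omega), ih' (by omega)⟩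
  | disj φ ψ ih ih' =>
    have h1 := Nat.left_le_pair φ.toNat ψ.toNat
    have h2 := Nat.right_le_pair φ.toNat ψ.toNat
    rw [Constraint.toNat] at h
    exact ⟨ih (by omega), ih' (by omega)⟩

theorem Constraint.boundedBy_map {V W : Type*} (f : V → W) {C M : ℕ} (φ : Constraint V) :
    (φ.map f).BoundedBy C M ↔ φ.BoundedBy C M := by
  induction φ with
  | tru => exact Iff.rfl
  | atom a => cases a <;> exact Iff.rfl
  | neg φ ih => exact ih
  | conj φ ψ ih ih' => exact and_congr ih ih'
  | disj φ ψ ih ih' => exact and_congr ih ih'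

theorem Op.boundedBy_of_encode_le {op : OpCode} {n : ℕ} (h : encode op ≤ n) :
    op.BoundedBy n n.factorial := by
  cases op with
  | elapse => trivial
  | input a => trivial
  | test φ =>
    have e : encode (Op.test φ : OpCode) = 2 * (2 * (2 * φ.toNat) + 1) + 1 := rfl
    exact Constraint.boundedBy_of_toNat_le (by omega)
  | reset Y => trivial
  | push g ψ =>
    have e : encode (Op.push g ψ : OpCode) =
      2 * (2 * (2 * (2 * (2 * Nat.pair g ψ.toNat) + 1) + 1) + 1) + 1 := rfl
    have := Nat.right_le_pair g ψ.toNat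
    exact Constraint.boundedBy_of_toNat_le (by omega)
  | pop g ψ =>
    have e : encode (Op.pop g ψ : OpCode) =
      2 * (2 * (2 * (2 * (2 * Nat.pair g ψ.toNat + 1) + 1) + 1) + 1) + 1 := rfl
    have := Nat.right_le_pair g ψ.toNat
    exact Constraint.boundedBy_of_toNat_le (by omega)

theorem encode_le_of_mem {α : Type*} [Encodable α] {a : α} {l : List α} (h : a ∈ l) :
    encode a ≤ encode l := by
  induction l with
  | nil => exact absurd h List.not_mem_nil
  | cons b l ih =>
    rw [Encodable.encode_list_cons]
    rcases List.mem_cons.1 h with rfl | h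
    · exact (Nat.left_le_pair _ _).trans (Nat.le_succ _)
    · exact (ih h).trans ((Nat.right_le_pair _ _).trans (Nat.le_succ _))

theorem TPDA.boundedBy_of_mem {s g l x z : ℕ} {P : TPDA (Fin s) (Fin g) (Fin l) (Fin x) (Fin z)}
    {ρ : Fin l × Op (Fin s) (Fin g) (Fin x) (Fin z) × Fin l} (h : ρ ∈ P.rules) :
    ρ.2.1.BoundedBy (encode P.code) (encode P.code).factorial := by
  have h1 : encode (ρ.2.1.map Fin.val Fin.val Fin.val Fin.val : OpCode) ≤ encode P.code := by
    have h2 := encode_le_of_mem (List.mem_map_of_mem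
      (f := fun ρ : Fin l × Op (Fin s) (Fin g) (Fin x) (Fin z) × Fin l =>
        ((ρ.1.val, ρ.2.1.map Fin.val Fin.val Fin.val Fin.val, ρ.2.2.val) : ℕ × OpCode × ℕ)) h)
    rw [Encodable.encode_prod_val, Encodable.encode_prod_val] at h2
    have h3 : encode P.code.2 ≤ encode P.code := Nat.right_le_pair _ _
    exact (((Nat.left_le_pair _ _).trans (Nat.right_le_pair _ _)).trans h2).trans h3
  have h2 := Op.boundedBy_of_encode_le h1
  obtain ⟨a, op, b⟩ := ρ
  cases op with
  | elapse => trivial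
  | input a => trivial
  | test φ => exact (Constraint.boundedBy_map _ φ).1 h2
  | reset Y => trivial
  | push g ψ => exact (Constraint.boundedBy_map _ ψ).1 h2
  | pop g ψ => exact (Constraint.boundedBy_map _ ψ).1 h2

end Bounds

/-! ### Correctness of the grammar. -/

section Correctness

variable {s g l x z : ℕ}

theorem Op.epsN_iff {N D : ℕ} (hN : 0 < N) {P Q : ℕ} (op : Op (Fin s) (Fin g) (Fin x) (Fin z)) :
    EpsN N D x (op.map Fin.val Fin.val Fin.val Fin.val) P Q ↔
      op.Basic [] (scale N (tup D x P)) (scale N (tup D x Q)) := by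
  have hdig : ∀ i : Fin x, dig D Q i = dig D P i ↔
      scale N (tup D x Q) (some i) = scale N (tup D x P) (some i) := fun i =>
    (scale_eq_scale hN (p := tup D x Q) (q := tup D x P) (i := some i) (j := some i)).symm
  cases op with
  | elapse =>
    simp only [EpsN, Op.map, Op.tests, Op.resets, Op.Basic, List.not_mem_nil, false_and,
      exists_false, or_false, true_and, reduceCtorEq, SameN]
    exact ⟨fun h i => (hdig i).1 (h i i.2), fun h j hj => (hdig ⟨j, hj⟩).2 (h _)⟩
  | input a =>
    rcases a with _ | a
    · simp [EpsN, Op.map, Op.tests, Op.resets, Op.Basic, sameN_iff, scale_eq_scale hN]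
    · simp [EpsN, Op.map, Op.tests, Op.resets, Op.Basic]
  | test φ =>
    simp [EpsN, Op.map, Op.tests, Op.resets, Op.Basic, sameN_iff, scale_eq_scale hN,
      holds_test_iff hN]
  | reset Y =>
    have hnow : dig D Q x = dig D P x ↔ scale N (tup D x Q) none = scale N (tup D x P) none :=
      (scale_eq_scale hN (p := tup D x Q) (q := tup D x P) (i := none) (j := none)).symm
    have hset : ∀ i : Fin x, dig D Q i = dig D P x ↔
        scale N (tup D x Q) (some i) = scale N (tup D x P) none := fun i =>
      (scale_eq_scale hN (p := tup D x Q) (q := tup D x P) (i := some i) (j := none)).symm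
    simp only [EpsN, Op.map, Op.tests, Op.resets, Op.Basic, List.not_mem_nil, false_and,
      exists_false, false_or, true_and, reduceCtorEq, List.mem_singleton, exists_eq_left]
    rw [hnow]
    refine and_congr_right fun _ => ⟨fun h i => ?_, fun h j hj => ?_⟩
    · have hmem : i.val ∈ Y.map Fin.val ↔ i ∈ Y :=
        List.mem_map_of_injective Fin.val_injective
      rw [← hset, ← hdig, ← hmem]
      have := h i i.2
      tauto
    · have hmem : j ∈ Y.map Fin.val ↔ (⟨j, hj⟩ : Fin x) ∈ Y :=
        List.mem_map_of_injective (a := (⟨j, hj⟩ : Fin x)) Fin.val_injective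
      have := h ⟨j, hj⟩
      rw [← hset, ← hdig, ← hmem] at this
      tauto
  | push γ ψ => simp [EpsN, Op.map, Op.tests, Op.resets, Op.Basic]
  | pop γ ψ => simp [EpsN, Op.map, Op.tests, Op.resets, Op.Basic]

theorem Op.Basic.word {S G X Z : Type*} {op : Op S G X Z} {w : List S} {u v : Option X → ℚ}
    (h : op.Basic w u v) : w = [] ∨ ∃ a, op = .input (some a) ∧ w = [a] := by
  cases op with
  | elapse => exact .inl h.1
  | input a =>
    rcases a with _ | a
    · exact .inl h.1
    · exact .inr ⟨a, rfl, h.1⟩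
  | test φ => exact .inl h.1
  | reset Y => exact .inl h.1
  | push γ ψ => exact h.elim
  | pop γ ψ => exact h.elim

variable {P : TPDA (Fin s) (Fin g) (Fin l) (Fin x) (Fin z)}

theorem TPDA.mem_code {ρ : ℕ × OpCode × ℕ} : ρ ∈ P.code.2 ↔ ∃ σ ∈ P.rules,
    (σ.1.val, σ.2.1.map Fin.val Fin.val Fin.val Fin.val, σ.2.2.val) = ρ := List.mem_map

/-- `TPDA.Gen` with the parameters of the grammar. -/
def TPDA.CodeGen (P : TPDA (Fin s) (Fin g) (Fin l) (Fin x) (Fin z)) (ℓ : Fin l) (A : ℕ)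
    (w : List (Fin s)) (r : Fin l) (B : ℕ) : Prop :=
  P.Gen P.code.den P.code.thr P.code.modulus P.code.base ℓ (tup P.code.base x A) w r
    (tup P.code.base x B)

theorem TPDA.mem_untimedLanguage_iff_code {ℓ r : Fin l} {w : List (Fin s)} :
    w ∈ P.untimedLanguage ℓ r ↔ ∃ p q : Option (Fin x) → ℕ, (∀ i, p i < P.code.base) ∧
      (∀ i, q i < P.code.base) ∧ (∀ i, p i = p none) ∧ (∀ i, q i = q none) ∧
      P.Gen P.code.den P.code.thr P.code.modulus P.code.base ℓ p w r q :=
  P.mem_untimedLanguage_iff_gen P.code.modulus_pos (fun ρ hρ => TPDA.boundedBy_of_mem hρ)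
    (by rw [Fintype.card_fin]; rfl)
    (by rw [Fintype.card_fin, Fintype.card_fin]; exact Nat.lt_succ_self _)
    (by rw [Fintype.card_fin, Fintype.card_fin]; exact le_refl _)

theorem TPDA.mem_untimedLanguage_of_codeGen {ℓ r : Fin l} {w : List (Fin s)} {A B : ℕ}
    (hA : ConstN P.code.base x A) (hB : ConstN P.code.base x B) (h : P.CodeGen ℓ A w r B) :
    w ∈ P.untimedLanguage ℓ r :=
  TPDA.mem_untimedLanguage_iff_code.2 ⟨_, _, fun _ => dig_lt P.code.base_pos _ _,
    fun _ => dig_lt P.code.base_pos _ _, constN_iff.1 hA, constN_iff.1 hB, h⟩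

/-- The words that nonterminals stand for. -/
def TPDA.sem (P : TPDA (Fin s) (Fin g) (Fin l) (Fin x) (Fin z)) (ℓ r : Fin l) (A : ℕ) :
    Language ℕ :=
  {w | (A = 0 ∧ w ∈ Language.map Fin.val (P.untimedLanguage ℓ r)) ∨
    (A ≠ 0 ∧ ∃ (k k' : Fin l) (w' : List (Fin s)), k.val = srcLoc A ∧ k'.val = tgtLoc A ∧
      P.CodeGen k (srcTup A) w' k' (tgtTup A) ∧ w'.map Fin.val = w)}

theorem TPDA.mem_sem {ℓ r : Fin l} {A : ℕ} (hA : A ≠ 0) {w : List ℕ} :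
    w ∈ P.sem ℓ r A ↔ ∃ (k k' : Fin l) (w' : List (Fin s)), k.val = srcLoc A ∧
      k'.val = tgtLoc A ∧ P.CodeGen k (srcTup A) w' k' (tgtTup A) ∧ w'.map Fin.val = w := by
  change (_ ∨ _) ↔ _
  simp [hA]

theorem TPDA.mem_sem_zero {ℓ r : Fin l} {w : List ℕ} :
    w ∈ P.sem ℓ r 0 ↔ w ∈ Language.map Fin.val (P.untimedLanguage ℓ r) := by
  change (_ ∨ _) ↔ _
  simp

/-- Apart from the rules of the initial nonterminal, each case of `RuleOk` is an instance of a
constructor of `TPDA.Gen`. -/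
theorem TPDA.sem_rule {ℓ r : Fin l} {k A B C : ℕ} (h : P.code.RuleOk ℓ r k A B C) :
    formLanguage (P.sem ℓ r) ((TPDACode.rhs k B C).map
      (Sum.elim Symbol.terminal Symbol.nonterminal)) ≤ P.sem ℓ r A := by
  have hN := P.code.den_pos
  have hD := P.code.base_pos
  rcases h with ⟨rfl, hA, hv, h⟩ | ⟨rfl, hA, hv, hs, ρ, hρ, rfl⟩ |
    ⟨rfl, rfl, hB, h1, h2, h3, h4⟩ | ⟨rfl, hA, hB, h1, h2, he⟩ |
    ⟨rfl, hA, hB, h1, h2, ρ, hρ, h3, h4, ρ', hρ', h5, h6, a, ha, b, hb, hab, F, hF, hFP, hψ, hψ'⟩ |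
    ⟨hk, hA, hB, hC, h1, h2, h3, h4, h5, h6⟩
  · have e : formLanguage (P.sem ℓ r) ((TPDACode.rhs 0 B C).map
        (Sum.elim Symbol.terminal Symbol.nonterminal)) = 1 := rfl
    rw [e]
    intro w hw
    obtain rfl : w = [] := hw
    refine (TPDA.mem_sem hA).2 ?_
    rcases h with ⟨h1, h2, h3⟩ | ⟨ρ, hρ, h1, h2, h3⟩
    · exact ⟨⟨_, h2⟩, ⟨_, h2⟩, [], rfl, h1, .nil ((validN_iff hN).1 hv) (sameN_iff.1 h3), rfl⟩
    · obtain ⟨⟨k, op, k'⟩, hσ, rfl⟩ := TPDA.mem_code.1 hρ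
      exact ⟨k, k', [], h1, h2, .step hσ ((validN_iff hN).1 hv) ((Op.epsN_iff hN op).1 h3), rfl⟩
  · have e : formLanguage (P.sem ℓ r) ((TPDACode.rhs 1 B C).map
        (Sum.elim Symbol.terminal Symbol.nonterminal)) = {[B]} := by
      simp [formLanguage, TPDACode.rhs]
    rw [e]
    intro w hw
    obtain rfl : w = [B] := hw
    refine (TPDA.mem_sem hA).2 ?_
    obtain ⟨⟨k, op, k'⟩, hσ, h⟩ := TPDA.mem_code.1 hρ
    simp only [Prod.mk.injEq] at h
    obtain ⟨h1, h2, h3⟩ := h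
    cases op <;> simp only [Op.map, reduceCtorEq, Op.input.injEq, Option.map_eq_some_iff] at h2
    obtain ⟨a, rfl, rfl⟩ := h2
    exact ⟨k, k', [a], h1, h3, .step hσ ((validN_iff hN).1 hv)
      ⟨rfl, fun i => (scale_eq_scale hN).2 (sameN_iff.1 hs i)⟩, rfl⟩
  · have e : formLanguage (P.sem ℓ r) ((TPDACode.rhs 2 B C).map
        (Sum.elim Symbol.terminal Symbol.nonterminal)) = P.sem ℓ r B := by
      simp [formLanguage, TPDACode.rhs]
    rw [e]
    intro w hw
    obtain ⟨k, k', w', e1, e2, hG, rfl⟩ := (TPDA.mem_sem hB).1 hw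
    obtain rfl : k = ℓ := Fin.ext (e1.trans h1)
    obtain rfl : k' = r := Fin.ext (e2.trans h2)
    exact TPDA.mem_sem_zero.2 ⟨w', TPDA.mem_untimedLanguage_of_codeGen h3 h4 hG, rfl⟩
  · have e : formLanguage (P.sem ℓ r) ((TPDACode.rhs 2 B C).map
        (Sum.elim Symbol.terminal Symbol.nonterminal)) = P.sem ℓ r B := by
      simp [formLanguage, TPDACode.rhs]
    rw [e]
    intro w hw
    obtain ⟨k, k', w', e1, e2, hG, rfl⟩ := (TPDA.mem_sem hB).1 hw
    refine (TPDA.mem_sem hA).2 ?_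
    -- Digits are below the base for every number, so even nonterminals with oversized codes stand
    -- for bounded tuples.
    exact ⟨k, k', w', e1.trans h1, e2.trans h2, .equi (fun i => dig_lt hD _ _)
      (fun i => dig_lt hD _ _) ((equiN_iff hN).1 he) hG, rfl⟩
  · have e : formLanguage (P.sem ℓ r) ((TPDACode.rhs 2 B C).map
        (Sum.elim Symbol.terminal Symbol.nonterminal)) = P.sem ℓ r B := by
      simp [formLanguage, TPDACode.rhs]
    rw [e]
    intro w hw
    obtain ⟨k, k', w', e1, e2, hG, rfl⟩ := (TPDA.mem_sem hB).1 hw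
    refine (TPDA.mem_sem hA).2 ?_
    obtain ⟨⟨i, op, j⟩, hσ, rfl⟩ := TPDA.mem_code.1 hρ
    obtain ⟨⟨i', op', j'⟩, hσ', rfl⟩ := TPDA.mem_code.1 hρ'
    cases op <;> simp only [Op.map, Op.pushes, List.not_mem_nil, List.mem_singleton] at ha
    rename_i γ ψ
    cases op' <;> simp only [Op.map, Op.pops, List.not_mem_nil, List.mem_singleton] at hb
    rename_i γ' ψ'
    subst ha hb
    obtain rfl : γ = γ' := Fin.ext hab
    obtain rfl : j = k := Fin.ext (h4.trans e1.symm)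
    obtain rfl : i' = k' := Fin.ext (h5.trans e2.symm)
    rw [h1, h2] at hG
    refine ⟨i, j', w', h3, h6, .pushPop hσ hσ' (frm P.code.base z F) (fun i => dig_lt hD _ _)
      (fun i => (scale_le_scale hN).2 (hFP i i.2)) ?_ ?_ hG, rfl⟩
    · exact (holds_frame_iff hN ψ).1 hψ
    · exact (holds_frame_iff hN ψ').1 hψ'
  · have e : formLanguage (P.sem ℓ r) ((TPDACode.rhs k B C).map
        (Sum.elim Symbol.terminal Symbol.nonterminal)) = P.sem ℓ r B * P.sem ℓ r C := by
      rw [TPDACode.rhs, if_neg (by omega), if_neg (by omega), if_neg (by omega)]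
      simp [formLanguage]
    rw [e]
    intro w hw
    obtain ⟨w₁, hw₁, w₂, hw₂, rfl⟩ := Language.mem_mul.1 hw
    obtain ⟨k₁, k₂, w₁, e1, e2, hG, rfl⟩ := (TPDA.mem_sem hB).1 hw₁
    obtain ⟨k₃, k₄, w₂, e3, e4, hG', rfl⟩ := (TPDA.mem_sem hC).1 hw₂
    obtain rfl : k₃ = k₂ := Fin.ext (e3.trans (h3.trans e2.symm))
    refine (TPDA.mem_sem hA).2 ?_
    rw [h2] at hG
    rw [h4, h6] at hG'
    exact ⟨k₁, k₄, w₁ ++ w₂, e1.trans h1, e4.trans h5, .trans (fun i => dig_lt hD _ _) hG hG',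
      List.map_append⟩

/-- The bounds on guessed tuples in `TPDA.Gen` provide codes for them that are small enough for
their nonterminals to be within `bound`. -/
theorem TPDA.Gen.yields {ℓ₀ r₀ : ℕ} {ℓ r : Fin l} {w : List (Fin s)} {p q : Option (Fin x) → ℕ}
    (h : P.Gen P.code.den P.code.thr P.code.modulus P.code.base ℓ p w r q) {A B : ℕ}
    (hA : A < P.code.base ^ (x + 1)) (hB : B < P.code.base ^ (x + 1))
    (hp : tup P.code.base x A = p) (hq : tup P.code.base x B = q) :
    (P.code.toGrammar ℓ₀ r₀).Yields (nt ℓ A r B) (w.map Fin.val) := by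
  have hN := P.code.den_pos
  have hD := P.code.base_pos
  have hloc : ∀ k : Fin l, k.val < P.code.locs := fun k => k.2
  induction h generalizing A B with
  | @nil ℓ p q hv h =>
    subst hp hq
    refine .nil (TPDACode.RuleOk.mem (k := 0) (B := 0) (C := 0)
      (.inl ⟨rfl, nt_ne_zero _ _ _ _, ?_, ?_⟩)
      (by omega) (TPDACode.nt_le_bound (hloc _) hA (hloc _) hB) (by omega) (by omega))
    · simp only [srcTup_nt, tgtTup_nt]; exact (validN_iff hN).2 hv
    · left
      simp only [srcTup_nt, tgtTup_nt, srcLoc_nt, tgtLoc_nt]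
      exact ⟨trivial, hloc _, sameN_iff.2 h⟩
  | @step ℓ r op w p q h hv hb =>
    subst hp hq
    have hmem : (ℓ.val, op.map Fin.val Fin.val Fin.val Fin.val, r.val) ∈ P.code.2 :=
      TPDA.mem_code.2 ⟨_, h, rfl⟩
    rcases hb.word with rfl | ⟨a, rfl, rfl⟩
    · refine .nil (TPDACode.RuleOk.mem (k := 0) (B := 0) (C := 0)
        (.inl ⟨rfl, nt_ne_zero _ _ _ _, ?_, ?_⟩)
        (by omega) (TPDACode.nt_le_bound (hloc _) hA (hloc _) hB) (by omega) (by omega))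
      · simp only [srcTup_nt, tgtTup_nt]; exact (validN_iff hN).2 hv
      · right
        simp only [srcTup_nt, tgtTup_nt, srcLoc_nt, tgtLoc_nt]
        exact ⟨_, hmem, rfl, rfl, (Op.epsN_iff hN op).2 hb⟩
    · refine .letter (TPDACode.RuleOk.mem (k := 1) (B := a.val) (C := 0)
        (.inr (.inl ⟨rfl, nt_ne_zero _ _ _ _, ?_, ?_, ?_⟩))
        (by omega) (TPDACode.nt_le_bound (hloc _) hA (hloc _) hB)
        (TPDACode.letter_le_bound a.2) (by omega))
      · simp only [srcTup_nt, tgtTup_nt]; exact (validN_iff hN).2 hv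
      · simp only [srcTup_nt, tgtTup_nt]
        exact sameN_iff.2 fun i => (scale_eq_scale hN).1 (hb.2 i)
      · simp only [srcLoc_nt, tgtLoc_nt]
        exact ⟨_, hmem, rfl⟩
  | @pushPop ℓ ℓ' r' r γ ψ ψ' w p q h h' ζ hζD hζ hψ hψ' hs ih =>
    subst hp hq
    obtain ⟨F, hF, rfl⟩ := exists_frm ζ hζD
    refine .unit (TPDACode.RuleOk.mem (k := 2) (B := nt ℓ' A r' B) (C := 0)
      (.inr (.inr (.inr (.inr (.inl ⟨rfl, nt_ne_zero _ _ _ _, nt_ne_zero _ _ _ _, ?_, ?_, ?_⟩)))))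
      (by omega) (TPDACode.nt_le_bound (hloc _) hA (hloc _) hB)
      (TPDACode.nt_le_bound (hloc _) hA (hloc _) hB) (by omega)) (ih hA hB rfl rfl)
    · simp only [srcTup_nt]
    · simp only [tgtTup_nt]
    · simp only [srcTup_nt, tgtTup_nt, srcLoc_nt, tgtLoc_nt]
      refine ⟨_, TPDA.mem_code.2 ⟨_, h, rfl⟩, rfl, rfl, _, TPDA.mem_code.2 ⟨_, h', rfl⟩, rfl, rfl,
        _, List.mem_singleton_self _, _, List.mem_singleton_self _, rfl, F, hF, fun i hi => ?_,
        ?_, ?_⟩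
      · exact (scale_le_scale hN).1 (hζ ⟨i, hi⟩)
      · exact (holds_frame_iff hN ψ).2 hψ
      · exact (holds_frame_iff hN ψ').2 hψ'
  | @trans ℓ k r w w' p s q hs h h' ih ih' =>
    subst hp hq
    obtain ⟨C, hC, rfl⟩ := exists_tup s hs
    rw [List.map_append]
    refine .binary (TPDACode.RuleOk.mem (k := 3) (B := nt ℓ A k C) (C := nt k C r B)
      (.inr (.inr (.inr (.inr (.inr ⟨le_rfl, nt_ne_zero _ _ _ _,
        nt_ne_zero _ _ _ _, nt_ne_zero _ _ _ _,
        ?_⟩)))))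
      (by omega) (TPDACode.nt_le_bound (hloc _) hA (hloc _) hB)
      (TPDACode.nt_le_bound (hloc _) hA (hloc _) hC)
      (TPDACode.nt_le_bound (hloc _) hC (hloc _) hB)) (ih hA hC rfl rfl) (ih' hC hB rfl rfl)
    simp
  | @equi ℓ r w p q p' q' hp' hq' he h ih =>
    subst hp hq
    obtain ⟨A', hA', rfl⟩ := exists_tup p' hp'
    obtain ⟨B', hB', rfl⟩ := exists_tup q' hq'
    refine .unit (TPDACode.RuleOk.mem (k := 2) (B := nt ℓ A' r B') (C := 0)
      (.inr (.inr (.inr (.inl ⟨rfl, nt_ne_zero _ _ _ _, nt_ne_zero _ _ _ _, ?_, ?_, ?_⟩))))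
      (by omega) (TPDACode.nt_le_bound (hloc _) hA (hloc _) hB)
      (TPDACode.nt_le_bound (hloc _) hA' (hloc _) hB') (by omega)) (ih hA' hB' rfl rfl)
    · simp only [srcLoc_nt]
    · simp only [tgtLoc_nt]
    · simp only [srcTup_nt, tgtTup_nt]
      exact (equiN_iff hN).2 he

theorem TPDA.language_toGrammar (P : TPDA (Fin s) (Fin g) (Fin l) (Fin x) (Fin z)) (ℓ r : Fin l) :
    (P.code.toGrammar ℓ r).grammar.language = Language.map Fin.val (P.untimedLanguage ℓ r) := by
  apply le_antisymm
  · intro w hw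
    refine TPDA.mem_sem_zero.1 (language_le_of_rules _ (P.sem ℓ r) (fun ρ hρ => ?_) hw)
    obtain ⟨⟨A, u⟩, hσ, rfl⟩ := GrammarCode.mem_rules.1 hρ
    obtain ⟨k, B, C, h, rfl⟩ := TPDACode.mem_toGrammar hσ
    exact TPDA.sem_rule h
  · rintro _ ⟨w, hw, rfl⟩
    have hloc : ∀ k : Fin l, k.val < P.code.locs := fun k => k.2
    obtain ⟨p, q, hp, hq, hp', hq', h⟩ := TPDA.mem_untimedLanguage_iff_code.1 hw
    obtain ⟨A, hA, rfl⟩ := exists_tup p hp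
    obtain ⟨B, hB, rfl⟩ := exists_tup q hq
    refine GrammarCode.Yields.unit (A := 0) (B := nt ℓ A r B) (TPDACode.RuleOk.mem (k := 2) (C := 0)
      (.inr (.inr (.inl ⟨rfl, rfl, nt_ne_zero _ _ _ _, ?_, ?_, ?_, ?_⟩)))
      (by omega) (by omega)
      (TPDACode.nt_le_bound (hloc _) hA (hloc _) hB) (by omega)) (h.yields hA hB rfl rfl)
    · simp only [srcLoc_nt]
    · simp only [tgtLoc_nt]
    · simp only [srcTup_nt]; exact constN_iff.2 hp'
    · simp only [tgtTup_nt]; exact constN_iff.2 hq'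

end Correctness

/-! ### Primitive recursive predicates -/

section Primrec

variable {α β γ : Type*} [Primcodable α] [Primcodable β] [Primcodable γ]

theorem primrecPred_exists_mem {L : α → List β} {p : α → β → Prop} (hL : Primrec L)
    (hp : PrimrecPred fun a : α × β => p a.1 a.2) : PrimrecPred fun a => ∃ b ∈ L a, p a b := by
  have : PrimrecRel fun (b : β) (a : α) => p a b := hp.comp (Primrec.pair Primrec.snd Primrec.fst)
  exact this.exists_mem_list.comp hL Primrec.id

theorem primrecPred_exists_lt {f : α → ℕ} {p : α → ℕ → Prop} (hf : Primrec f)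
    (hp : PrimrecPred fun a : α × ℕ => p a.1 a.2) : PrimrecPred fun a => ∃ i < f a, p a i :=
  (primrecPred_exists_mem (Primrec.list_range.comp hf) hp).of_eq fun a => by simp

theorem primrecPred_forall_lt {f : α → ℕ} {p : α → ℕ → Prop} (hf : Primrec f)
    (hp : PrimrecPred fun a : α × ℕ => p a.1 a.2) : PrimrecPred fun a => ∀ i < f a, p a i :=
  (primrecPred_exists_lt (p := fun a i => ¬ p a i) hf hp.not).not.of_eq fun a => by simp

theorem primrecPred_iff {p q : α → Prop} (hp : PrimrecPred p) (hq : PrimrecPred q) :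
    PrimrecPred fun a => p a ↔ q a :=
  ((hp.and hq).or (hp.not.and hq.not)).of_eq fun a => by tauto

theorem primrecPred_sum {f : α → β ⊕ γ} {p : α → β → Prop} {q : α → γ → Prop} (hf : Primrec f)
    (hp : PrimrecPred fun a : α × β => p a.1 a.2) (hq : PrimrecPred fun a : α × γ => q a.1 a.2) :
    PrimrecPred fun a => Sum.elim (p a) (q a) (f a) := by
  classical
  have := Primrec.sumCasesOn hf hp.decide.to₂ hq.decide.to₂
  refine (Primrec.eq.comp this (Primrec.const true)).of_eq fun a => ?_
  cases f a <;> simp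

theorem primrec_pow : Primrec₂ ((· ^ ·) : ℕ → ℕ → ℕ) := Primrec₂.unpaired'.1 Nat.Primrec.pow

theorem primrec_factorial : Primrec Nat.factorial := by
  have : Primrec₂ fun (n r : ℕ) => (n + 1) * r :=
    Primrec.nat_mul.comp (Primrec.succ.comp Primrec.fst) Primrec.snd
  refine (Primrec.nat_rec₁ 1 this).of_eq fun n => ?_
  induction n with
  | zero => rfl
  | succ n ih => rw [Nat.factorial_succ, ← ih]

theorem primrec_int_toNat : Primrec Int.toNat := by
  have h : PrimrecPred fun k : ℤ => encode k % 2 = 0 :=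
    Primrec.eq.comp (Primrec.nat_mod.comp Primrec.encode (Primrec.const 2)) (Primrec.const 0)
  refine (Primrec.ite h (Primrec.nat_div.comp Primrec.encode (Primrec.const 2))
    (Primrec.const 0)).of_eq fun k => ?_
  cases k with
  | ofNat n =>
    have e : encode (Int.ofNat n) = 2 * n := rfl
    rw [e, if_pos (by omega)]
    simp
  | negSucc n =>
    have e : encode (Int.negSucc n) = 2 * n + 1 := rfl
    rw [e, if_neg (by omega)]
    rfl

theorem primrec_int_neg_toNat : Primrec fun k : ℤ => (-k).toNat := by
  have h : PrimrecPred fun k : ℤ => encode k % 2 = 0 :=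
    Primrec.eq.comp (Primrec.nat_mod.comp Primrec.encode (Primrec.const 2)) (Primrec.const 0)
  refine (Primrec.ite h (Primrec.const 0) (Primrec.succ.comp
    (Primrec.nat_div.comp Primrec.encode (Primrec.const 2)))).of_eq fun k => ?_
  cases k with
  | ofNat n =>
    have e : encode (Int.ofNat n) = 2 * n := rfl
    rw [e, if_pos (by omega)]
    simp
  | negSucc n =>
    have e : encode (Int.negSucc n) = 2 * n + 1 := rfl
    rw [e, if_neg (by omega)]
    simp only [Int.neg_negSucc]
    omega

theorem primrec_pnat_val : Primrec (PNat.val : ℕ+ → ℕ) :=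
  (Primrec.succ.comp (Primrec.encode (α := ℕ+))).of_eq fun m => PNat.natPred_add_one m

/-- With `k` split into positive and negative part, terms are moved across until only natural
numbers are compared. -/
theorem primrecPred_sub_le {f g : α → ℕ} {k : α → ℤ} (hf : Primrec f) (hg : Primrec g)
    (hk : Primrec k) : PrimrecPred fun a => (f a : ℤ) - g a ≤ k a :=
  (Primrec.nat_le.comp (Primrec.nat_add.comp hf (primrec_int_neg_toNat.comp hk))
    (Primrec.nat_add.comp hg (primrec_int_toNat.comp hk))).of_eq fun a => by omega

theorem primrecPred_sub_modEq {f g m : α → ℕ} {k : α → ℤ} (hf : Primrec f) (hg : Primrec g)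
    (hm : Primrec m) (hk : Primrec k) :
    PrimrecPred fun a => (f a : ℤ) - g a ≡ k a [ZMOD (m a : ℤ)] := by
  refine (Primrec.eq.comp
    (Primrec.nat_mod.comp (Primrec.nat_add.comp hf (primrec_int_neg_toNat.comp hk)) hm)
    (Primrec.nat_mod.comp (Primrec.nat_add.comp hg (primrec_int_toNat.comp hk)) hm)).of_eq
    fun a => ?_
  change (_ ≡ _ [MOD m a]) ↔ _
  rw [← Int.natCast_modEq_iff]
  have h1 : ((f a + (-k a).toNat : ℕ) : ℤ) = (f a - g a) + (g a + (-k a).toNat) := by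
    push_cast; ring
  have h2 : ((g a + (k a).toNat : ℕ) : ℤ) = k a + (g a + (-k a).toNat) := by
    push_cast; omega
  rw [h1, h2]
  exact ⟨fun h => h.add_right_cancel' _, fun h => h.add_right _⟩

end Primrec

/-! ### Evaluation of constraints. -/

section Constraints

/-- `Atom.Holds` in integer arithmetic. -/
def Atom.HoldsN {V : Type*} (N : ℕ) (c : V → ℕ) (a : Atom V) : Prop :=
  -- Subtracting `0` gives atoms in one clock the shape of those in two, so the same lemmas decide
  -- both.
  Sum.elim (fun p : V × ℤ => ((c p.1 / N : ℕ) : ℤ) - (0 : ℕ) ≤ p.2)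
    (Sum.elim (fun p : V × ℕ+ × ℤ => ((c p.1 / N : ℕ) : ℤ) - (0 : ℕ) ≡ p.2.2 [ZMOD (p.2.1.val : ℤ)])
    (Sum.elim (fun x : V => c x % N = 0)
    (Sum.elim (fun p : V × V × ℤ => ((c p.1 / N : ℕ) : ℤ) - (c p.2.1 / N : ℕ) ≤ p.2.2)
    (Sum.elim (fun p : V × V × ℕ+ × ℤ =>
      ((c p.1 / N : ℕ) : ℤ) - (c p.2.1 / N : ℕ) ≡ p.2.2.2 [ZMOD (p.2.2.1.val : ℤ)])
    (fun p : V × V => c p.1 % N ≤ c p.2 % N))))) (Atom.equivSum V a)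

theorem Atom.holdsN_iff {V : Type*} {N : ℕ} (hN : 0 < N) (c : V → ℕ) (a : Atom V) :
    a.HoldsN N c ↔ a.Holds fun v => (c v : NNRat) / N := by
  have hNQ : (0 : ℚ) < N := by exact_mod_cast hN
  have hcast : ∀ v, (((c v : NNRat) / N : NNRat) : ℚ) = (c v : ℚ) / N := fun v => by push_cast; rfl
  cases a <;>
    simp only [Atom.HoldsN, Atom.equivSum, Equiv.coe_fn_mk, Sum.elim_inl, Sum.elim_inr,
      Atom.Holds, hcast, floor_natCast_div, fract_natCast_div hN, Nat.cast_zero, sub_zero,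
      div_eq_zero_iff, hNQ.ne', or_false, Nat.cast_eq_zero, div_le_div_iff_of_pos_right hNQ,
      Nat.cast_le]

variable {V : Type*} [Denumerable V] {α : Type*} [Primcodable α]

theorem primrec_atom_equivSum : Primrec (Atom.equivSum V) :=
  Primrec.encode_iff.1 (Primrec.encode (α := Atom V))

theorem primrecPred_atom_holdsN {a : α → Atom V} {c : α → V → ℕ} {N : α → ℕ} (ha : Primrec a)
    (hc : Primrec₂ c) (hN : Primrec N) : PrimrecPred fun y => (a y).HoldsN (N y) (c y) := by
  have hq : Primrec₂ fun y v => c y v / N y := Primrec.nat_div.comp hc (hN.comp Primrec.fst)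
  have hr : Primrec₂ fun y v => c y v % N y := Primrec.nat_mod.comp hc (hN.comp Primrec.fst)
  unfold Atom.HoldsN
  refine primrecPred_sum (primrec_atom_equivSum.comp ha) ?_ (primrecPred_sum Primrec.snd ?_
    (primrecPred_sum Primrec.snd ?_ (primrecPred_sum Primrec.snd ?_
    (primrecPred_sum Primrec.snd ?_ ?_))))
  · exact primrecPred_sub_le (hq.comp Primrec.fst (Primrec.fst.comp Primrec.snd))
      (Primrec.const 0) (Primrec.snd.comp Primrec.snd)
  · exact primrecPred_sub_modEq
      (hq.comp (Primrec.fst.comp Primrec.fst) (Primrec.fst.comp Primrec.snd)) (Primrec.const 0)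
      (primrec_pnat_val.comp (Primrec.fst.comp (Primrec.snd.comp Primrec.snd)))
      (Primrec.snd.comp (Primrec.snd.comp Primrec.snd))
  · exact Primrec.eq.comp (hr.comp (Primrec.fst.comp (Primrec.fst.comp Primrec.fst)) Primrec.snd)
      (Primrec.const 0)
  · exact primrecPred_sub_le
      (hq.comp (Primrec.fst.comp (Primrec.fst.comp (Primrec.fst.comp Primrec.fst)))
        (Primrec.fst.comp Primrec.snd))
      (hq.comp (Primrec.fst.comp (Primrec.fst.comp (Primrec.fst.comp Primrec.fst)))
        (Primrec.fst.comp (Primrec.snd.comp Primrec.snd)))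
      (Primrec.snd.comp (Primrec.snd.comp Primrec.snd))
  · exact primrecPred_sub_modEq (hq.comp (Primrec.fst.comp (Primrec.fst.comp (Primrec.fst.comp
        (Primrec.fst.comp Primrec.fst))))
        (Primrec.fst.comp Primrec.snd))
      (hq.comp (Primrec.fst.comp (Primrec.fst.comp (Primrec.fst.comp
        (Primrec.fst.comp Primrec.fst))))
        (Primrec.fst.comp (Primrec.snd.comp Primrec.snd)))
      (primrec_pnat_val.comp
        (Primrec.fst.comp (Primrec.snd.comp (Primrec.snd.comp Primrec.snd))))
      (Primrec.snd.comp (Primrec.snd.comp (Primrec.snd.comp Primrec.snd)))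
  · exact Primrec.nat_le.comp (hr.comp (Primrec.fst.comp (Primrec.fst.comp (Primrec.fst.comp
        (Primrec.fst.comp Primrec.fst))))
        (Primrec.fst.comp Primrec.snd))
      (hr.comp (Primrec.fst.comp (Primrec.fst.comp (Primrec.fst.comp
        (Primrec.fst.comp Primrec.fst))))
        (Primrec.snd.comp Primrec.snd))

theorem primrec_constraint_toNat : Primrec (Constraint.toNat : Constraint V → ℕ) :=
  Primrec.encode (α := Constraint V)

/-- Course-of-values recursion on Gödel numbers: immediate subconstraints have smaller numbers, so
their truth values are found among the earlier ones. -/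
theorem primrecPred_holds {φ : α → Constraint V} {c : α → V → ℕ} {N : α → ℕ} (hφ : Primrec φ)
    (hc : Primrec₂ c) (hN : Primrec N) (hN0 : ∀ y, 0 < N y) :
    PrimrecPred fun y => (φ y).Holds fun v => (c y v : NNRat) / N y := by
  classical
  let f : α → ℕ → Bool := fun y n =>
    decide ((Constraint.ofNat V n).Holds fun v => (c y v : NNRat) / N y)
  -- The list holds the truth values at all smaller numbers, so its length is the number being
  -- evaluated. The default `false` is never reached on such lists.
  let g : α → List Bool → Bool := fun y l =>
    if l.length = 0 then true
    else if (l.length - 1) % 4 = 0 then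
      decide ((Denumerable.ofNat (Atom V) ((l.length - 1) / 4)).HoldsN (N y) (c y))
    else if (l.length - 1) % 4 = 1 then !(l.getD ((l.length - 1) / 4) false)
    else if (l.length - 1) % 4 = 2 then
      l.getD ((l.length - 1) / 4).unpair.1 false && l.getD ((l.length - 1) / 4).unpair.2 false
    else l.getD ((l.length - 1) / 4).unpair.1 false || l.getD ((l.length - 1) / 4).unpair.2 false
  have hlen : Primrec fun p : α × List Bool => p.2.length - 1 :=
    Primrec.nat_sub.comp (Primrec.list_length.comp Primrec.snd) (Primrec.const 1)
  have hdiv : Primrec fun p : α × List Bool => (p.2.length - 1) / 4 :=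
    Primrec.nat_div.comp hlen (Primrec.const 4)
  have hmod : ∀ i, PrimrecPred fun p : α × List Bool => (p.2.length - 1) % 4 = i := fun i =>
    Primrec.eq.comp (Primrec.nat_mod.comp hlen (Primrec.const 4)) (Primrec.const i)
  have hget : ∀ {h : α × List Bool → ℕ}, Primrec h →
      Primrec fun p : α × List Bool => p.2.getD (h p) false := fun hh =>
    (Primrec.list_getD false).comp Primrec.snd hh
  have hl := Primrec.fst.comp (Primrec.unpair.comp hdiv)
  have hr := Primrec.snd.comp (Primrec.unpair.comp hdiv)
  have hg : Primrec₂ g := by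
    refine Primrec.ite (Primrec.eq.comp (Primrec.list_length.comp Primrec.snd) (Primrec.const 0))
      (Primrec.const true) (Primrec.ite (hmod 0) ?_ (Primrec.ite (hmod 1)
      (Primrec.not.comp (hget hdiv)) (Primrec.ite (hmod 2) (Primrec.and.comp (hget hl) (hget hr))
      (Primrec.or.comp (hget hl) (hget hr)))))
    exact PrimrecPred.decide (primrecPred_atom_holdsN ((Primrec.ofNat (Atom V)).comp hdiv)
      (hc.comp (Primrec.fst.comp Primrec.fst) Primrec.snd) (hN.comp Primrec.fst))
  have hf : Primrec₂ f := by
    refine Primrec.nat_strong_rec f (g := fun y l => some (g y l))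
      (Primrec.option_some.comp hg) fun y n => ?_
    have hgetD : ∀ m < n, ((List.range n).map (f y)).getD m false = f y m := by
      intro m hm
      simp [List.getD, hm]
    rcases n with _ | n
    · simp [f, g, Constraint.ofNat, Constraint.Holds]
    · have h : n / 4 < n + 1 := by omega
      have h₁ : (n / 4).unpair.1 < n + 1 := lt_of_le_of_lt (Nat.unpair_left_le _) h
      have h₂ : (n / 4).unpair.2 < n + 1 := lt_of_le_of_lt (Nat.unpair_right_le _) h
      have hm : n % 4 = 0 ∨ n % 4 = 1 ∨ n % 4 = 2 ∨ n % 4 = 3 := by omega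
      simp only [g, List.length_map, List.length_range, Nat.add_sub_cancel, Nat.succ_ne_zero,
        if_false, hgetD _ h, hgetD _ h₁, hgetD _ h₂]
      rcases hm with hm | hm | hm | hm <;>
        simp [hm, f, Constraint.ofNat, Constraint.Holds, Atom.holdsN_iff (hN0 y)]
  refine (Primrec.eq.comp (hf.comp Primrec.id (primrec_constraint_toNat.comp hφ))
    (Primrec.const true)).of_eq fun y => ?_
  simp only [f, id, decide_eq_true_eq, Constraint.ofNat_toNat]

end Constraints

/-! ### The grammar is a primitive recursive function of the automaton -/

section Operations

variable {α : Type*} [Primcodable α] {op : α → OpCode}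

theorem primrec_op_equivSum : Primrec (Op.equivSum ℕ ℕ ℕ ℕ) := Primrec.of_equiv

theorem primrec_op_input {a : α → Option ℕ} (ha : Primrec a) :
    Primrec fun y => (Op.input (a y) : OpCode) :=
  (Primrec.of_equiv_symm (e := Op.equivSum ℕ ℕ ℕ ℕ)).comp
    (Primrec.sumInr.comp (Primrec.sumInl.comp ha))

theorem primrec_op_tests (h : Primrec op) : Primrec fun y => (op y).tests := by
  refine (Primrec.sumCasesOn (primrec_op_equivSum.comp h) (g := fun _ _ => [])
    (h := fun _ b => Sum.elim (fun _ => []) (Sum.elim (fun φ => [φ]) fun _ => []) b)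
    (Primrec.const []).to₂ ?_).of_eq fun y => ?_
  · refine (Primrec.sumCasesOn Primrec.snd (g := fun _ _ => [])
      (h := fun _ b => Sum.elim (fun φ => [φ]) (fun _ => []) b) (Primrec.const []).to₂ ?_).of_eq
      fun y => by rcases y.2 with a | a <;> rfl
    exact (Primrec.sumCasesOn Primrec.snd (g := fun _ φ => [φ]) (h := fun _ _ => [])
      (Primrec.list_cons.comp Primrec.snd (Primrec.const [])) (Primrec.const []).to₂).of_eq
      fun y => by rcases y.2 with a | a <;> rfl
  · cases op y <;> rfl

theorem primrec_op_resets (h : Primrec op) : Primrec fun y => (op y).resets := by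
  refine (Primrec.sumCasesOn (primrec_op_equivSum.comp h) (g := fun _ _ => [])
    (h := fun _ b => Sum.elim (fun _ => []) (Sum.elim (fun _ => [])
      (Sum.elim (fun Y => [Y]) fun _ => [])) b)
    (Primrec.const []).to₂ ?_).of_eq fun y => ?_
  · refine (Primrec.sumCasesOn Primrec.snd (g := fun _ _ => [])
      (h := fun _ b => Sum.elim (fun _ => []) (Sum.elim (fun Y => [Y]) fun _ => []) b)
      (Primrec.const []).to₂ ?_).of_eq fun y => by rcases y.2 with a | a <;> rfl
    refine (Primrec.sumCasesOn Primrec.snd (g := fun _ _ => [])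
      (h := fun _ b => Sum.elim (fun Y => [Y]) (fun _ => []) b)
      (Primrec.const []).to₂ ?_).of_eq fun y => by rcases y.2 with a | a <;> rfl
    exact (Primrec.sumCasesOn Primrec.snd (g := fun _ φ => [φ]) (h := fun _ _ => [])
      (Primrec.list_cons.comp Primrec.snd (Primrec.const [])) (Primrec.const []).to₂).of_eq
      fun y => by rcases y.2 with a | a <;> rfl
  · cases op y <;> rfl

theorem primrec_op_pushes_pops (h : Primrec op) :
    (Primrec fun y => (op y).pushes) ∧ Primrec fun y => (op y).pops := by
  have key : ∀ {f g : ℕ × Constraint (ℕ ⊕ ℕ) → List (ℕ × Constraint (ℕ ⊕ ℕ))}, Primrec f →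
      Primrec g → Primrec fun y => Sum.elim (fun _ => []) (Sum.elim (fun _ => [])
        (Sum.elim (fun _ => []) (Sum.elim (fun _ => []) (Sum.elim f g))))
          (Op.equivSum ℕ ℕ ℕ ℕ (op y)) := by
    intro f g hf hg
    have step : ∀ {β γ : Type} [Primcodable β] [Primcodable γ]
        {k : γ → List (ℕ × Constraint (ℕ ⊕ ℕ))}, Primrec k →
        Primrec (Sum.elim (fun _ : β => []) k) := fun hk =>
      (Primrec.sumCasesOn Primrec.id (Primrec.const []).to₂ (hk.comp Primrec.snd).to₂).of_eq
        fun y => by rcases y with a | a <;> rfl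
    refine (step (step (step (step ?_)))).comp (primrec_op_equivSum.comp h)
    exact (Primrec.sumCasesOn Primrec.id (hf.comp Primrec.snd).to₂
      (hg.comp Primrec.snd).to₂).of_eq fun y => by rcases y with a | a <;> rfl
  have single : Primrec fun a : ℕ × Constraint (ℕ ⊕ ℕ) => [a] :=
    Primrec.list_cons.comp Primrec.id (Primrec.const [])
  exact ⟨(key single (Primrec.const [])).of_eq fun y => by cases op y <;> rfl,
    (key (Primrec.const []) single).of_eq fun y => by cases op y <;> rfl⟩

end Operations

/-! ### Primitive recursiveness of the predicates on codes. -/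

section Digits

variable {α : Type*} [Primcodable α] {K M N D x z P Q P' Q' i : α → ℕ}

theorem primrec_dig (hD : Primrec D) (hP : Primrec P) (hi : Primrec i) :
    Primrec fun y => dig (D y) (P y) (i y) :=
  Primrec.nat_mod.comp (Primrec.nat_div.comp hP (primrec_pow.comp hD hi)) hD

theorem primrec_valN (hD : Primrec D) (hx : Primrec x) (hP : Primrec P) (hQ : Primrec Q)
    (hi : Primrec i) : Primrec fun y => valN (D y) (x y) (P y) (Q y) (i y) :=
  Primrec.nat_sub.comp (primrec_dig hD hP hx) (primrec_dig hD hQ hi)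

theorem primrec_jdig (hD : Primrec D) (hx : Primrec x) (hP : Primrec P) (hQ : Primrec Q)
    (hi : Primrec i) : Primrec fun y => jdig (D y) (x y) (P y) (Q y) (i y) := by
  have hx1 := Primrec.succ.comp hx
  exact Primrec.ite (Primrec.nat_lt.comp hi hx1) (primrec_dig hD hP hi)
    (primrec_dig hD hQ (Primrec.nat_sub.comp hi hx1))

theorem primrecPred_sameN (hD : Primrec D) (hx : Primrec x) (hP : Primrec P) (hQ : Primrec Q) :
    PrimrecPred fun y => SameN (D y) (x y) (P y) (Q y) :=
  primrecPred_forall_lt hx (Primrec.eq.comp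
    (primrec_dig (hD.comp Primrec.fst) (hQ.comp Primrec.fst) Primrec.snd)
    (primrec_dig (hD.comp Primrec.fst) (hP.comp Primrec.fst) Primrec.snd))

theorem primrecPred_constN (hD : Primrec D) (hx : Primrec x) (hP : Primrec P) :
    PrimrecPred fun y => ConstN (D y) (x y) (P y) :=
  primrecPred_forall_lt (Primrec.succ.comp hx) (Primrec.eq.comp
    (primrec_dig (hD.comp Primrec.fst) (hP.comp Primrec.fst) Primrec.snd)
    ((primrec_dig hD hP hx).comp Primrec.fst))

theorem primrecPred_validN (hD : Primrec D) (hx : Primrec x) (hP : Primrec P) (hQ : Primrec Q) :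
    PrimrecPred fun y => ValidN (D y) (x y) (P y) (Q y) := by
  have h1 := primrec_dig (hD.comp Primrec.fst) (hP.comp Primrec.fst) Primrec.snd
  have h2 := primrec_dig (hD.comp Primrec.fst) (hQ.comp Primrec.fst) Primrec.snd
  have h3 := (primrec_dig hD hP hx).comp (Primrec.fst (β := ℕ))
  have h4 := (primrec_dig hD hQ hx).comp (Primrec.fst (β := ℕ))
  exact primrecPred_forall_lt (Primrec.succ.comp hx) ((Primrec.nat_le.comp h1 h3).and
    ((Primrec.nat_le.comp h2 h4).and ((Primrec.eq.comp h2 h1).or (Primrec.nat_le.comp h3 h2))))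

theorem primrecPred_intEq {a b c d : α → ℕ} (hK : Primrec K) (hM : Primrec M) (ha : Primrec a)
    (hb : Primrec b) (hc : Primrec c) (hd : Primrec d) :
    PrimrecPred fun y => IntEq (K y) (M y) ((a y : ℤ) - b y) ((c y : ℤ) - d y) := by
  have had := Primrec.nat_add.comp ha hd
  have hcb := Primrec.nat_add.comp hc hb
  have hlt : ∀ {f g : α → ℕ}, Primrec f → Primrec g → PrimrecPred fun y => f y + K y < g y :=
    fun hf hg => Primrec.nat_lt.comp (Primrec.nat_add.comp hf hK) hg
  refine ((Primrec.eq.comp (Primrec.nat_mod.comp had hM) (Primrec.nat_mod.comp hcb hM)).and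
    ((Primrec.eq.comp had hcb).or (((hlt hb ha).and (hlt hd hc)).or
      ((hlt ha hb).and (hlt hc hd))))).of_eq fun y => and_congr ?_ (by omega)
  change (_ ≡ _ [MOD M y]) ↔ _
  rw [← Int.natCast_modEq_iff]
  have h1 : ((a y + d y : ℕ) : ℤ) = (a y - b y) + (b y + d y) := by push_cast; ring
  have h2 : ((c y + b y : ℕ) : ℤ) = (c y - d y) + (b y + d y) := by push_cast; ring
  rw [h1, h2]
  exact ⟨fun h => h.add_right_cancel' _, fun h => h.add_right _⟩

theorem primrecPred_equiN (hK : Primrec K) (hM : Primrec M) (hN : Primrec N) (hD : Primrec D)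
    (hx : Primrec x) (hP : Primrec P) (hQ : Primrec Q) (hP' : Primrec P') (hQ' : Primrec Q') :
    PrimrecPred fun y => EquiN (K y) (M y) (N y) (D y) (x y) (P y) (Q y) (P' y) (Q' y) := by
  have hn : Primrec fun y => 2 * (x y + 1) :=
    Primrec.nat_mul.comp (Primrec.const 2) (Primrec.succ.comp hx)
  have h0 : Primrec fun y : (α × ℕ) × ℕ => y.1.1 := Primrec.fst.comp Primrec.fst
  have hi : Primrec fun y : (α × ℕ) × ℕ => y.1.2 := Primrec.snd.comp Primrec.fst
  have j1 := primrec_jdig (hD.comp h0) (hx.comp h0) (hP.comp h0) (hQ.comp h0) hi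
  have j2 := primrec_jdig (hD.comp h0) (hx.comp h0) (hP.comp h0) (hQ.comp h0) Primrec.snd
  have j3 := primrec_jdig (hD.comp h0) (hx.comp h0) (hP'.comp h0) (hQ'.comp h0) hi
  have j4 := primrec_jdig (hD.comp h0) (hx.comp h0) (hP'.comp h0) (hQ'.comp h0) Primrec.snd
  have hN' := hN.comp h0
  exact primrecPred_forall_lt hn (primrecPred_forall_lt (hn.comp Primrec.fst)
    ((primrecPred_intEq (hK.comp h0) (hM.comp h0) (Primrec.nat_div.comp j1 hN')
      (Primrec.nat_div.comp j2 hN') (Primrec.nat_div.comp j3 hN')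
      (Primrec.nat_div.comp j4 hN')).and
    ((primrecPred_iff
      (Primrec.nat_le.comp (Primrec.nat_mod.comp j1 hN') (Primrec.nat_mod.comp j2 hN'))
      (Primrec.nat_le.comp (Primrec.nat_mod.comp j3 hN') (Primrec.nat_mod.comp j4 hN'))).and
    (primrecPred_iff (Primrec.eq.comp (Primrec.nat_mod.comp j1 hN') (Primrec.const 0))
      (Primrec.eq.comp (Primrec.nat_mod.comp j3 hN') (Primrec.const 0))))))

theorem primrecPred_epsN {op : α → OpCode} (hN : Primrec N) (hN0 : ∀ y, 0 < N y) (hD : Primrec D)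
    (hx : Primrec x) (hop : Primrec op) (hP : Primrec P) (hQ : Primrec Q) :
    PrimrecPred fun y => EpsN (N y) (D y) (x y) (op y) (P y) (Q y) := by
  have hx1 := Primrec.succ.comp hx
  have hsame := primrecPred_sameN hD hx1 hP hQ
  have htest : PrimrecPred fun p : α × Constraint ℕ =>
      p.2.Holds fun i => (valN (D p.1) (x p.1) (P p.1) (P p.1) i : NNRat) / N p.1 := by
    have h0 : Primrec fun y : (α × Constraint ℕ) × ℕ => y.1.1 := Primrec.fst.comp Primrec.fst
    exact primrecPred_holds Primrec.snd
      (primrec_valN (hD.comp h0) (hx.comp h0) (hP.comp h0) (hP.comp h0) Primrec.snd).to₂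
      (hN.comp Primrec.fst) fun y => hN0 y.1
  refine ((Primrec.eq.comp hop (Primrec.const _)).and (primrecPred_sameN hD hx hP hQ)).or
    (((Primrec.eq.comp hop (Primrec.const _)).and hsame).or
    ((primrecPred_exists_mem (primrec_op_tests hop)
      ((hsame.comp Primrec.fst).and htest)).or
    (primrecPred_exists_mem (primrec_op_resets hop)
      ((Primrec.eq.comp ((primrec_dig hD hQ hx).comp Primrec.fst)
        ((primrec_dig hD hP hx).comp Primrec.fst)).and
      (primrecPred_forall_lt (hx.comp Primrec.fst) ?_)))))
  have h0 : Primrec fun y : (α × List ℕ) × ℕ => y.1.1 := Primrec.fst.comp Primrec.fst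
  have hmem : PrimrecPred fun y : (α × List ℕ) × ℕ => y.2 ∈ y.1.2 :=
    (primrecPred_exists_mem (p := fun (y : (α × List ℕ) × ℕ) i => i = y.2)
      (Primrec.snd.comp Primrec.fst)
      (Primrec.eq.comp Primrec.snd (Primrec.snd.comp Primrec.fst))).of_eq fun y => by simp
  have hQi := primrec_dig (hD.comp h0) (hQ.comp h0) Primrec.snd
  exact (hmem.and (Primrec.eq.comp hQi ((primrec_dig hD hP hx).comp h0))).or
    (hmem.not.and (Primrec.eq.comp hQi (primrec_dig (hD.comp h0) (hP.comp h0) Primrec.snd)))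

theorem primrecPred_frameN {ψ ψ' : α → Constraint (ℕ ⊕ ℕ)} (hN : Primrec N) (hN0 : ∀ y, 0 < N y)
    (hD : Primrec D) (hx : Primrec x) (hz : Primrec z) (hψ : Primrec ψ) (hψ' : Primrec ψ')
    (hP : Primrec P) (hQ : Primrec Q) :
    PrimrecPred fun y => FrameN (N y) (D y) (x y) (z y) (ψ y) (ψ' y) (P y) (Q y) := by
  have key : ∀ {R : α → ℕ}, Primrec R → Primrec₂ fun (y : α × ℕ) (i : ℕ ⊕ ℕ) =>
      (Sum.elim (valN (D y.1) (x y.1) (R y.1) (R y.1)) (valN (D y.1) (x y.1) (R y.1) y.2) i) := by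
    intro R hR
    have h0 : Primrec fun y : ((α × ℕ) × (ℕ ⊕ ℕ)) × ℕ => y.1.1.1 :=
      Primrec.fst.comp (Primrec.fst.comp Primrec.fst)
    refine (Primrec.sumCasesOn Primrec.snd
      (primrec_valN (hD.comp h0) (hx.comp h0) (hR.comp h0) (hR.comp h0) Primrec.snd).to₂
      (primrec_valN (hD.comp h0) (hx.comp h0) (hR.comp h0)
        (Primrec.snd.comp (Primrec.fst.comp Primrec.fst)) Primrec.snd).to₂).of_eq fun y => ?_
    rcases y.2 with i | i <;> rfl
  refine primrecPred_exists_lt (primrec_pow.comp hD hz)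
    ((primrecPred_forall_lt (hz.comp Primrec.fst) (Primrec.nat_le.comp
      (primrec_dig (hD.comp (Primrec.fst.comp Primrec.fst)) (Primrec.snd.comp Primrec.fst)
        Primrec.snd) ((primrec_dig hD hP hx).comp (Primrec.fst.comp Primrec.fst)))).and
    ((primrecPred_holds (hψ.comp Primrec.fst) (key hP) (hN.comp Primrec.fst) fun y => hN0 y.1).and
    (primrecPred_holds (hψ'.comp Primrec.fst) (key hQ) (hN.comp Primrec.fst) fun y => hN0 y.1)))

end Digits

/-! ### Primitive recursiveness of the parameters and of the rules. -/

section Codes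

theorem primrec_srcLoc : Primrec srcLoc :=
  Primrec.fst.comp (Primrec.unpair.comp (Primrec.fst.comp (Primrec.unpair.comp Primrec.pred)))

theorem primrec_srcTup : Primrec srcTup :=
  Primrec.snd.comp (Primrec.unpair.comp (Primrec.fst.comp (Primrec.unpair.comp Primrec.pred)))

theorem primrec_tgtLoc : Primrec tgtLoc :=
  Primrec.fst.comp (Primrec.unpair.comp (Primrec.snd.comp (Primrec.unpair.comp Primrec.pred)))

theorem primrec_tgtTup : Primrec tgtTup :=
  Primrec.snd.comp (Primrec.unpair.comp (Primrec.snd.comp (Primrec.unpair.comp Primrec.pred)))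

namespace TPDACode

theorem primrec_locs : Primrec locs :=
  Primrec.fst.comp (Primrec.snd.comp (Primrec.snd.comp Primrec.fst))

theorem primrec_clocks : Primrec clocks :=
  Primrec.fst.comp (Primrec.snd.comp (Primrec.snd.comp (Primrec.snd.comp Primrec.fst)))

theorem primrec_frame : Primrec frame :=
  Primrec.snd.comp (Primrec.snd.comp (Primrec.snd.comp (Primrec.snd.comp Primrec.fst)))

theorem primrec_modulus : Primrec modulus := primrec_factorial.comp Primrec.encode

theorem primrec_thr : Primrec thr :=
  Primrec.nat_mul.comp (primrec_pow.comp (Primrec.const 3) primrec_frame)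
    (Primrec.nat_add.comp (Primrec.nat_add.comp Primrec.encode (Primrec.const 2)) primrec_modulus)

theorem primrec_clocks_frame : Primrec fun c : TPDACode => 3 * (c.clocks + 1) + c.frame :=
  Primrec.nat_add.comp
    (Primrec.nat_mul.comp (Primrec.const 3) (Primrec.succ.comp primrec_clocks)) primrec_frame

theorem primrec_den : Primrec den := Primrec.succ.comp primrec_clocks_frame

theorem primrec_base : Primrec base :=
  Primrec.nat_mul.comp (Primrec.nat_mul.comp primrec_clocks_frame
    (Primrec.succ.comp (Primrec.nat_add.comp primrec_thr primrec_modulus))) primrec_den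

theorem primrec_width : Primrec width :=
  Primrec.nat_add.comp (Primrec.nat_add.comp primrec_locs
    (primrec_pow.comp primrec_base (Primrec.succ.comp primrec_clocks)))
    (Primrec.fst.comp Primrec.fst)

theorem primrec_bound : Primrec bound := by
  have h : Primrec fun c : TPDACode => Nat.pair c.width c.width :=
    Primrec₂.natPair.comp primrec_width primrec_width
  exact Primrec.nat_add.comp (Primrec.succ.comp (Primrec₂.natPair.comp h h)) (Primrec.const 3)

section

variable {α : Type*} [Primcodable α] {c : α → TPDACode} {ℓ r k A B C : α → ℕ}

theorem primrecPred_popRule (hc : Primrec c) (hA : Primrec A) (hB : Primrec B) :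
    PrimrecPred fun y => ∃ ρ ∈ (c y).2, ρ.1 = srcLoc (A y) ∧ ρ.2.2 = srcLoc (B y) ∧
      ∃ ρ' ∈ (c y).2, ρ'.1 = tgtLoc (B y) ∧ ρ'.2.2 = tgtLoc (A y) ∧
        ∃ a ∈ ρ.2.1.pushes, ∃ b ∈ ρ'.2.1.pops, a.1 = b.1 ∧
          FrameN (c y).den (c y).base (c y).clocks (c y).frame a.2 b.2
            (srcTup (A y)) (tgtTup (A y)) := by
  have hL := Primrec.snd.comp hc
  have heq₁ : ∀ {g : α → ℕ}, Primrec g →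
      PrimrecPred fun y : α × (ℕ × OpCode × ℕ) => y.2.1 = g y.1 := fun hg =>
    Primrec.eq.comp (Primrec.fst.comp Primrec.snd) (hg.comp Primrec.fst)
  have heq₂ : ∀ {g : α → ℕ}, Primrec g →
      PrimrecPred fun y : α × (ℕ × OpCode × ℕ) => y.2.2.2 = g y.1 := fun hg =>
    Primrec.eq.comp (Primrec.snd.comp (Primrec.snd.comp Primrec.snd)) (hg.comp Primrec.fst)
  have hsub : Primrec fun y : (α × (ℕ × OpCode × ℕ)) × (ℕ × OpCode × ℕ) => (y.1.1, y.2) :=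
    Primrec.pair (Primrec.fst.comp Primrec.fst) Primrec.snd
  refine primrecPred_exists_mem hL ((heq₁ (primrec_srcLoc.comp hA)).and
    ((heq₂ (primrec_srcLoc.comp hB)).and (primrecPred_exists_mem (hL.comp Primrec.fst)
    (((heq₁ (primrec_tgtLoc.comp hB)).comp hsub).and
    (((heq₂ (primrec_tgtLoc.comp hA)).comp hsub).and
    (primrecPred_exists_mem ?_ (primrecPred_exists_mem ?_ ((Primrec.eq.comp
      (Primrec.fst.comp (Primrec.snd.comp Primrec.fst)) (Primrec.fst.comp Primrec.snd)).and
      ?_))))))))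
  · exact (primrec_op_pushes_pops
      (Primrec.fst.comp (Primrec.snd.comp (Primrec.snd.comp Primrec.fst)))).1
  · exact (primrec_op_pushes_pops (Primrec.fst.comp (Primrec.snd.comp
      (Primrec.snd.comp Primrec.fst)))).2
  · have h0 : Primrec fun y : (((α × (ℕ × OpCode × ℕ)) × (ℕ × OpCode × ℕ)) ×
        (ℕ × Constraint (ℕ ⊕ ℕ))) × (ℕ × Constraint (ℕ ⊕ ℕ)) => y.1.1.1.1 :=
      Primrec.fst.comp (Primrec.fst.comp (Primrec.fst.comp Primrec.fst))
    exact primrecPred_frameN (primrec_den.comp (hc.comp h0)) (fun y => den_pos _)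
      (primrec_base.comp (hc.comp h0)) (primrec_clocks.comp (hc.comp h0))
      (primrec_frame.comp (hc.comp h0)) (Primrec.snd.comp (Primrec.snd.comp Primrec.fst))
      (Primrec.snd.comp Primrec.snd) (primrec_srcTup.comp (hA.comp h0))
      (primrec_tgtTup.comp (hA.comp h0))

theorem primrecPred_ruleOk (hc : Primrec c) (hℓ : Primrec ℓ) (hr : Primrec r) (hk : Primrec k)
    (hA : Primrec A) (hB : Primrec B) (hC : Primrec C) :
    PrimrecPred fun y => RuleOk (c y) (ℓ y) (r y) (k y) (A y) (B y) (C y) := by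
  have hL := Primrec.snd.comp hc
  have hx := primrec_clocks.comp hc
  have hx1 := Primrec.succ.comp hx
  have hD := primrec_base.comp hc
  have hkn : ∀ n, PrimrecPred fun y => k y = n := fun n => Primrec.eq.comp hk (Primrec.const n)
  have hne : ∀ {f : α → ℕ}, Primrec f → PrimrecPred fun y => f y ≠ 0 := fun hf =>
    (Primrec.eq.comp hf (Primrec.const 0)).not
  have sℓ : ∀ {f : α → ℕ}, Primrec f → Primrec fun y => srcLoc (f y) := primrec_srcLoc.comp
  have sP : ∀ {f : α → ℕ}, Primrec f → Primrec fun y => srcTup (f y) := primrec_srcTup.comp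
  have tℓ : ∀ {f : α → ℕ}, Primrec f → Primrec fun y => tgtLoc (f y) := primrec_tgtLoc.comp
  have tP : ∀ {f : α → ℕ}, Primrec f → Primrec fun y => tgtTup (f y) := primrec_tgtTup.comp
  have heq : ∀ {f g : α → ℕ}, Primrec f → Primrec g → PrimrecPred fun y => f y = g y :=
    Primrec.eq.comp
  have hvalid := primrecPred_validN hD hx (sP hA) (tP hA)
  have hsame := primrecPred_sameN hD hx1 (sP hA) (tP hA)
  have heps : PrimrecPred fun y => ∃ ρ ∈ (c y).2, ρ.1 = srcLoc (A y) ∧ ρ.2.2 = tgtLoc (A y) ∧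
      EpsN (c y).den (c y).base (c y).clocks ρ.2.1 (srcTup (A y)) (tgtTup (A y)) :=
    primrecPred_exists_mem hL
      ((Primrec.eq.comp (Primrec.fst.comp Primrec.snd) ((sℓ hA).comp Primrec.fst)).and
      ((Primrec.eq.comp (Primrec.snd.comp (Primrec.snd.comp Primrec.snd))
        ((tℓ hA).comp Primrec.fst)).and
      (primrecPred_epsN (primrec_den.comp (hc.comp Primrec.fst)) (fun y => den_pos _)
        (hD.comp Primrec.fst) (hx.comp Primrec.fst)
        (Primrec.fst.comp (Primrec.snd.comp Primrec.snd))
        ((sP hA).comp Primrec.fst) ((tP hA).comp Primrec.fst))))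
  have hread : PrimrecPred fun y => ∃ ρ ∈ (c y).2,
      ρ = (srcLoc (A y), Op.input (some (B y)), tgtLoc (A y)) :=
    primrecPred_exists_mem hL (Primrec.eq.comp Primrec.snd
      ((Primrec.pair (sℓ hA) (Primrec.pair (primrec_op_input (Primrec.option_some.comp hB))
        (tℓ hA))).comp Primrec.fst))
  have h1 := (hkn 0).and ((hne hA).and (hvalid.and (((heq (sℓ hA) (tℓ hA)).and
    ((Primrec.nat_lt.comp (sℓ hA) (primrec_locs.comp hc)).and hsame)).or heps)))
  have h2 := (hkn 1).and ((hne hA).and (hvalid.and (hsame.and hread)))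
  have h3 := (hkn 2).and ((heq hA (Primrec.const 0)).and ((hne hB).and ((heq (sℓ hB) hℓ).and
    ((heq (tℓ hB) hr).and ((primrecPred_constN hD hx (sP hB)).and
    (primrecPred_constN hD hx (tP hB)))))))
  have h4 := (hkn 2).and ((hne hA).and ((hne hB).and ((heq (sℓ hB) (sℓ hA)).and
    ((heq (tℓ hB) (tℓ hA)).and (primrecPred_equiN (primrec_thr.comp hc) (primrec_modulus.comp hc)
      (primrec_den.comp hc) hD hx (sP hA) (tP hA) (sP hB) (tP hB))))))
  have h5 := (hkn 2).and ((hne hA).and ((hne hB).and ((heq (sP hB) (sP hA)).and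
    ((heq (tP hB) (tP hA)).and (primrecPred_popRule hc hA hB)))))
  have h6 := (Primrec.nat_le.comp (Primrec.const 3) hk).and ((hne hA).and ((hne hB).and
    ((hne hC).and ((heq (sℓ hB) (sℓ hA)).and ((heq (sP hB) (sP hA)).and
    ((heq (sℓ hC) (tℓ hB)).and ((heq (sP hC) (tP hB)).and ((heq (tℓ hC) (tℓ hA)).and
    (heq (tP hC) (tP hA))))))))))
  exact h1.or (h2.or (h3.or (h4.or (h5.or h6))))

theorem primrec_rhs (hk : Primrec k) (hB : Primrec B) (hC : Primrec C) :
    Primrec fun y => rhs (k y) (B y) (C y) := by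
  have hkn : ∀ n, PrimrecPred fun y => k y = n := fun n => Primrec.eq.comp hk (Primrec.const n)
  exact Primrec.ite (hkn 0) (Primrec.const [])
    (Primrec.ite (hkn 1) (Primrec.list_cons.comp (Primrec.sumInl.comp hB) (Primrec.const []))
    (Primrec.ite (hkn 2) (Primrec.list_cons.comp (Primrec.sumInr.comp hB) (Primrec.const []))
    (Primrec.list_cons.comp (Primrec.sumInr.comp hB)
      (Primrec.list_cons.comp (Primrec.sumInr.comp hC) (Primrec.const [])))))

end

theorem computable_toGrammar :
    Computable fun y : TPDACode × ℕ × ℕ => toGrammar y.1 y.2.1 y.2.2 := by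
  classical
  refine Primrec.to_comp ?_
  have hb := primrec_bound.comp (Primrec.fst (α := TPDACode) (β := ℕ × ℕ))
  have hk : Primrec fun p : (TPDACode × ℕ × ℕ) × ℕ => p.2.unpair.1 :=
    Primrec.fst.comp (Primrec.unpair.comp Primrec.snd)
  have h1 : Primrec fun p : (TPDACode × ℕ × ℕ) × ℕ => p.2.unpair.2.unpair :=
    Primrec.unpair.comp (Primrec.snd.comp (Primrec.unpair.comp Primrec.snd))
  have h2 : Primrec fun p : (TPDACode × ℕ × ℕ) × ℕ => p.2.unpair.2.unpair.2.unpair :=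
    Primrec.unpair.comp (Primrec.snd.comp h1)
  have hok := primrecPred_ruleOk (Primrec.fst.comp Primrec.fst)
    (Primrec.fst.comp (Primrec.snd.comp Primrec.fst))
    (Primrec.snd.comp (Primrec.snd.comp Primrec.fst)) hk (Primrec.fst.comp h1)
    (Primrec.fst.comp h2) (Primrec.snd.comp h2)
  refine (Primrec.pair (Primrec.const 0) (Primrec.list_map (Primrec.listFilterMap
    (Primrec.list_range.comp (Primrec.succ.comp (Primrec₂.natPair.comp hb (Primrec₂.natPair.comp hb
      (Primrec₂.natPair.comp hb hb)))))
    (Primrec.ite hok (Primrec.option_some.comp Primrec.snd) (Primrec.const none)).to₂)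
    (Primrec.pair (Primrec.fst.comp h1)
      (primrec_rhs hk (Primrec.fst.comp h2) (Primrec.snd.comp h2))).to₂)).of_eq fun y => ?_
  rw [toGrammar, ← List.filterMap_eq_filter]
  simp only [Option.guard, decide_eq_true_eq]

end TPDACode

end Codes

/-! ### Inverse images of context-free languages -/

section ContextFree

variable {T T' N N' : Type*} {g : ContextFreeGrammar T} {g' : ContextFreeGrammar T'}

theorem ContextFreeRule.Rewrites.map {r : ContextFreeRule T N} {r' : ContextFreeRule T' N'}
    {σ : Symbol T N → Symbol T' N'} (h : σ (.nonterminal r.input) = .nonterminal r'.input)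
    (h' : r.output.map σ = r'.output) {u v : List (Symbol T N)} (hr : r.Rewrites u v) :
    r'.Rewrites (u.map σ) (v.map σ) := by
  induction hr with
  | head s => rw [List.map_cons, List.map_append, h, h']; exact .head _
  | cons x _ ih => exact .cons _ ih

theorem ContextFreeGrammar.Derives.map {σ : Symbol T g.NT → Symbol T' g'.NT}
    (hσ : ∀ r ∈ g.rules, ∃ r' ∈ g'.rules,
      σ (.nonterminal r.input) = .nonterminal r'.input ∧ r.output.map σ = r'.output)
    {u v : List (Symbol T g.NT)} (h : g.Derives u v) : g'.Derives (u.map σ) (v.map σ) := by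
  induction h with
  | refl => exact .refl _
  | tail _ hp ih =>
    obtain ⟨r, hr, hrw⟩ := hp
    obtain ⟨r', hr', h1, h2⟩ := hσ r hr
    exact ih.trans_produces ⟨r', hr', ContextFreeRule.Rewrites.map h1 h2 hrw⟩

-- Terminals outside the range of `f` become nonterminals without rules, which can never be
-- eliminated. The symbol maps `σ` and `τ` carry rules to rules, hence derivations to derivations,
-- in the two directions.
open Classical in
theorem isContextFree_preimage {T : Type} {S : Type*} (f : S → T) (hf : Function.Injective f)
    (g : ContextFreeGrammar T) :
    Language.IsContextFree {w : List S | w.map f ∈ g.language} := by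
  let σ : Symbol T g.NT → Symbol S (g.NT ⊕ T)
    | .terminal t => if h : ∃ s, f s = t then .terminal h.choose else .nonterminal (.inr t)
    | .nonterminal A => .nonterminal (.inl A)
  let τ : Symbol S (g.NT ⊕ T) → Symbol T g.NT
    | .terminal s => .terminal (f s)
    | .nonterminal (.inl A) => .nonterminal A
    | .nonterminal (.inr t) => .terminal t
  have hτσ : τ ∘ σ = id := by
    funext a
    rcases a with t | A
    · by_cases h : ∃ s, f s = t
      · simp only [Function.comp, σ, dif_pos h, τ, h.choose_spec, id]
      · simp only [Function.comp, σ, dif_neg h, τ, id]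
    · rfl
  have hσ : ∀ s, σ (.terminal (f s)) = .terminal s := fun s => by
    have h : ∃ s', f s' = f s := ⟨s, rfl⟩
    simp only [σ, dif_pos h, hf h.choose_spec]
  let R : ContextFreeRule T g.NT → ContextFreeRule S (g.NT ⊕ T) := fun r =>
    ⟨.inl r.input, r.output.map σ⟩
  let g' : ContextFreeGrammar S := ⟨g.NT ⊕ T, .inl g.initial, g.rules.image R⟩
  refine ⟨g', Set.ext fun w => ⟨fun h => ?_, fun h => ?_⟩⟩
  · have := ContextFreeGrammar.Derives.map (g := g') (g' := g) (σ := τ) (fun r hr => ?_) h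
    · rw [List.map_map] at this
      change g.Derives [.nonterminal g.initial] ((w.map f).map .terminal)
      rw [List.map_map]
      exact this
    · obtain ⟨r₀, hr₀, rfl⟩ := Finset.mem_image.1 hr
      exact ⟨r₀, hr₀, rfl, by simp only [R, List.map_map, hτσ, List.map_id]⟩
  · have := ContextFreeGrammar.Derives.map (g := g) (g' := g') (σ := σ)
      (fun r hr => ⟨R r, Finset.mem_image_of_mem R hr, rfl, rfl⟩) h
    rw [List.map_map, List.map_map] at this
    have e : (σ ∘ Symbol.terminal) ∘ f = Symbol.terminal := funext hσ
    change g'.Derives [.nonterminal (.inl g.initial)] (w.map .terminal)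
    rw [← e]
    exact this

end ContextFree

/-! ### Renaming -/

section Renaming

variable {S G L X Z S' G' L' X' Z' : Type*}

/-- Renaming of letters, stack symbols, locations and clocks. -/
def TPDA.map (s : S → S') (g : G → G') (l : L → L') (x : X → X') (z : Z → Z')
    (P : TPDA S G L X Z) : TPDA S' G' L' X' Z' :=
  ⟨P.rules.map fun ρ => (l ρ.1, ρ.2.1.map s g x z, l ρ.2.2)⟩

theorem Constraint.map_map_of_inverse {V W : Type*} {f : V → W} {f' : W → V}
    (h : Function.LeftInverse f' f) (φ : Constraint V) : (φ.map f).map f' = φ := by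
  induction φ with
  | tru => rfl
  | atom a => cases a <;> simp only [Constraint.map, Atom.map, h _]
  | neg φ ih => simp only [Constraint.map, ih]
  | conj φ ψ ih ih' => simp only [Constraint.map, ih, ih']
  | disj φ ψ ih ih' => simp only [Constraint.map, ih, ih']

theorem Op.map_map_symm (s : S ≃ S') (g : G ≃ G') (x : X ≃ X') (z : Z ≃ Z') (op : Op S G X Z) :
    (op.map s g x z).map s.symm g.symm x.symm z.symm = op := by
  have h : Function.LeftInverse (Sum.map x.symm z.symm) (Sum.map x z) := fun v => by
    rcases v with v | v <;> simp
  cases op with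
  | test φ => exact congrArg Op.test (Constraint.map_map_of_inverse x.left_inv φ)
  | _ => simp [Op.map, Constraint.map_map_of_inverse h]

theorem TPDA.map_map_symm (s : S ≃ S') (g : G ≃ G') (l : L ≃ L') (x : X ≃ X') (z : Z ≃ Z')
    (P : TPDA S G L X Z) :
    (P.map s g l x z).map s.symm g.symm l.symm x.symm z.symm = P := by
  obtain ⟨rules⟩ := P
  simp only [TPDA.map, List.map_map, TPDA.mk.injEq]
  refine (List.map_congr_left fun ρ _ => ?_).trans (List.map_id _)
  simp [Op.map_map_symm]

/-- Renaming of letters in labels. -/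
def Label.map (s : S → S') : Label S → Label S'
  | .delay δ => .delay δ
  | .letter a => .letter (a.map s)

/-- Renaming of stack symbols, locations and clocks in configurations. -/
def Config.map (g : G → G') (l : L → L') (x : X' → X) (z : Z' → Z) (c : Config G L X Z) :
    Config G' L' X' Z' :=
  -- Valuations are functions on clocks, so clocks are renamed contravariantly.
  ⟨l c.loc, c.val ∘ x, c.stack.map fun p => (g p.1, p.2 ∘ z)⟩

theorem timedWordFrom_map (s : S → S') (δ : NNRat) (w : List (Label S)) :
    (timedWordFrom δ (w.map (Label.map s))).map Prod.snd =
      ((timedWordFrom δ w).map Prod.snd).map s := by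
  induction w generalizing δ with
  | nil => rfl
  | cons a w ih =>
    rcases a with δ' | _ | a
    · exact ih _
    · exact ih _
    · exact congrArg (s a :: ·) (ih _)

variable (s : S ≃ S') (g : G ≃ G') (l : L ≃ L') (x : X ≃ X') (z : Z ≃ Z') {P : TPDA S G L X Z}

theorem TPDA.Step.map {c d : Config G L X Z} {a : Label S} (h : P.Step c a d) :
    (P.map s g l x z).Step (c.map g l x.symm z.symm) (a.map s) (d.map g l x.symm z.symm) := by
  have hrule : ∀ {ℓ op r}, (ℓ, op, r) ∈ P.rules →
      (l ℓ, op.map s g x z, l r) ∈ (P.map s g l x z).rules := fun h =>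
    List.mem_map_of_mem (f := fun ρ : L × Op S G X Z × L =>
      (l ρ.1, ρ.2.1.map s g x z, l ρ.2.2)) h
  have hframe : ∀ {ψ : Constraint (X ⊕ Z)} {μ : Valuation X} {ζ : Valuation Z},
      ψ.Holds (Sum.elim μ ζ) →
      (ψ.map (Sum.map x z)).Holds (Sum.elim (μ ∘ x.symm) (ζ ∘ z.symm)) := fun {ψ μ ζ} h => by
    rw [Constraint.holds_map]
    convert h using 2 with v
    rcases v with v | v <;> simp
  cases h with
  | elapse μ u δ h =>
    have := TPDA.Step.elapse (P := P.map s g l x z) (μ ∘ x.symm)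
      (u.map fun p => (g p.1, p.2 ∘ z.symm)) δ (hrule h)
    have e : stackElapse (u.map fun p => (g p.1, p.2 ∘ z.symm)) δ =
        (stackElapse u δ).map fun p => (g p.1, p.2 ∘ z.symm) := by
      simp only [stackElapse, List.map_map]
      rfl
    rw [e] at this
    exact this
  | input μ u a h => exact .input _ _ _ (hrule h)
  | test μ u φ h hφ =>
    refine .test _ _ _ (hrule h) ?_
    rw [Constraint.holds_map]
    simpa using hφ
  | reset μ u Y h =>
    have := TPDA.Step.reset (P := P.map s g l x z) (μ ∘ x.symm)
      (u.map fun p => (g p.1, p.2 ∘ z.symm)) _ (hrule h)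
    have e : Valuation.reset (μ ∘ x.symm) (Y.map x) = Valuation.reset μ Y ∘ x.symm := by
      funext i
      simp only [Function.comp, Valuation.reset]
      congr 1
      refine propext (List.mem_map.trans ⟨fun ⟨j, hj, e⟩ => ?_, fun h => ?_⟩)
      · rwa [← e, x.symm_apply_apply]
      · exact ⟨_, h, x.apply_symm_apply i⟩
    rw [e] at this
    exact this
  | push μ u γ ψ ζ h hψ => exact .push _ _ _ _ _ (hrule h) (hframe hψ)
  | pop μ u γ ψ ζ h hψ => exact .pop _ _ _ _ _ (hrule h) (hframe hψ)

theorem TPDA.Run.map {c d : Config G L X Z} {w : List (Label S)} (h : P.Run c w d) :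
    (P.map s g l x z).Run (c.map g l x.symm z.symm) (w.map (Label.map s))
      (d.map g l x.symm z.symm) := by
  induction h with
  | nil c => exact .nil _
  | cons h _ ih => exact .cons (h.map s g l x z) ih

theorem TPDA.map_mem_untimedLanguage {ℓ r : L} {v : List S} (h : v ∈ P.untimedLanguage ℓ r) :
    v.map s ∈ (P.map s g l x z).untimedLanguage (l ℓ) (l r) := by
  obtain ⟨t, ⟨w, hw, rfl⟩, rfl⟩ := h
  exact ⟨_, ⟨_, hw.map s g l x z, rfl⟩, timedWordFrom_map s 0 w⟩

theorem TPDA.map_mem_untimedLanguage_iff {ℓ r : L} {v : List S} :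
    v.map s ∈ (P.map s g l x z).untimedLanguage (l ℓ) (l r) ↔ v ∈ P.untimedLanguage ℓ r := by
  refine ⟨fun h => ?_, TPDA.map_mem_untimedLanguage s g l x z⟩
  -- The converse is the same inclusion for the inverse renaming.
  have := TPDA.map_mem_untimedLanguage s.symm g.symm l.symm x.symm z.symm h
  simpa [TPDA.map_map_symm] using this

end Renaming

/-- After numbering all the finite sets, the language is the inverse image of that of a coded
grammar under an injective map of letters into `ℕ`. -/
theorem TPDA.isContextFree_untimedLanguage {S G L X Z : Type*} [Finite S] [Finite G] [Finite L]
    [Finite X] [Finite Z] (P : TPDA S G L X Z) (ℓ r : L) :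
    (P.untimedLanguage ℓ r).IsContextFree := by
  obtain ⟨_, ⟨s⟩⟩ := Finite.exists_equiv_fin S
  obtain ⟨_, ⟨g⟩⟩ := Finite.exists_equiv_fin G
  obtain ⟨_, ⟨l⟩⟩ := Finite.exists_equiv_fin L
  obtain ⟨_, ⟨x⟩⟩ := Finite.exists_equiv_fin X
  obtain ⟨_, ⟨z⟩⟩ := Finite.exists_equiv_fin Z
  have hinj := Fin.val_injective.comp s.injective
  have h := isContextFree_preimage _ hinj
    ((P.map s g l x z).code.toGrammar (l ℓ).val (l r).val).grammar
  rw [TPDA.language_toGrammar] at h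
  refine (congrArg Language.IsContextFree ?_).mpr h
  refine Set.ext fun v => (TPDA.map_mem_untimedLanguage_iff s g l x z).symm.trans ?_
  change _ ↔ v.map (Fin.val ∘ s) ∈
    List.map Fin.val '' ((P.map s g l x z).untimedLanguage (l ℓ) (l r))
  rw [← List.map_map]
  exact Fin.val_injective.list_map.mem_set_image.symm

end TimedPushdown

theorem mainTheorem2 :
    (∀ (S G L X Z : Type*) [Finite S] [Finite G] [Finite L] [Finite X] [Finite Z]
      (P : TimedPushdown.TPDA S G L X Z) (ℓ r : L), (P.untimedLanguage ℓ r).IsContextFree) ∧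
    ∃ f : TimedPushdown.TPDACode × ℕ × ℕ → TimedPushdown.GrammarCode, Computable f ∧
      ∀ (s g l x z : ℕ) (P : TimedPushdown.TPDA (Fin s) (Fin g) (Fin l) (Fin x) (Fin z))
        (ℓ r : Fin l),
        (TimedPushdown.GrammarCode.grammar (f (P.code, ℓ.val, r.val))).language =
          Language.map Fin.val (P.untimedLanguage ℓ r) :=
  ⟨fun _ _ _ _ _ _ _ _ _ _ P ℓ r => P.isContextFree_untimedLanguage ℓ r,
    fun y => y.1.toGrammar y.2.1 y.2.2, TimedPushdown.TPDACode.computable_toGrammar,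
    fun _ _ _ _ _ P ℓ r => P.language_toGrammar ℓ r⟩
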